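/- **Theorem (Colombini–Orrù–Pernazza).** Let $I\subseteq\mathbb{R}$ be an open interval, and for $t\in I$ let $$P_a(t)(Z)=Z^n+\sum_{j=1}^n a_j(t)\,Z^{n-j}$$ be a monic polynomial with real coefficients all of whose complex roots are real. Let $p$ be the maximal multiplicity of the roots of the polynomials $P_a(t)$, over all $t\in I$, and suppose that the coefficients $a_1,\dots,a_n$ are of class $C^p$ on $I$. A *root* of $P_a$ is a function $\lambda:I\to\mathbb{R}$ with $P_a(t)(\lambda(t))=0$ for all $t\in I$; a *system of the roots* is an $n$-tuple $(\lambda_1,\dots,\lambda_n)$ of functions $I\to\mathbb{R}$ with $P_a(t)(Z)=\prod_{j=1}^n(Z-\lambda_j(t))$ for all $t\in I$. Write $f'^-(t_0)$ and $f'^+(t_0)$ for the left and right derivatives of $f$ at $t_0$. Then: 1. Any continuous root $\lambda$ of $P_a$ has both (finite) one-sided derivatives at every $t\in I$. 2. For any continuous root $\lambda$, these derivatives are continuous in the following sense: for every $t_0\in I$, $$\lim_{t\to t_0^-}\lambda'^{\pm}(t)=\lambda'^-(t_0),\qquad \lim_{t\to t_0^+}\lambda'^{\pm}(t)=\lambda'^+(t_0).$$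 3. There exists a system of the roots $(\lambda_1,\dots,\lambda_n)$ with every $\lambda_j$ differentiable on $I$. 4. Any root that is differentiable on $I$ is of class $C^1$ on $I$. -/

import Mathlib

open Set Filter Topology Polynomial

namespace HyperbolicCurve

/-- The monic polynomial `Z ^ n + ∑_{j=1}^{n} a_j Z ^ (n - j)`; the coefficient `a_j` of the usual
notation, `1 ≤ j ≤ n`, is `a ⟨j - 1, _⟩` here. -/
noncomputable def monicPoly {n : ℕ} (a : Fin n → ℝ) : ℝ[X] :=
  X ^ n + ∑ j : Fin n, C (a j) * X ^ (n - (j.val + 1))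

/-- A real polynomial is hyperbolic if all its complex roots are real. -/
def IsHyperbolic (P : ℝ[X]) : Prop :=
  ∀ z : ℂ, aeval z P = 0 → z.im = 0

/-- `a` is the coefficient vector of a `C ^ k` curve of monic hyperbolic polynomials of degree `n`,
parameterized by the (open) set `I`. -/
structure IsHyperbolicCurve {n : ℕ} (k : ℕ) (I : Set ℝ) (a : Fin n → ℝ → ℝ) : Prop where
  contDiffOn : ∀ j, ContDiffOn ℝ k (a j) I
  hyperbolic : ∀ t ∈ I, IsHyperbolic (monicPoly fun j => a j t)

/-- `p` is the maximal multiplicity of the roots of the polynomials `P_a(t)`, `t ∈ I`. -/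
def IsMaximalMultiplicity {n : ℕ} (I : Set ℝ) (a : Fin n → ℝ → ℝ) (p : ℕ) : Prop :=
  IsGreatest {m : ℕ | ∃ t ∈ I, ∃ x : ℝ, (monicPoly fun j => a j t).IsRoot x ∧
    (monicPoly fun j => a j t).rootMultiplicity x = m} p

/-- `r` is a root of the curve: `P_a(t)(r(t)) = 0` for all `t ∈ I`. -/
def IsRootCurve {n : ℕ} (I : Set ℝ) (a : Fin n → ℝ → ℝ) (r : ℝ → ℝ) : Prop :=
  ∀ t ∈ I, (monicPoly fun j => a j t).IsRoot (r t)

/-- `r` is a system of the roots: `P_a(t)(Z) = ∏_j (Z - r_j(t))` for all `t ∈ I`. -/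
def IsRootSystem {n : ℕ} (I : Set ℝ) (a : Fin n → ℝ → ℝ) (r : Fin n → ℝ → ℝ) : Prop :=
  ∀ t ∈ I, (monicPoly fun j => a j t) = ∏ j : Fin n, (X - C (r j t))

/-- The left derivative of `f` at `t`. -/
noncomputable def leftDeriv (f : ℝ → ℝ) (t : ℝ) : ℝ := derivWithin f (Iio t) t

/-- The right derivative of `f` at `t`. -/
noncomputable def rightDeriv (f : ℝ → ℝ) (t : ℝ) : ℝ := derivWithin f (Ioi t) t

end HyperbolicCurve

/-! The engine is Bronshtein's theorem (`exists_rootBound`): a continuous root of a `C ^ n`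
hyperbolic curve of degree `n` satisfies `|f t - f 0| ≤ C * |t|` near `0`, with `C` depending only
on `n`, the interval radius and the `C ^ n` bound. The proof is by induction on the degree. After
centring, `-2 * a 1` is the sum of the squares of the roots. Scaling roots and time by the square
root of its value at `0` makes that sum equal to `1` at `0` while keeping uniform `C ^ n` bounds.
The roots at `0` then do not all coincide, so the polynomial splits smoothly into factors of lower
degree, and compactness makes the constants uniform.

Near `t₀`, split off the factor `B` of the roots close to a root `x` of multiplicity `q ≤ p`; with
`x` moved to the origin, `B` is a `C ^ q` curve of degree `q` with `B 0 = 0`. Bronshtein's bound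
makes its roots `O(h)`, so its coefficients vanish to the orders that let the polynomial with roots
divided by `h` converge to one limit `c` from both sides (`exists_scaled_limit`). A continuous root
divided by `h` stays near the finite root set of `c`, so it cannot oscillate, and one-sided
derivatives exist. In the time `u = log h` the rescaled curve tends to `c` and its derivatives of
orders `1, …, q` tend to `0`. A scaled form of Bronshtein's bound then gives `f h / h` a vanishing
local Lipschitz constant in `u` (`eventually_root_variation_le`), which is the continuity of the
one-sided derivatives. A differentiable root is therefore `C ^ 1`.

Since `c` is the same from both sides, left and right slopes at `t₀` agree as multisets, and
permuting the branches after `t₀` makes a continuous system differentiable there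
(`exists_perm_slopes`). This handles finitely many points. The remainder at `t₀` is bounded
independently of the root (`eventually_abs_sub_sub_le`), so an ultrafilter limit over finite sets of
points is differentiable everywhere. -/

namespace HyperbolicCurve

/-! ### Monic polynomials and their coefficient vectors -/

lemma monicPoly_eval {n : ℕ} (a : Fin n → ℝ) (z : ℝ) :
    (monicPoly a).eval z = z ^ n + ∑ j : Fin n, a j * z ^ (n - (j.val + 1)) := by
  simp [monicPoly, eval_finsetSum]

lemma degree_sum_lt {n : ℕ} (a : Fin n → ℝ) :
    (∑ j : Fin n, C (a j) * X ^ (n - (j.val + 1)) : ℝ[X]).degree < n := by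
  refine (Polynomial.degree_sum_le _ _).trans_lt ?_
  refine (Finset.sup_lt_iff (by exact_mod_cast WithBot.bot_lt_coe n)).2 fun j _ => ?_
  refine (degree_C_mul_X_pow_le _ _).trans_lt ?_
  exact_mod_cast (by omega : n - (j.val + 1) < n)

lemma monicPoly_monic {n : ℕ} (a : Fin n → ℝ) : (monicPoly a).Monic := by
  unfold monicPoly
  exact monic_X_pow_add (degree_sum_lt a)

lemma monicPoly_natDegree {n : ℕ} (a : Fin n → ℝ) : (monicPoly a).natDegree = n := by
  apply natDegree_eq_of_degree_eq_some
  unfold monicPoly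
  rw [degree_add_eq_left_of_degree_lt] <;> simp [degree_sum_lt a]

lemma monicPoly_coeff {n : ℕ} (a : Fin n → ℝ) (j : Fin n) :
    (monicPoly a).coeff (n - (j.val + 1)) = a j := by
  have h : n - (j.val + 1) ≠ n := by omega
  simp only [monicPoly, coeff_add, coeff_X_pow, h, if_false, finsetSum_coeff, coeff_C_mul, zero_add]
  rw [Finset.sum_eq_single j]
  · simp
  · intro b _ hb
    have : n - (j.val + 1) ≠ n - (b.val + 1) := by
      intro h'; apply hb; ext; omega
    simp [this]
  · simp

/-- The non-leading coefficients of a polynomial, regarded as monic of degree `n`. -/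
noncomputable def coeffVec (n : ℕ) (Q : ℝ[X]) : Fin n → ℝ := fun j => Q.coeff (n - (j.val + 1))

lemma coeffVec_monicPoly {n : ℕ} (a : Fin n → ℝ) : coeffVec n (monicPoly a) = a :=
  funext fun j => monicPoly_coeff a j

lemma monicPoly_injective {n : ℕ} : Function.Injective (monicPoly : (Fin n → ℝ) → ℝ[X]) :=
  Function.LeftInverse.injective coeffVec_monicPoly

lemma monicPoly_coeffVec {n : ℕ} {Q : ℝ[X]} (hQ : Q.Monic) (hn : Q.natDegree = n) :
    monicPoly (coeffVec n Q) = Q := by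
  ext i
  rcases lt_trichotomy i n with hi | rfl | hi
  · have := monicPoly_coeff (coeffVec n Q) ⟨n - 1 - i, by omega⟩
    have e : n - (n - 1 - i + 1) = i := by omega
    simpa [coeffVec, e] using this
  · have h1 := (monicPoly_monic (coeffVec i Q)).coeff_natDegree
    rw [monicPoly_natDegree] at h1
    rw [h1, ← hn, hQ.coeff_natDegree]
  · rw [coeff_eq_zero_of_natDegree_lt, coeff_eq_zero_of_natDegree_lt] <;>
      simp [monicPoly_natDegree, hn, hi]

lemma monicPoly_zero (n : ℕ) : monicPoly (0 : Fin n → ℝ) = X ^ n := by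
  simp [monicPoly]

lemma exists_monicPoly_eq {Q : ℝ[X]} (hQ : Q.Monic) {n : ℕ} (hn : Q.natDegree = n) :
    ∃ a : Fin n → ℝ, monicPoly a = Q := ⟨_, monicPoly_coeffVec hQ hn⟩

/-! ### Hyperbolicity and root vectors -/

lemma IsHyperbolic.of_dvd {P Q : ℝ[X]} (hP : IsHyperbolic P) (h : Q ∣ P) : IsHyperbolic Q := by
  intro z hz
  obtain ⟨R, rfl⟩ := h
  exact hP z (by simp [hz])

lemma IsHyperbolic.splits {P : ℝ[X]} (hP : IsHyperbolic P) : P.Splits := by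
  by_cases h0 : P = 0
  · simp [h0]
  rw [splits_iff_splits]
  right
  intro g hg hgP
  have hg0 : g.degree ≠ 0 := fun h => hg.not_isUnit (isUnit_iff_degree_eq_zero.2 h)
  obtain ⟨z, hz⟩ := IsAlgClosed.exists_aeval_eq_zero ℂ g hg0
  have him := (hP.of_dvd hgP) z hz
  have hr : z = algebraMap ℝ ℂ z.re := by
    apply Complex.ext <;> simp [him]
  rw [hr, aeval_algebraMap_apply] at hz
  have : g.eval z.re = 0 := by
    rw [← coe_aeval_eq_eval]
    exact (map_eq_zero_iff _ (algebraMap ℝ ℂ).injective).1 hz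
  exact degree_eq_one_of_irreducible_of_root hg this

lemma prod_X_sub_C_eq {n : ℕ} (v : Fin n → ℝ) :
    ∏ j, (X - C (v j)) = ((List.ofFn v : Multiset ℝ).map fun x => X - C x).prod := by
  simp [List.prod_ofFn, List.map_ofFn]

lemma roots_prod {n : ℕ} (v : Fin n → ℝ) :
    (∏ j, (X - C (v j))).roots = (List.ofFn v : Multiset ℝ) := by
  rw [prod_X_sub_C_eq, roots_multiset_prod_X_sub_C]

lemma exists_monotone_roots {n : ℕ} {a : Fin n → ℝ} (h : IsHyperbolic (monicPoly a)) :
    ∃ v : Fin n → ℝ, Monotone v ∧ monicPoly a = ∏ j, (X - C (v j)) := by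
  have hs := h.splits
  have hcard : (monicPoly a).roots.card = n := by
    rw [← hs.natDegree_eq_card_roots, monicPoly_natDegree]
  set l := (monicPoly a).roots.sort (· ≤ ·) with hl
  have hlen : l.length = n := by rw [hl, Multiset.length_sort, hcard]
  refine ⟨fun j => l.get (j.cast hlen.symm), ?_, ?_⟩
  · intro i j hij
    have := (Multiset.pairwise_sort (monicPoly a).roots (· ≤ ·))
    rcases hij.eq_or_lt with rfl | hij
    · exact le_rfl
    · exact (List.pairwise_iff_get.1 this) (i.cast hlen.symm) (j.cast hlen.symm) (by simpa using hij)
  · rw [prod_X_sub_C_eq]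
    have e : List.ofFn (fun j : Fin n => l.get (j.cast hlen.symm)) = l := by
      apply List.ext_get
      · simp [hlen]
      · intro i h1 h2; simp
    rw [e, hl, Multiset.sort_eq]
    have := hs.eq_prod_roots
    rw [(monicPoly_monic a).leadingCoeff] at this
    simpa using this

lemma eq_of_monotone_of_prod_eq {n : ℕ} {v w : Fin n → ℝ} (hv : Monotone v) (hw : Monotone w)
    (h : ∏ j, (X - C (v j)) = ∏ j, (X - C (w j))) : v = w := by
  have h1 := congrArg roots h
  rw [roots_prod, roots_prod, Multiset.coe_eq_coe] at h1
  exact List.ofFn_injective (h1.eq_of_pairwise' (r := (· ≤ ·)) hv.sortedLE_ofFn.pairwise hw.sortedLE_ofFn.pairwise)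

lemma isHyperbolic_prod {n : ℕ} (v : Fin n → ℝ) : IsHyperbolic (∏ j, (X - C (v j))) := by
  intro z hz
  rw [map_prod, Finset.prod_eq_zero_iff] at hz
  obtain ⟨j, -, hj⟩ := hz
  have : z = (v j : ℂ) := by simpa [sub_eq_zero] using hj
  simp [this]

lemma isRoot_prod_iff {n : ℕ} (v : Fin n → ℝ) (y : ℝ) :
    (∏ j, (X - C (v j))).IsRoot y ↔ ∃ j, v j = y := by
  rw [IsRoot, eval_prod, Finset.prod_eq_zero_iff]
  simp [sub_eq_zero, eq_comm]

/-- Cauchy's bound: if `|y| ≥ 1`, divide the equation by `|y| ^ (n - 1)`. -/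
lemma abs_root_le {n : ℕ} {a : Fin n → ℝ} {y : ℝ} (h : (monicPoly a).IsRoot y) :
    |y| ≤ 1 + n * ‖a‖ := by
  by_contra! hc
  have h1 : 1 ≤ |y| := by
    have : 0 ≤ n * ‖a‖ := by positivity
    linarith
  rw [IsRoot, monicPoly_eval] at h
  rcases Nat.eq_zero_or_pos n with rfl | hn
  · simp at h
  have h2 : |y| ^ n ≤ n * ‖a‖ * |y| ^ (n - 1) := by
    calc |y| ^ n = |∑ j : Fin n, a j * y ^ (n - (j.val + 1))| := by
          rw [← abs_pow, eq_neg_of_add_eq_zero_left h, abs_neg]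
      _ ≤ ∑ j : Fin n, |a j * y ^ (n - (j.val + 1))| := Finset.abs_sum_le_sum_abs _ _
      _ ≤ ∑ j : Fin n, ‖a‖ * |y| ^ (n - 1) := by
          refine Finset.sum_le_sum fun j _ => ?_
          rw [abs_mul, abs_pow]
          refine mul_le_mul (norm_le_pi_norm a j) (pow_le_pow_right₀ h1 (by omega)) (by positivity)
            (norm_nonneg _)
      _ = _ := by simp [mul_assoc]
  have h3 : |y| ^ n = |y| * |y| ^ (n - 1) := by
    rw [← pow_succ']; congr 1; omega
  rw [h3] at h2
  have := le_of_mul_le_mul_right h2 (by positivity)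
  linarith

/-- Up to sign the coefficient is an elementary symmetric function of degree `j + 1` in the roots.
This homogeneity is what later turns roots of size `O(h)` into coefficients of size `O(h ^ (j +
1))`. -/
lemma norm_le_of_roots_le {n : ℕ} {a v : Fin n → ℝ} (h : monicPoly a = ∏ j, (X - C (v j)))
    {B : ℝ} (hv : ∀ j, |v j| ≤ B) (j : Fin n) : |a j| ≤ 2 ^ n * B ^ (j.val + 1) := by
  have h0 : 0 ≤ B := (abs_nonneg _).trans (hv j)
  have hs : (monicPoly a).Splits := by
    have := isHyperbolic_prod v
    rw [← h] at this
    exact this.splits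
  have := coeff_le_of_roots_le (f := RingHom.id ℝ) (B := B) (n - (j.val + 1)) (monicPoly_monic a)
    (by simpa using hs) (by
      intro z hz
      rw [Polynomial.map_id, h, roots_prod] at hz
      obtain ⟨i, rfl⟩ : ∃ i, v i = z := by simpa [List.mem_ofFn] using hz
      exact hv i)
  rw [Polynomial.map_id, monicPoly_coeff, monicPoly_natDegree, Real.norm_eq_abs] at this
  have e : n - (n - (j.val + 1)) = j.val + 1 := by omega
  rw [e] at this
  refine this.trans ?_
  rw [mul_comm]
  gcongr
  exact_mod_cast Nat.choose_le_two_pow _ _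

/-- Vieta's formulas. When `a 0 = 0`, the single nonnegative quantity `-2 * a 1` controls every
root. -/
lemma sum_roots_and_sum_sq_roots {m : ℕ} {a v : Fin (m + 2) → ℝ} (h : monicPoly a = ∏ j, (X - C (v j))) :
    ∑ j, v j = -a 0 ∧ ∑ j, v j ^ 2 = a 0 ^ 2 - 2 * a 1 := by
  have key : ∀ (k : ℕ) (w : Fin (k + 2) → ℝ),
      (∏ j, (X - C (w j))).coeff (k + 1) = - ∑ j, w j ∧
      2 * (∏ j, (X - C (w j))).coeff k = (∑ j, w j) ^ 2 - ∑ j, w j ^ 2 := by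
    intro k
    induction k with
    | zero =>
      intro w
      have : (∏ j, (X - C (w j))) = X ^ 2 + (C (- (w 0 + w 1)) * X + C (w 0 * w 1)) := by
        simp [Fin.prod_univ_two]; ring
      rw [this]
      simp [Fin.sum_univ_two, coeff_X, coeff_X_pow, coeff_C]
      ring
    | succ k ih =>
      intro w
      obtain ⟨h1, h2⟩ := ih (fun j => w j.succ)
      have hm : (∏ j : Fin (k + 2), (X - C (w j.succ))).coeff (k + 2) = 1 := by
        have hmon : (∏ j : Fin (k + 2), (X - C (w j.succ))).Monic :=
          monic_prod_of_monic _ _ fun j _ => monic_X_sub_C _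
        have hd : (∏ j : Fin (k + 2), (X - C (w j.succ))).natDegree = k + 2 := by
          rw [natDegree_prod_of_monic _ _ fun j _ => monic_X_sub_C _]; simp
        rw [← hmon.coeff_natDegree, hd]
      rw [Fin.prod_univ_succ, Fin.sum_univ_succ w, Fin.sum_univ_succ (fun j => w j ^ 2), sub_mul]
      simp only [coeff_sub, coeff_X_mul, coeff_C_mul]
      rw [h1, hm]
      refine ⟨by ring, ?_⟩
      linear_combination h2
  obtain ⟨h1, h2⟩ := key m v
  rw [← h] at h1 h2
  have e0 : (monicPoly a).coeff (m + 1) = a 0 := by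
    simpa using monicPoly_coeff a 0
  have e1 : (monicPoly a).coeff m = a 1 := by
    have := monicPoly_coeff a 1
    simpa using this
  rw [e0] at h1
  rw [e1] at h2
  refine ⟨by linear_combination h1, ?_⟩
  rw [h1]
  linear_combination h2

/-! ### Dilation and translation of the roots -/

/-- The coefficients of the polynomial whose roots are multiplied by `r`. -/
def dilate {n : ℕ} (r : ℝ) (a : Fin n → ℝ) : Fin n → ℝ := fun j => r ^ (j.val + 1) * a j

lemma dilate_eval {n : ℕ} (r : ℝ) (a : Fin n → ℝ) (z : ℝ) :
    (monicPoly (dilate r a)).eval (r * z) = r ^ n * (monicPoly a).eval z := by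
  rw [monicPoly_eval, monicPoly_eval, mul_pow, mul_add, Finset.mul_sum]
  congr 1
  refine Finset.sum_congr rfl fun j _ => ?_
  have : r ^ n = r ^ (j.val + 1) * r ^ (n - (j.val + 1)) := by
    rw [← pow_add]; congr 1; omega
  rw [dilate, this, mul_pow]; ring

lemma dilate_dilate {n : ℕ} (r s : ℝ) (a : Fin n → ℝ) :
    dilate r (dilate s a) = dilate (r * s) a := by
  ext j; simp [dilate, mul_pow, mul_assoc]

lemma dilate_one {n : ℕ} (a : Fin n → ℝ) : dilate 1 a = a := by
  ext j; simp [dilate]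

lemma isRoot_dilate {n : ℕ} {r : ℝ} (hr : r ≠ 0) (a : Fin n → ℝ) (z : ℝ) :
    (monicPoly (dilate r a)).IsRoot (r * z) ↔ (monicPoly a).IsRoot z := by
  rw [IsRoot, IsRoot, dilate_eval]
  simp [hr]

lemma dilate_prod {n : ℕ} {r : ℝ} (hr : r ≠ 0) {a v : Fin n → ℝ}
    (h : monicPoly a = ∏ j, (X - C (v j))) :
    monicPoly (dilate r a) = ∏ j, (X - C (r * v j)) := by
  refine Polynomial.funext fun z => ?_
  have := dilate_eval r a (z / r)
  rw [mul_div_cancel₀ z hr] at this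
  rw [this, h, eval_prod, eval_prod, ← Fin.prod_const, ← Finset.prod_mul_distrib]
  refine Finset.prod_congr rfl fun j _ => ?_
  simp; field_simp

lemma isHyperbolic_dilate {n : ℕ} {r : ℝ} (hr : r ≠ 0) {a : Fin n → ℝ}
    (h : IsHyperbolic (monicPoly a)) : IsHyperbolic (monicPoly (dilate r a)) := by
  obtain ⟨v, -, hv⟩ := exists_monotone_roots h
  rw [dilate_prod hr hv]
  exact isHyperbolic_prod _

/-- The coefficients of the polynomial whose roots are translated by `-y`. -/
noncomputable def translate {n : ℕ} (a : Fin n → ℝ) (y : ℝ) : Fin n → ℝ :=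
  coeffVec n ((monicPoly a).comp (X + C y))

lemma monicPoly_translate {n : ℕ} (a : Fin n → ℝ) (y : ℝ) :
    monicPoly (translate a y) = (monicPoly a).comp (X + C y) :=
  monicPoly_coeffVec ((monicPoly_monic a).comp_X_add_C y) (by simp [natDegree_comp, monicPoly_natDegree])

lemma translate_eval {n : ℕ} (a : Fin n → ℝ) (y z : ℝ) :
    (monicPoly (translate a y)).eval z = (monicPoly a).eval (z + y) := by
  simp [monicPoly_translate]

lemma translate_apply {n : ℕ} (a : Fin n → ℝ) (y : ℝ) (i : Fin n) :
    translate a y i = y ^ (i.val + 1) * (n.choose (i.val + 1)) +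
      ∑ j : Fin n, a j * (y ^ ((n - (j.val + 1)) - (n - (i.val + 1))) *
        ((n - (j.val + 1)).choose (n - (i.val + 1)))) := by
  have e : n - (n - (i.val + 1)) = i.val + 1 := by omega
  have e2 : n.choose (n - (i.val + 1)) = n.choose (i.val + 1) := Nat.choose_symm (by omega)
  simp [translate, coeffVec, monicPoly, coeff_X_add_C_pow, e, e2, Polynomial.sum_comp, finsetSum_coeff]

lemma contDiff_translate {n : ℕ} {k : WithTop ℕ∞} :
    ContDiff ℝ k fun p : (Fin n → ℝ) × ℝ => translate p.1 p.2 := by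
  rw [contDiff_pi]
  intro i
  simp only [translate_apply]
  fun_prop

lemma translate_prod {n : ℕ} {a v : Fin n → ℝ} (h : monicPoly a = ∏ j, (X - C (v j))) (y : ℝ) :
    monicPoly (translate a y) = ∏ j, (X - C (v j - y)) := by
  refine Polynomial.funext fun z => ?_
  rw [translate_eval, h, eval_prod, eval_prod]
  refine Finset.prod_congr rfl fun j _ => ?_
  simp; ring

lemma isHyperbolic_translate {n : ℕ} {a : Fin n → ℝ} (h : IsHyperbolic (monicPoly a)) (y : ℝ) :
    IsHyperbolic (monicPoly (translate a y)) := by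
  obtain ⟨v, -, hv⟩ := exists_monotone_roots h
  rw [translate_prod hv]
  exact isHyperbolic_prod _

lemma translate_zero_coeff {m : ℕ} (a : Fin (m + 1) → ℝ) (y : ℝ) :
    translate a y 0 = a 0 + (m + 1) * y := by
  rw [translate_apply, Finset.sum_eq_single 0]
  · simp; ring
  · intro j _ hj
    have : 0 < j.val := Nat.pos_of_ne_zero fun h => hj (Fin.ext h)
    have h0 : ((0 : Fin (m + 1)) : ℕ) = 0 := rfl
    rw [Nat.choose_eq_zero_of_lt (by omega)]; simp
  · simp


/-! ### Uniform bounds for derivatives -/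

/-- `A` is of class `C ^ k` on `S`, with all derivatives up to order `k` bounded by `D`. -/
def CkBound {E : Type*} [NormedAddCommGroup E] [NormedSpace ℝ E] (k : ℕ) (S : Set ℝ) (D : ℝ)
    (A : ℝ → E) : Prop :=
  ContDiffOn ℝ k A S ∧ ∀ i ≤ k, ∀ t ∈ S, ‖iteratedDeriv i A t‖ ≤ D

section

variable {E F : Type*} [NormedAddCommGroup E] [NormedSpace ℝ E] [NormedAddCommGroup F]
  [NormedSpace ℝ F]

lemma CkBound.mono {k l : ℕ} {S T : Set ℝ} {D D' : ℝ} {A : ℝ → E} (h : CkBound k S D A)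
    (hl : l ≤ k) (hT : T ⊆ S) (hD : D ≤ D') : CkBound l T D' A :=
  ⟨(h.1.of_le (by exact_mod_cast hl)).mono hT, fun i hi t ht =>
    (h.2 i (hi.trans hl) t (hT ht)).trans hD⟩

lemma CkBound.norm_le {k : ℕ} {S : Set ℝ} {D : ℝ} {A : ℝ → E} (h : CkBound k S D A) {t : ℝ}
    (ht : t ∈ S) : ‖A t‖ ≤ D := by
  simpa using h.2 0 (Nat.zero_le _) t ht

lemma norm_iteratedFDerivWithin_eq {S : Set ℝ} (hS : IsOpen S) (A : ℝ → E) (i : ℕ) {t : ℝ}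
    (ht : t ∈ S) : ‖iteratedFDerivWithin ℝ i A S t‖ = ‖iteratedDeriv i A t‖ := by
  rw [norm_iteratedFDerivWithin_eq_norm_iteratedDerivWithin, iteratedDerivWithin_of_isOpen hS ht]

lemma iteratedDeriv_clm_comp {k : ℕ} {S : Set ℝ} (hS : IsOpen S) {A : ℝ → E}
    (hA : ContDiffOn ℝ k A S) (L : E →L[ℝ] F) {i : ℕ} (hi : i ≤ k) {t : ℝ} (ht : t ∈ S) :
    iteratedDeriv i (fun s => L (A s)) t = L (iteratedDeriv i A t) := by
  rw [iteratedDeriv, iteratedDeriv, ← iteratedFDerivWithin_of_isOpen i hS ht,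
    ← iteratedFDerivWithin_of_isOpen i hS ht]
  have := L.iteratedFDerivWithin_comp_left (hA t ht) hS.uniqueDiffOn ht
    (i := i) (by exact_mod_cast hi)
  exact congrArg (fun m => m fun _ => (1 : ℝ)) this

lemma iteratedDeriv_apply {ι : Type*} [Fintype ι] {k : ℕ} {S : Set ℝ} (hS : IsOpen S)
    {A : ℝ → ι → ℝ} (hA : ContDiffOn ℝ k A S) {i : ℕ} (hi : i ≤ k) {t : ℝ} (ht : t ∈ S) (j : ι) :
    iteratedDeriv i A t j = iteratedDeriv i (fun s => A s j) t :=
  (iteratedDeriv_clm_comp hS hA (ContinuousLinearMap.proj j) hi ht).symm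

lemma ckBound_pi {ι : Type*} [Fintype ι] {k : ℕ} {S : Set ℝ} (hS : IsOpen S) {D : ℝ}
    (hD : 0 ≤ D) {A : ℝ → ι → ℝ} : CkBound k S D A ↔ ∀ j, CkBound k S D fun t => A t j := by
  constructor
  · intro h j
    refine ⟨contDiffOn_pi.1 h.1 j, fun i hi t ht => ?_⟩
    rw [← iteratedDeriv_apply hS h.1 hi ht]
    exact (norm_le_pi_norm _ j).trans (h.2 i hi t ht)
  · intro h
    have hA : ContDiffOn ℝ k A S := contDiffOn_pi.2 fun j => (h j).1
    refine ⟨hA, fun i hi t ht => ?_⟩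
    rw [pi_norm_le_iff_of_nonneg hD]
    intro j
    rw [iteratedDeriv_apply hS hA hi ht]
    exact (h j).2 i hi t ht

/-- By Faà di Bruno, the `i`-th derivative of the composite is a sum of terms of total weight `i` in
the derivatives of `A`, whence `η ^ i`. Only derivatives of order at least `1` need be bounded by
powers of `η`; compactness of `K` makes `M` independent of `A`. -/
lemma exists_bound_comp {k : ℕ} {Ψ : E → F} {U K : Set E} (hU : IsOpen U)
    (hΨ : ContDiffOn ℝ k Ψ U) (hK : IsCompact K) (hKU : K ⊆ U) :
    ∃ M, 0 ≤ M ∧ ∀ (S : Set ℝ) (A : ℝ → E), IsOpen S → ContDiffOn ℝ k A S → MapsTo A S K →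
      ∀ t ∈ S, ∀ η : ℝ, (∀ i, 1 ≤ i → i ≤ k → ‖iteratedDeriv i A t‖ ≤ η ^ i) →
        ∀ i ≤ k, ‖iteratedDeriv i (Ψ ∘ A) t‖ ≤ M * η ^ i := by
  have h1 : ∀ i : ℕ, ∃ C, i ≤ k → ∀ x ∈ K, ‖iteratedFDerivWithin ℝ i Ψ U x‖ ≤ C := by
    intro i
    by_cases hi : i ≤ k
    · have hc : ContinuousOn (iteratedFDerivWithin ℝ i Ψ U) K :=
        (hΨ.continuousOn_iteratedFDerivWithin (by exact_mod_cast hi) hU.uniqueDiffOn).mono hKU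
      obtain ⟨C, hC⟩ := hK.exists_bound_of_continuousOn hc
      exact ⟨C, fun _ => hC⟩
    · exact ⟨0, fun h => absurd h hi⟩
  choose C hC using h1
  set C' := ∑ i ∈ Finset.range (k + 1), |C i| with hC'
  have hC'0 : 0 ≤ C' := Finset.sum_nonneg fun i _ => abs_nonneg _
  refine ⟨k.factorial * C', by positivity, ?_⟩
  intro S A hS hA hm t ht η hη i hi
  have hη0 : 0 ≤ η ^ i := by
    rcases Nat.eq_zero_or_pos i with rfl | h
    · simp
    · exact (norm_nonneg _).trans (hη i h hi)
  rw [← norm_iteratedFDerivWithin_eq hS _ _ ht]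
  have hb : ∀ l ≤ i, ‖iteratedFDerivWithin ℝ l Ψ U (A t)‖ ≤ C' := by
    intro l hl
    refine (hC l (hl.trans hi) _ (hm ht)).trans ((le_abs_self _).trans ?_)
    exact Finset.single_le_sum (f := fun i => |C i|) (fun i _ => abs_nonneg _)
      (Finset.mem_range.2 (by omega))
  have := norm_iteratedFDerivWithin_comp_le hΨ hA (n := i) (by exact_mod_cast hi) hU.uniqueDiffOn
    hS.uniqueDiffOn (fun s hs => hKU (hm hs)) ht hb (D := η) (by
      intro l hl1 hl2
      rw [norm_iteratedFDerivWithin_eq hS _ _ ht]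
      exact hη l hl1 (hl2.trans hi))
  refine this.trans ?_
  gcongr

lemma exists_ckBound_comp {k : ℕ} {Ψ : E → F} {U K : Set E} (hU : IsOpen U)
    (hΨ : ContDiffOn ℝ k Ψ U) (hK : IsCompact K) (hKU : K ⊆ U) (D : ℝ) :
    ∃ D', 0 ≤ D' ∧ ∀ (S : Set ℝ) (A : ℝ → E), IsOpen S → CkBound k S D A → MapsTo A S K →
        CkBound k S D' (Ψ ∘ A) := by
  obtain ⟨M, hM, h⟩ := exists_bound_comp hU hΨ hK hKU
  refine ⟨M * (max D 1) ^ k, by positivity, fun S A hS hA hm => ⟨?_, ?_⟩⟩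
  · exact hΨ.comp hA.1 fun s hs => hKU (hm hs)
  · intro i hi t ht
    refine (h S A hS hA.1 hm t ht (max D 1) ?_ i hi).trans ?_
    · intro i hi1 hik
      refine (hA.2 i hik t ht).trans ((le_max_left D 1).trans ?_)
      exact le_self_pow₀ (le_max_right _ _) (by omega)
    · gcongr
      exact le_max_right _ _

lemma differentiableAt_iteratedDeriv {k i : ℕ} {S : Set ℝ} (hS : IsOpen S) {A : ℝ → E}
    (hA : ContDiffOn ℝ k A S) (hi : i < k) {t : ℝ} (ht : t ∈ S) :
    DifferentiableAt ℝ (iteratedDeriv i A) t := by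
  have h := (hA.differentiableOn_iteratedDerivWithin (m := i) (by exact_mod_cast hi) hS.uniqueDiffOn)
  have h2 : DifferentiableOn ℝ (iteratedDeriv i A) S :=
    h.congr fun x hx => (iteratedDerivWithin_of_isOpen hS hx).symm
  exact h2.differentiableAt (hS.mem_nhds ht)

lemma continuousOn_iteratedDeriv {k i : ℕ} {S : Set ℝ} (hS : IsOpen S) {A : ℝ → E}
    (hA : ContDiffOn ℝ k A S) (hi : i ≤ k) : ContinuousOn (iteratedDeriv i A) S :=
  (hA.continuousOn_iteratedDerivWithin (m := i) (by exact_mod_cast hi) hS.uniqueDiffOn).congr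
    fun _ hx => (iteratedDerivWithin_of_isOpen hS hx).symm

end

/-- Apply the induction hypothesis on the two outer thirds of the interval: it gives points at
distance at least `L` where the lower derivative is controlled, and the mean value theorem between
them yields `ξ`. -/
lemma exists_iteratedDeriv_le (m : ℕ) : ∃ K, 0 ≤ K ∧ ∀ (f : ℝ → ℝ) (S : Set ℝ) (M α β : ℝ),
    IsOpen S → ContDiffOn ℝ m f S → α < β → Icc α β ⊆ S → (∀ t ∈ Icc α β, |f t| ≤ M) →
    ∃ ξ ∈ Icc α β, |iteratedDeriv m f ξ| ≤ K * M / (β - α) ^ m := by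
  induction m with
  | zero =>
    refine ⟨1, zero_le_one, fun f S M α β _ _ hab _ hM => ⟨α, left_mem_Icc.2 hab.le, ?_⟩⟩
    simpa using hM α (left_mem_Icc.2 hab.le)
  | succ m ih =>
    obtain ⟨K, hK, h⟩ := ih
    refine ⟨2 * K * 3 ^ (m + 1), by positivity, fun f S M α β hS hf hab hsub hM => ?_⟩
    have hf' : ContDiffOn ℝ m f S := hf.of_le (by exact_mod_cast Nat.le_succ m)
    set L := (β - α) / 3 with hL
    have hL0 : 0 < L := by rw [hL]; linarith
    have hs1 : Icc α (α + L) ⊆ Icc α β := Icc_subset_Icc_right (by linarith)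
    have hs2 : Icc (β - L) β ⊆ Icc α β := Icc_subset_Icc_left (by linarith)
    obtain ⟨x, hx, hxb⟩ := h f S M α (α + L) hS hf' (by linarith) (hs1.trans hsub)
      fun t ht => hM t (hs1 ht)
    obtain ⟨y, hy, hyb⟩ := h f S M (β - L) β hS hf' (by linarith) (hs2.trans hsub)
      fun t ht => hM t (hs2 ht)
    have hxy : L ≤ y - x := by linarith [hx.2, hy.1]
    have hsub' : Icc x y ⊆ Icc α β := Icc_subset_Icc hx.1 hy.2
    obtain ⟨ξ, hξ, he⟩ := exists_deriv_eq_slope (iteratedDeriv m f) (by linarith : x < y)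
      ((continuousOn_iteratedDeriv hS hf (Nat.le_succ m)).mono (hsub'.trans hsub))
      (fun t ht => (differentiableAt_iteratedDeriv hS hf (Nat.lt_succ_self m)
        (hsub (hsub' (Ioo_subset_Icc_self ht)))).differentiableWithinAt)
    refine ⟨ξ, hsub' (Ioo_subset_Icc_self hξ), ?_⟩
    have e1 : α + L - α = L := by ring
    have e2 : β - (β - L) = L := by ring
    rw [e1] at hxb
    rw [e2] at hyb
    rw [iteratedDeriv_succ, he, abs_div, abs_of_pos (by linarith : 0 < y - x)]
    have hM0 : 0 ≤ M := (abs_nonneg _).trans (hM α (left_mem_Icc.2 hab.le))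
    calc |iteratedDeriv m f y - iteratedDeriv m f x| / (y - x)
        ≤ (K * M / L ^ m + K * M / L ^ m) / L := by
          gcongr
          exact (abs_sub _ _).trans (add_le_add hyb hxb)
      _ = 2 * K * 3 ^ (m + 1) * M / (β - α) ^ (m + 1) := by
          have : β - α = 3 * L := by rw [hL]; ring
          rw [this, mul_pow, pow_succ L]
          field_simp
          norm_num

/-- Interpolation: the sup bound controls the derivative of order `k` at one point, the bound on
order `k + 1` spreads this over the whole interval, and one descends. It spares estimating
intermediate derivatives after a rescaling. -/
lemma exists_ckBound_of_top (k : ℕ) {δ : ℝ} (hδ : 0 < δ) : ∀ M₀ M : ℝ, ∃ D, 0 ≤ D ∧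
    ∀ f : ℝ → ℝ, ContDiffOn ℝ k f (Ioo (-δ) δ) → (∀ t ∈ Ioo (-δ) δ, |f t| ≤ M₀) →
      (∀ t ∈ Ioo (-δ) δ, |iteratedDeriv k f t| ≤ M) → CkBound k (Ioo (-δ) δ) D f := by
  have h0 : (0 : ℝ) ∈ Ioo (-δ) δ := by simp [hδ]
  induction k with
  | zero =>
    intro M₀ M
    refine ⟨|M|, abs_nonneg _, fun f hf _ hM => ⟨hf, fun i hi t ht => ?_⟩⟩
    obtain rfl : i = 0 := by omega
    exact (hM t ht).trans (le_abs_self _)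
  | succ k ih =>
    intro M₀ M
    obtain ⟨K, hK, hK'⟩ := exists_iteratedDeriv_le k
    obtain ⟨D, hD, h⟩ := ih M₀ (K * M₀ / δ ^ k + M * (2 * δ))
    refine ⟨max D |M|, by positivity, fun f hf hM₀ hM => ⟨hf, ?_⟩⟩
    have hM0 : 0 ≤ M := (abs_nonneg _).trans (hM 0 h0)
    have hsub : Icc (-(δ / 2)) (δ / 2) ⊆ Ioo (-δ) δ := fun x hx =>
      ⟨by linarith [hx.1], by linarith [hx.2]⟩
    obtain ⟨ξ, hξ, hξb⟩ := hK' f _ M₀ (-(δ / 2)) (δ / 2) isOpen_Ioo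
      (hf.of_le (by exact_mod_cast Nat.le_succ k)) (by linarith) hsub fun t ht => hM₀ t (hsub ht)
    have e : δ / 2 - -(δ / 2) = δ := by ring
    rw [e] at hξb
    have hb : CkBound k (Ioo (-δ) δ) D f := by
      refine h f (hf.of_le (by exact_mod_cast Nat.le_succ k)) hM₀ fun t ht => ?_
      have := (convex_Ioo (-δ) δ).norm_image_sub_le_of_norm_deriv_le
        (f := iteratedDeriv k f) (C := M)
        (fun x hx => differentiableAt_iteratedDeriv isOpen_Ioo hf (Nat.lt_succ_self k) hx)
        (fun x hx => by rw [← iteratedDeriv_succ]; exact hM x hx) (hsub hξ) ht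
      rw [Real.norm_eq_abs, Real.norm_eq_abs] at this
      have hd : |t - ξ| ≤ 2 * δ := by
        rw [abs_le]; constructor <;> linarith [ht.1, ht.2, (hsub hξ).1, (hsub hξ).2]
      have h2 : M * |t - ξ| ≤ M * (2 * δ) := by gcongr
      have h3 := abs_sub_abs_le_abs_sub (iteratedDeriv k f t) (iteratedDeriv k f ξ)
      linarith
    intro i hi t ht
    rcases Nat.lt_or_ge i (k + 1) with hlt | hge
    · exact (hb.2 i (by omega) t ht).trans (le_max_left _ _)
    · obtain rfl : i = k + 1 := by omega
      exact (hM t ht).trans ((le_abs_self _).trans (le_max_right _ _))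

lemma iteratedDeriv_const_mul_comp_mul (c r : ℝ) (f : ℝ → ℝ) (k : ℕ) (s : ℝ) :
    iteratedDeriv k (fun s => c * f (r * s)) s = c * r ^ k * iteratedDeriv k f (r * s) := by
  induction k generalizing s with
  | zero => simp
  | succ k ih =>
    rw [iteratedDeriv_succ, funext ih, iteratedDeriv_succ, deriv_const_mul_field,
      deriv_comp_mul_left, smul_eq_mul]
    ring

lemma abs_taylor_two_le {S : Set ℝ} (hS : IsOpen S) (hc : Convex ℝ S) (h0 : (0 : ℝ) ∈ S)
    {V : ℝ → ℝ} {M : ℝ} (hV : ContDiffOn ℝ 2 V S) (hM : ∀ t ∈ S, |iteratedDeriv 2 V t| ≤ M)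
    {t : ℝ} (ht : t ∈ S) : |V t - V 0 - deriv V 0 * t| ≤ M * t ^ 2 := by
  have hd : ∀ s ∈ S, DifferentiableAt ℝ V s := fun s hs =>
    (hV.differentiableOn (by norm_num)).differentiableAt (hS.mem_nhds hs)
  have h1 : ∀ s ∈ S, |deriv V s - deriv V 0| ≤ M * |s| := by
    intro s hs
    have := hc.norm_image_sub_le_of_norm_deriv_le (f := deriv V) (C := M)
      (fun x hx => by
        have := differentiableAt_iteratedDeriv (k := 2) (i := 1) hS (by exact_mod_cast hV)
          (by norm_num) hx
        rwa [iteratedDeriv_one] at this)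
      (fun x hx => by
        have := hM x hx
        rwa [iteratedDeriv_succ, iteratedDeriv_one] at this) h0 hs
    simpa using this
  have hM0 : 0 ≤ M := (abs_nonneg _).trans (hM 0 h0)
  have hseg : segment ℝ 0 t ⊆ S := hc.segment_subset h0 ht
  have := (convex_segment (0 : ℝ) t).norm_image_sub_le_of_norm_hasDerivWithin_le
    (f := fun s => V s - deriv V 0 * s) (f' := fun s => deriv V s - deriv V 0) (C := M * |t|)
    (fun x hx => by
      have h := ((hd x (hseg hx)).hasDerivAt.fun_sub ((hasDerivAt_id x).const_mul (deriv V 0)))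
      simpa using h.hasDerivWithinAt)
    (fun x hx => by
      refine (h1 x (hseg hx)).trans (mul_le_mul_of_nonneg_left ?_ hM0)
      rw [segment_eq_uIcc] at hx
      have := abs_sub_left_of_mem_uIcc hx
      simpa using this)
    (left_mem_segment ℝ _ _) (right_mem_segment ℝ _ _)
  simp only [Real.norm_eq_abs, mul_zero, sub_zero] at this
  rw [show V t - V 0 - deriv V 0 * t = V t - deriv V 0 * t - V 0 by ring]
  refine this.trans (le_of_eq ?_)
  rw [mul_assoc, ← sq, sq_abs]

/-- A zero of a nonnegative function is a minimum, so the linear Taylor term is absent. -/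
lemma le_sq_of_nonneg_of_zero {S : Set ℝ} (hS : IsOpen S) (hc : Convex ℝ S) (h0 : (0 : ℝ) ∈ S)
    {V : ℝ → ℝ} {M : ℝ} (hV : ContDiffOn ℝ 2 V S) (hM : ∀ t ∈ S, |iteratedDeriv 2 V t| ≤ M)
    (hpos : ∀ t ∈ S, 0 ≤ V t) (hz : V 0 = 0) {t : ℝ} (ht : t ∈ S) : V t ≤ M * t ^ 2 := by
  have hmin : IsLocalMin V 0 := by
    filter_upwards [hS.mem_nhds h0] with s hs
    rw [hz]; exact hpos s hs
  have := abs_taylor_two_le hS hc h0 hV hM ht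
  rw [hmin.deriv_eq_zero, hz] at this
  simp only [sub_zero, zero_mul] at this
  exact (le_abs_self _).trans this

/-- Nonnegativity at `δ / 2` and `-(δ / 2)` bounds the slope at `0` in both directions; Taylor's
formula then bounds `V` without a hypothesis on `deriv V 0`. -/
lemma le_of_nonneg_of_one {δ : ℝ} (hδ : 0 < δ)
    {V : ℝ → ℝ} {M : ℝ} (hV : ContDiffOn ℝ 2 V (Ioo (-δ) δ))
    (hM : ∀ t ∈ Ioo (-δ) δ, |iteratedDeriv 2 V t| ≤ M)
    (hpos : ∀ t ∈ Ioo (-δ) δ, 0 ≤ V t) (hz : V 0 = 1) {t : ℝ} (ht : t ∈ Ioo (-δ) δ) :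
    V t ≤ 3 + 2 * M * δ ^ 2 := by
  have h0 : (0 : ℝ) ∈ Ioo (-δ) δ := by simp [hδ]
  have hT := fun s hs => abs_le.1 (abs_taylor_two_le isOpen_Ioo (convex_Ioo (-δ) δ) h0 hV hM
    (t := s) hs)
  have hM0 : 0 ≤ M := (abs_nonneg _).trans (hM 0 h0)
  have hp : δ / 2 ∈ Ioo (-δ) δ := ⟨by linarith, by linarith⟩
  have hn : -(δ / 2) ∈ Ioo (-δ) δ := ⟨by linarith, by linarith⟩
  have h1 := (hT _ hp).2
  have h2 := (hT _ hn).2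
  have h3 := (hT _ ht).2
  have p1 := hpos _ hp
  have p2 := hpos _ hn
  rw [hz] at h1 h2 h3
  obtain ⟨ht1, ht2⟩ := ht
  have hb : |deriv V 0| * δ ≤ 2 + M * δ ^ 2 / 2 := by
    rcases abs_cases (deriv V 0) with ⟨h, _⟩ | ⟨h, _⟩ <;> rw [h] <;> nlinarith
  have hb2 : deriv V 0 * t ≤ |deriv V 0| * δ := by
    refine (le_abs_self _).trans ?_
    rw [abs_mul]
    gcongr
    exact (abs_lt.2 ⟨ht1, ht2⟩).le
  have hb3 : M * t ^ 2 ≤ M * δ ^ 2 := by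
    gcongr ?_ * ?_
    rw [sq_le_sq, abs_of_pos hδ]
    exact (abs_lt.2 ⟨ht1, ht2⟩).le
  nlinarith [mul_nonneg hM0 (sq_nonneg δ)]


/-! ### Smooth local factorization -/

lemma continuous_eval {n : ℕ} :
    Continuous fun p : (Fin n → ℝ) × ℝ => (monicPoly p.1).eval p.2 := by
  simp only [monicPoly_eval]
  fun_prop

/-- The part of degree less than `n` of a monic polynomial, as a function of the coefficients. -/
noncomputable def lowerPoly {n : ℕ} (a : Fin n → ℝ) : ℝ[X] :=
  ∑ j : Fin n, C (a j) * X ^ (n - (j.val + 1))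

lemma lowerPoly_eq_zero {n : ℕ} {a : Fin n → ℝ} (h : lowerPoly a = 0) : a = 0 := by
  have : monicPoly a = monicPoly (0 : Fin n → ℝ) := by
    rw [monicPoly_zero, monicPoly]
    change X ^ n + lowerPoly a = X ^ n
    rw [h, add_zero]
  exact monicPoly_injective this

lemma monicPoly_add_smul {n : ℕ} (a b : Fin n → ℝ) (t : ℝ) :
    monicPoly (a + t • b) = monicPoly a + C t * lowerPoly b := by
  simp only [monicPoly, lowerPoly, Pi.add_apply, Pi.smul_apply, smul_eq_mul, C_add, C_mul, add_mul,
    Finset.sum_add_distrib, Finset.mul_sum, add_assoc, mul_assoc]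

/-- The coefficients of the product of two monic polynomials. -/
noncomputable def mulVec {m k : ℕ} (p : (Fin m → ℝ) × (Fin k → ℝ)) : Fin (m + k) → ℝ :=
  coeffVec (m + k) (monicPoly p.1 * monicPoly p.2)

lemma monicPoly_mulVec {m k : ℕ} (p : (Fin m → ℝ) × (Fin k → ℝ)) :
    monicPoly (mulVec p) = monicPoly p.1 * monicPoly p.2 :=
  monicPoly_coeffVec ((monicPoly_monic _).mul (monicPoly_monic _)) (by
    rw [(monicPoly_monic p.1).natDegree_mul (monicPoly_monic p.2), monicPoly_natDegree,
      monicPoly_natDegree])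

lemma contDiff_coeff {n i : ℕ} {N : WithTop ℕ∞} :
    ContDiff ℝ N fun a : Fin n → ℝ => (monicPoly a).coeff i := by
  simp only [monicPoly, coeff_add, finsetSum_coeff, coeff_C_mul]
  fun_prop

lemma contDiff_mulVec {m k : ℕ} {N : WithTop ℕ∞} :
    ContDiff ℝ N (mulVec : (Fin m → ℝ) × (Fin k → ℝ) → Fin (m + k) → ℝ) := by
  rw [contDiff_pi]
  intro i
  simp only [mulVec, coeffVec, coeff_mul]
  refine ContDiff.sum fun p _ => ?_
  exact (contDiff_coeff.comp contDiff_fst).mul (contDiff_coeff.comp contDiff_snd)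

lemma mulVec_line {m k : ℕ} (b β : Fin m → ℝ) (c γ : Fin k → ℝ) :
    HasDerivAt (fun t : ℝ => mulVec ((b, c) + t • (β, γ)))
      (coeffVec (m + k) (monicPoly b * lowerPoly γ + lowerPoly β * monicPoly c)) 0 := by
  rw [hasDerivAt_pi]
  intro i
  have e : ∀ t : ℝ, mulVec ((b, c) + t • (β, γ)) i =
      (monicPoly b * monicPoly c).coeff (m + k - (i.val + 1)) +
      t * (monicPoly b * lowerPoly γ + lowerPoly β * monicPoly c).coeff (m + k - (i.val + 1)) +
      t ^ 2 * (lowerPoly β * lowerPoly γ).coeff (m + k - (i.val + 1)) := by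
    intro t
    simp only [mulVec, coeffVec, Prod.smul_mk, Prod.mk_add_mk, monicPoly_add_smul]
    rw [← coeff_C_mul, ← coeff_C_mul, ← coeff_add, ← coeff_add]
    congr 1
    simp only [C_pow]
    ring
  simp only [e]
  have h1 : HasDerivAt (fun t : ℝ => (monicPoly b * monicPoly c).coeff (m + k - (i.val + 1)) +
      t * (monicPoly b * lowerPoly γ + lowerPoly β * monicPoly c).coeff (m + k - (i.val + 1)) +
      t ^ 2 * (lowerPoly β * lowerPoly γ).coeff (m + k - (i.val + 1))) _ 0 :=
    ((((hasDerivAt_id (0 : ℝ)).mul_const _).const_add _).add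
      ((hasDerivAt_pow 2 (0 : ℝ)).mul_const _))
  simpa [coeffVec] using h1

/-- The derivative is the Sylvester map `(β, γ) ↦ b γ + β c`. If it vanishes, coprimality makes `b`
divide `β`, which has smaller degree, so both components are zero. -/
lemma injective_fderiv_mulVec {m k : ℕ} {b : Fin m → ℝ} {c : Fin k → ℝ}
    (h : IsCoprime (monicPoly b) (monicPoly c)) :
    Function.Injective (fderiv ℝ (mulVec : (Fin m → ℝ) × (Fin k → ℝ) → Fin (m + k) → ℝ) (b, c)) := by
  rw [injective_iff_map_eq_zero]
  rintro ⟨β, γ⟩ h0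
  have hd : HasFDerivAt mulVec (fderiv ℝ (mulVec : _ → Fin (m + k) → ℝ) (b, c)) ((b, c) + (0 : ℝ) • (β, γ)) := by
    rw [zero_smul, add_zero]
    exact ((contDiff_mulVec (N := 1)).differentiable (by simp) (b, c)).hasFDerivAt
  have hl : HasDerivAt (fun t : ℝ => (b, c) + t • (β, γ)) (β, γ) 0 := by
    simpa using (((hasDerivAt_id (0 : ℝ)).smul_const (β, γ)).const_add (b, c))
  have hcomp : HasDerivAt (fun t : ℝ => mulVec ((b, c) + t • (β, γ)))
      (fderiv ℝ (mulVec : _ → Fin (m + k) → ℝ) (b, c) (β, γ)) 0 :=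
    HasFDerivAt.comp_hasDerivAt (f := fun t : ℝ => (b, c) + t • (β, γ)) (0 : ℝ) hd hl
  have h1 := hcomp.unique (mulVec_line b β c γ)
  rw [h0] at h1
  set Q := monicPoly b * lowerPoly γ + lowerPoly β * monicPoly c with hQ
  have hbd : (monicPoly b).degree = m := by
    rw [degree_eq_natDegree (monicPoly_monic b).ne_zero, monicPoly_natDegree]
  have hcd : (monicPoly c).degree = k := by
    rw [degree_eq_natDegree (monicPoly_monic c).ne_zero, monicPoly_natDegree]
  have hβd : (lowerPoly β).degree < m := degree_sum_lt β
  have hγd : (lowerPoly γ).degree < k := degree_sum_lt γ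
  have hQ0 : Q = 0 := by
    have hdeg : Q.degree < ((m + k : ℕ) : WithBot ℕ) := by
      refine (degree_add_le _ _).trans_lt (max_lt ?_ ?_)
      · rw [degree_mul, hbd, Nat.cast_add]
        exact WithBot.add_lt_add_left (WithBot.natCast_ne_bot m) hγd
      · rw [degree_mul, hcd, Nat.cast_add]
        exact WithBot.add_lt_add_right (WithBot.natCast_ne_bot k) hβd
    ext i
    rw [coeff_zero]
    rcases Nat.lt_or_ge i (m + k) with hi | hi
    · have := congrFun h1 ⟨m + k - 1 - i, by omega⟩
      have e : m + k - (m + k - 1 - i + 1) = i := by omega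
      simp only [coeffVec, e, Pi.zero_apply] at this
      exact this.symm
    · exact coeff_eq_zero_of_degree_lt (hdeg.trans_le (by exact_mod_cast hi))
  have hdvd : monicPoly b ∣ lowerPoly β := by
    refine h.dvd_of_dvd_mul_right ⟨-lowerPoly γ, ?_⟩
    linear_combination hQ0
  have hβ0 : lowerPoly β = 0 := eq_zero_of_dvd_of_degree_lt hdvd (by rw [hbd]; exact hβd)
  have hγ0 : lowerPoly γ = 0 := by
    rw [hQ, hβ0, zero_mul, add_zero] at hQ0
    exact (mul_eq_zero.1 hQ0).resolve_left (monicPoly_monic b).ne_zero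
  rw [lowerPoly_eq_zero hβ0, lowerPoly_eq_zero hγ0]
  rfl

/-- The inverse function theorem for multiplication of coprime monic polynomials; source and target
both have dimension `m + k`. -/
lemma exists_smooth_factorization {m k : ℕ} (N : ℕ) {b : Fin m → ℝ} {c : Fin k → ℝ}
    (h : IsCoprime (monicPoly b) (monicPoly c)) :
    ∃ (ψ : (Fin (m + k) → ℝ) → Fin m → ℝ) (χ : (Fin (m + k) → ℝ) → Fin k → ℝ),
      ψ (mulVec (b, c)) = b ∧ χ (mulVec (b, c)) = c ∧
      ContDiffAt ℝ N ψ (mulVec (b, c)) ∧ ContDiffAt ℝ N χ (mulVec (b, c)) ∧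
      ∀ᶠ a in 𝓝 (mulVec (b, c)), monicPoly a = monicPoly (ψ a) * monicPoly (χ a) := by
  have hinj := injective_fderiv_mulVec h
  set L := fderiv ℝ (mulVec : (Fin m → ℝ) × (Fin k → ℝ) → Fin (m + k) → ℝ) (b, c) with hL
  have hfr : Module.finrank ℝ ((Fin m → ℝ) × (Fin k → ℝ)) = Module.finrank ℝ (Fin (m + k) → ℝ) := by
    simp
  set e : ((Fin m → ℝ) × (Fin k → ℝ)) ≃L[ℝ] (Fin (m + k) → ℝ) :=
    (LinearMap.linearEquivOfInjective (L : _ →ₗ[ℝ] _) hinj hfr).toContinuousLinearEquiv with he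
  have heL : (e : _ →L[ℝ] _) = L :=
    ContinuousLinearMap.ext fun _ => rfl
  -- Order `N + 1` because the local inverse requires a nonzero smoothness exponent, also when `N =
  -- 0`.
  have hcd : ContDiffAt ℝ ((N + 1 : ℕ) : WithTop ℕ∞)
      (mulVec : (Fin m → ℝ) × (Fin k → ℝ) → Fin (m + k) → ℝ) (b, c) := contDiff_mulVec.contDiffAt
  have hn : ((N + 1 : ℕ) : WithTop ℕ∞) ≠ 0 := by exact_mod_cast Nat.succ_ne_zero N
  have hf' : HasFDerivAt mulVec (e : _ →L[ℝ] _) (b, c) := by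
    rw [heL]
    exact (hcd.differentiableAt hn).hasFDerivAt
  set g := hcd.localInverse hf' hn with hg
  have hg1 : g (mulVec (b, c)) = (b, c) := hcd.localInverse_apply_image hf' hn
  have hg2 : ContDiffAt ℝ N g (mulVec (b, c)) :=
    (hcd.to_localInverse hf' hn).of_le (by exact_mod_cast Nat.le_succ N)
  refine ⟨fun a => (g a).1, fun a => (g a).2, by simp only [hg1], by simp only [hg1], hg2.fst, hg2.snd, ?_⟩
  filter_upwards [(hcd.hasStrictFDerivAt' hf' hn).eventually_right_inverse] with a ha
  have ha' : mulVec (g a) = a := ha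
  rw [← monicPoly_mulVec, ha']

lemma contDiff_translate_comp {n : ℕ} {N : WithTop ℕ∞} {E : Type*} [NormedAddCommGroup E]
    [NormedSpace ℝ E] {g : E → Fin n → ℝ} {h : E → ℝ} (hg : ContDiff ℝ N g) (hh : ContDiff ℝ N h) :
    ContDiff ℝ N fun e => translate (g e) (h e) :=
  (contDiff_translate (n := n)).comp (f := fun e => (g e, h e)) (hg.prodMk hh)

lemma exists_local_factor_of_eq {q k : ℕ} (N : ℕ) {a₀ : Fin (q + k) → ℝ} {x : ℝ} {c : Fin k → ℝ}
    (h : (monicPoly a₀).comp (X + C x) = X ^ q * monicPoly c) (hc0 : (monicPoly c).eval 0 ≠ 0) :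
    ∃ (ψ : (Fin (q + k) → ℝ) → Fin q → ℝ) (χ : (Fin (q + k) → ℝ) → Fin k → ℝ),
      ψ a₀ = 0 ∧ ContDiffAt ℝ N ψ a₀ ∧ ContDiffAt ℝ N χ a₀ ∧
      (monicPoly (χ a₀)).eval 0 ≠ 0 ∧
      ∀ᶠ a in 𝓝 a₀, (monicPoly a).comp (X + C x) = monicPoly (ψ a) * monicPoly (χ a) := by
  have hcop : IsCoprime (monicPoly (0 : Fin q → ℝ)) (monicPoly c) := by
    rw [monicPoly_zero]
    refine IsCoprime.pow_left ?_
    have hX : Irreducible (X : ℝ[X]) := irreducible_X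
    rw [hX.coprime_iff_not_dvd]
    intro h
    apply hc0
    rw [X_dvd_iff] at h
    rwa [← coeff_zero_eq_eval_zero]
  obtain ⟨ψ, χ, h1, h2, h3, h4, h5⟩ := exists_smooth_factorization N hcop
  have hT : translate a₀ x = mulVec (0, c) := by
    apply monicPoly_injective
    rw [monicPoly_translate, monicPoly_mulVec, monicPoly_zero, h]
  have hTc : ContDiff ℝ N fun a : Fin (q + k) → ℝ => translate a x :=
    contDiff_translate_comp contDiff_id contDiff_const
  rw [← hT] at h1 h2 h3 h4 h5
  refine ⟨fun a => ψ (translate a x), fun a => χ (translate a x), h1, ?_, ?_, ?_, ?_⟩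
  · exact ContDiffAt.comp (g := ψ) (f := fun a => translate a x) a₀ h3 hTc.contDiffAt
  · exact ContDiffAt.comp (g := χ) (f := fun a => translate a x) a₀ h4 hTc.contDiffAt
  · change (monicPoly (χ (translate a₀ x))).eval 0 ≠ 0
    rw [h2]; exact hc0
  · filter_upwards [hTc.continuous.continuousAt.eventually h5] with a ha
    rw [← monicPoly_translate, ha]

lemma exists_local_factor {n : ℕ} (N : ℕ) (a₀ : Fin n → ℝ) (x : ℝ) {q : ℕ}
    (hq : (monicPoly a₀).rootMultiplicity x = q) :
    ∃ (k : ℕ) (ψ : (Fin n → ℝ) → Fin q → ℝ) (χ : (Fin n → ℝ) → Fin k → ℝ),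
      q + k = n ∧ ψ a₀ = 0 ∧ ContDiffAt ℝ N ψ a₀ ∧ ContDiffAt ℝ N χ a₀ ∧
      (monicPoly (χ a₀)).eval 0 ≠ 0 ∧
      ∀ᶠ a in 𝓝 a₀, (monicPoly a).comp (X + C x) = monicPoly (ψ a) * monicPoly (χ a) := by
  obtain ⟨R, hR, hRx⟩ := exists_eq_pow_rootMultiplicity_mul_and_not_dvd (monicPoly a₀)
    (monicPoly_monic a₀).ne_zero x
  rw [hq] at hR
  have hpm : ((X - C x) ^ q : ℝ[X]).Monic := (monic_X_sub_C x).pow q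
  have hRm : R.Monic := by
    have := monicPoly_monic a₀
    rw [hR] at this
    exact hpm.of_mul_monic_left this
  have hn : q + R.natDegree = n := by
    have := congrArg natDegree hR
    rw [monicPoly_natDegree, hpm.natDegree_mul hRm, (monic_X_sub_C x).natDegree_pow] at this
    simpa using this.symm
  obtain ⟨k, hk⟩ : ∃ k, k = R.natDegree := ⟨_, rfl⟩
  rw [← hk] at hn
  subst hn
  obtain ⟨c, hc⟩ := exists_monicPoly_eq (hRm.comp_X_add_C x) (n := k)
    (by simp [natDegree_comp, hk])
  have hc0 : (monicPoly c).eval 0 ≠ 0 := by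
    rw [hc]
    simp only [eval_comp, eval_add, eval_X, eval_C, zero_add]
    intro h
    exact hRx (dvd_iff_isRoot.2 h)
  have hp : (monicPoly a₀).comp (X + C x) = X ^ q * monicPoly c := by
    rw [hR, mul_comp, pow_comp, sub_comp, X_comp, C_comp, add_sub_cancel_right, hc]
  obtain ⟨ψ, χ, h⟩ := exists_local_factor_of_eq N hp hc0
  exact ⟨k, ψ, χ, rfl, h⟩

/-- The cofactor is nonzero at `(a₀, x)`, hence nearby by continuity, so a root close to `x` must
come from the factor `ψ`. -/
lemma eventually_isRoot_factor {n q k : ℕ} {a₀ : Fin n → ℝ} {x : ℝ}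
    {ψ : (Fin n → ℝ) → Fin q → ℝ} {χ : (Fin n → ℝ) → Fin k → ℝ} (hχ : ContinuousAt χ a₀)
    (h0 : (monicPoly (χ a₀)).eval 0 ≠ 0)
    (h : ∀ᶠ a in 𝓝 a₀, (monicPoly a).comp (X + C x) = monicPoly (ψ a) * monicPoly (χ a)) :
    ∀ᶠ p : (Fin n → ℝ) × ℝ in 𝓝 (a₀, x), (monicPoly p.1).IsRoot p.2 →
      (monicPoly (ψ p.1)).IsRoot (p.2 - x) := by
  have hc : ContinuousAt (fun p : (Fin n → ℝ) × ℝ => (monicPoly (χ p.1)).eval (p.2 - x)) (a₀, x) := by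
    have h2 : ContinuousAt (fun p : (Fin n → ℝ) × ℝ => (χ p.1, p.2 - x)) (a₀, x) :=
      (ContinuousAt.comp (f := Prod.fst) (x := (a₀, x)) hχ continuousAt_fst).prodMk
        (continuousAt_snd.sub continuousAt_const)
    exact ContinuousAt.comp (f := fun p : (Fin n → ℝ) × ℝ => (χ p.1, p.2 - x))
      (g := fun p : (Fin k → ℝ) × ℝ => (monicPoly p.1).eval p.2)
      continuous_eval.continuousAt h2
  have h0' : (monicPoly (χ a₀)).eval (x - x) ≠ 0 := by simpa using h0
  have hne := hc.eventually_ne h0'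
  have hf : ∀ᶠ p : (Fin n → ℝ) × ℝ in 𝓝 (a₀, x),
      (monicPoly p.1).comp (X + C x) = monicPoly (ψ p.1) * monicPoly (χ p.1) :=
    (continuousAt_fst (p := (a₀, x))).eventually h
  filter_upwards [hne, hf] with p hp1 hp2 hp3
  have := congrArg (eval (p.2 - x)) hp2
  simp only [eval_comp, eval_add, eval_X, eval_C, sub_add_cancel, eval_mul] at this
  rw [hp3.eq_zero] at this
  exact (mul_eq_zero.1 this.symm).resolve_right hp1


/-! ### Bronshtein's theorem: uniform Lipschitz bounds for the roots -/

/-- Every root of a hyperbolic curve of degree `n` that satisfies the bound `D` in `C ^ n` on the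
interval of radius `δ`, and the condition `Q`, is Lipschitz at `0` with constant `C`. -/
def RootBound (n : ℕ) (δ D C : ℝ) (Q : (ℝ → Fin n → ℝ) → (ℝ → ℝ) → Prop) : Prop :=
  ∀ A : ℝ → Fin n → ℝ, CkBound n (Ioo (-δ) δ) D A →
    (∀ t ∈ Ioo (-δ) δ, IsHyperbolic (monicPoly (A t))) →
    ∀ f : ℝ → ℝ, ContinuousAt f 0 → (∀ᶠ t in 𝓝 0, (monicPoly (A t)).IsRoot (f t)) → Q A f →
      ∀ᶠ t in 𝓝 (0 : ℝ), |f t - f 0| ≤ C * |t|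

lemma RootBound.mono {n : ℕ} {δ D C C' : ℝ} {Q Q' : (ℝ → Fin n → ℝ) → (ℝ → ℝ) → Prop}
    (h : RootBound n δ D C Q) (hC : C ≤ C') (hQ : ∀ A f, Q' A f → Q A f) :
    RootBound n δ D C' Q' := by
  intro A hA hh f hf hr hq
  filter_upwards [h A hA hh f hf hr (hQ A f hq)] with t ht
  exact ht.trans (by gcongr)

lemma CkBound.norm_sub_le {E : Type*} [NormedAddCommGroup E] [NormedSpace ℝ E] {k : ℕ} {δ D : ℝ}
    {A : ℝ → E} (hk : 1 ≤ k) (h : CkBound k (Ioo (-δ) δ) D A) {t : ℝ} (ht : t ∈ Ioo (-δ) δ) :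
    ‖A t - A 0‖ ≤ D * |t| := by
  have h0 : (0 : ℝ) ∈ Ioo (-δ) δ := by
    have := ht.1.trans ht.2
    constructor <;> linarith
  have := (convex_Ioo (-δ) δ).norm_image_sub_le_of_norm_deriv_le (f := A) (C := D)
    (fun x hx => (h.1.differentiableOn (by exact_mod_cast (by omega : k ≠ 0))).differentiableAt
      (isOpen_Ioo.mem_nhds hx))
    (fun x hx => by have := h.2 1 hk x hx; rwa [iteratedDeriv_one] at this) h0 ht
  simpa using this

lemma CkBound.continuousAt {E : Type*} [NormedAddCommGroup E] [NormedSpace ℝ E] {k : ℕ} {δ D : ℝ}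
    {A : ℝ → E} (hδ : 0 < δ) (h : CkBound k (Ioo (-δ) δ) D A) : ContinuousAt A 0 :=
  h.1.continuousOn.continuousAt (Ioo_mem_nhds (by linarith) hδ)

/-- If all roots equalled `x`, their vanishing sum would force `x = 0`, while the sum of their
squares is `1`. -/
lemma rootMultiplicity_lt_of_normalized {m : ℕ} {a : Fin (m + 2) → ℝ} (h0 : a 0 = 0)
    (h1 : a 1 = -(1 / 2)) (x : ℝ) : (monicPoly a).rootMultiplicity x < m + 2 := by
  by_contra! hc
  have hd : (X - C x) ^ (m + 2) ∣ monicPoly a :=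
    (le_rootMultiplicity_iff (monicPoly_monic a).ne_zero).1 hc
  have he := eq_of_monic_of_dvd_of_natDegree_le ((monic_X_sub_C x).pow (m + 2)) (monicPoly_monic a)
    hd (by rw [(monic_X_sub_C x).natDegree_pow, monicPoly_natDegree]; simp)
  have hv : monicPoly a = ∏ j : Fin (m + 2), (X - C ((fun _ => x) j)) := by
    rw [he]; simp
  obtain ⟨e1, e2⟩ := sum_roots_and_sum_sq_roots hv
  rw [h0] at e1 e2
  rw [h1] at e2
  simp only [Finset.sum_const, Finset.card_univ, Fintype.card_fin, nsmul_eq_mul] at e1 e2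
  have hx : x = 0 := by
    have hm : ((m + 2 : ℕ) : ℝ) ≠ 0 := by positivity
    have e1' : ((m + 2 : ℕ) : ℝ) * x = 0 := by simpa using e1
    exact (mul_eq_zero.1 e1').resolve_left hm
  rw [hx] at e2
  norm_num at e2

lemma isHyperbolic_factor {n q k : ℕ} {a : Fin n → ℝ} {x : ℝ} {b : Fin q → ℝ} {c : Fin k → ℝ}
    (h : (monicPoly a).comp (X + C x) = monicPoly b * monicPoly c)
    (ha : IsHyperbolic (monicPoly a)) : IsHyperbolic (monicPoly b) := by
  refine (isHyperbolic_translate ha x).of_dvd ?_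
  rw [monicPoly_translate, h]
  exact dvd_mul_right _ _

lemma exists_common_radius {E : Type*} [PseudoMetricSpace E] {a₀ : E} {x : ℝ} {P : E → Prop}
    {Q : E × ℝ → Prop} (hP : ∀ᶠ a in 𝓝 a₀, P a) (hQ : ∀ᶠ p in 𝓝 (a₀, x), Q p) :
    ∃ ε > 0, (∀ a ∈ Metric.ball a₀ (2 * ε), P a) ∧
      ∀ a ∈ Metric.ball a₀ (2 * ε), ∀ y, |y - x| < 2 * ε → Q (a, y) := by
  obtain ⟨ε₁, hε₁, h₁⟩ := Metric.eventually_nhds_iff.1 hP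
  obtain ⟨ε₂, hε₂, h₂⟩ := Metric.eventually_nhds_iff.1 hQ
  refine ⟨min ε₁ ε₂ / 2, by positivity, fun a ha => h₁ ?_, fun a ha y hy => h₂ ?_⟩
  · rw [Metric.mem_ball] at ha
    linarith [min_le_left ε₁ ε₂]
  · rw [Metric.mem_ball] at ha
    rw [Prod.dist_eq, max_lt_iff]
    refine ⟨?_, ?_⟩
    · change dist a a₀ < ε₂
      linarith [min_le_right ε₁ ε₂]
    · change dist y x < ε₂
      rw [Real.dist_eq]
      linarith [min_le_right ε₁ ε₂]

/-- The radius `2 * ε` leaves room for the compact closed ball of radius `ε`, on which the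
derivatives of `ψ` are bounded. -/
lemma exists_ball_of_factor {n : ℕ} (a₀ : Fin n → ℝ) (x : ℝ) {q : ℕ}
    (hq : (monicPoly a₀).rootMultiplicity x = q) :
    ∃ (k : ℕ) (ψ : (Fin n → ℝ) → Fin q → ℝ) (χ : (Fin n → ℝ) → Fin k → ℝ) (ε : ℝ),
      q + k = n ∧ 0 < ε ∧ ψ a₀ = 0 ∧ (monicPoly (χ a₀)).eval 0 ≠ 0 ∧
      ContDiffOn ℝ n ψ (Metric.ball a₀ (2 * ε)) ∧ ContDiffOn ℝ n χ (Metric.ball a₀ (2 * ε)) ∧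
      (∀ a ∈ Metric.ball a₀ (2 * ε),
        (monicPoly a).comp (X + C x) = monicPoly (ψ a) * monicPoly (χ a)) ∧
      ∀ a ∈ Metric.ball a₀ (2 * ε), ∀ y, |y - x| < 2 * ε → (monicPoly a).IsRoot y →
        (monicPoly (ψ a)).IsRoot (y - x) := by
  obtain ⟨k, ψ, χ, hn, h0, hψ, hχ, hne, hf⟩ := exists_local_factor n a₀ x hq
  have hr := eventually_isRoot_factor hχ.continuousAt hne hf
  have hP := ((hψ.eventually (by simp)).and (hχ.eventually (by simp))).and hf
  obtain ⟨ε, hε, h1, h2⟩ := exists_common_radius hP hr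
  exact ⟨k, ψ, χ, ε, hn, hε, h0, hne, fun a ha => (h1 a ha).1.1.contDiffWithinAt,
    fun a ha => (h1 a ha).1.2.contDiffWithinAt, fun a ha => (h1 a ha).2, h2⟩

/-- Curves starting near `a₀` stay in the region where `ψ` extracts a factor of degree `q < n`, to
which the induction hypothesis applies. The constant depends on `(a₀, x)` but not on the curve. -/
lemma exists_rootBound_near {n : ℕ} (hn : 1 ≤ n)
    (ih : ∀ q < n, ∀ δ > 0, ∀ D : ℝ, ∃ C, RootBound q δ D C fun _ _ => True)
    {δ D : ℝ} (hδ : 0 < δ) (a₀ : Fin n → ℝ) (x : ℝ)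
    (hq : (monicPoly a₀).rootMultiplicity x < n) :
    ∃ s ∈ 𝓝 (a₀, x), ∃ C, RootBound n δ D C fun A f => (A 0, f 0) ∈ s := by
  obtain ⟨q, hqdef⟩ : ∃ q, (monicPoly a₀).rootMultiplicity x = q := ⟨_, rfl⟩
  obtain ⟨k, ψ, χ, ε, -, hε, -, -, hψ, -, hfac, hroot⟩ := exists_ball_of_factor a₀ x hqdef
  rw [hqdef] at hq
  obtain ⟨D', -, hD'⟩ := exists_ckBound_comp Metric.isOpen_ball hψ (isCompact_closedBall a₀ ε)
    (Metric.closedBall_subset_ball (by linarith)) D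
  -- On this window a curve with derivative bounded by `D` moves at most `ε / 2`; it starts within
  -- `ε / 2` of `a₀`.
  set δ' := min δ (ε / (2 * (|D| + 1))) with hδ'
  have hδ'0 : 0 < δ' := by positivity
  obtain ⟨C, hC⟩ := ih q hq δ' hδ'0 D'
  refine ⟨Metric.ball (a₀, x) (ε / 2), Metric.ball_mem_nhds _ (by positivity), C, ?_⟩
  intro A hA hhyp f hf hr hmem
  rw [Metric.mem_ball, Prod.dist_eq, max_lt_iff] at hmem
  have hsub : Ioo (-δ') δ' ⊆ Ioo (-δ) δ :=
    Ioo_subset_Ioo (neg_le_neg (min_le_left _ _)) (min_le_left _ _)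
  have hmaps : MapsTo A (Ioo (-δ') δ') (Metric.closedBall a₀ ε) := by
    intro s hs
    have h1 := hA.norm_sub_le hn (hsub hs)
    have h2 : D * |s| ≤ ε / 2 := by
      have h3 : |s| ≤ ε / (2 * (|D| + 1)) := (abs_lt.2 hs).le.trans (min_le_right _ _)
      calc D * |s| ≤ (|D| + 1) * (ε / (2 * (|D| + 1))) := by
            gcongr
            linarith [le_abs_self D]
        _ = ε / 2 := by field_simp
    rw [Metric.mem_closedBall]
    have h4 := dist_triangle (A s) (A 0) a₀
    have h5 : dist (A 0) a₀ < ε / 2 := hmem.1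
    rw [dist_eq_norm (A s) (A 0)] at h4
    linarith
  have hbig : ∀ s ∈ Ioo (-δ') δ', A s ∈ Metric.ball a₀ (2 * ε) := fun s hs =>
    Metric.closedBall_subset_ball (by linarith) (hmaps hs)
  have hB : CkBound n (Ioo (-δ') δ') D' (ψ ∘ A) :=
    hD' _ A isOpen_Ioo (hA.mono le_rfl hsub le_rfl) hmaps
  have := hC (ψ ∘ A) (hB.mono hq.le subset_rfl le_rfl)
    (fun t ht => isHyperbolic_factor (hfac _ (hbig t ht)) (hhyp t (hsub ht)))
    (fun t => f t - x) (hf.sub continuousAt_const) ?_ trivial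
  · simpa using this
  · have h1 : ∀ᶠ t in 𝓝 (0 : ℝ), |f t - x| < 2 * ε := by
      have : ContinuousAt (fun t => |f t - x|) 0 := (hf.sub continuousAt_const).abs
      have h3 : dist (f 0) x < ε / 2 := hmem.2
      refine this.eventually_lt_const ?_
      change |f 0 - x| < 2 * ε
      rw [← Real.dist_eq]
      linarith
    have h2 : ∀ᶠ t in 𝓝 (0 : ℝ), t ∈ Ioo (-δ') δ' := Ioo_mem_nhds (by linarith) hδ'0
    filter_upwards [hr, h1, h2] with t ht1 ht2 ht3
    exact hroot _ (hbig t ht3) _ ht2 ht1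

/-- The possible initial data `(A 0, f 0)` fill a compact set, since Cauchy's bound confines `f 0`.
Finitely many neighbourhoods from `exists_rootBound_near` cover it. -/
lemma exists_rootBound_normalized {m : ℕ}
    (ih : ∀ q < m + 2, ∀ δ > 0, ∀ D : ℝ, ∃ C, RootBound q δ D C fun _ _ => True)
    {δ : ℝ} (hδ : 0 < δ) (D : ℝ) :
    ∃ C, RootBound (m + 2) δ D C fun A _ => A 0 0 = 0 ∧ A 0 1 = -(1 / 2) := by
  set R : ℝ := max D (1 + (m + 2 : ℕ) * D) with hR
  set K : Set ((Fin (m + 2) → ℝ) × ℝ) := Metric.closedBall 0 R ∩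
    {p | p.1 0 = 0 ∧ p.1 1 = -(1 / 2)} with hK
  have hKc : IsCompact K := by
    refine (isCompact_closedBall _ _).inter_right ?_
    exact (isClosed_eq (by fun_prop) continuous_const).inter
      (isClosed_eq (by fun_prop) continuous_const)
  have key : ∃ C, RootBound (m + 2) δ D C fun A f => (A 0, f 0) ∈ K := by
    refine hKc.induction_on (p := fun s => ∃ C, RootBound (m + 2) δ D C fun A f => (A 0, f 0) ∈ s)
      ?_ ?_ ?_ ?_
    · exact ⟨0, fun A _ _ f _ _ h => absurd h (notMem_empty _)⟩
    · rintro s t hst ⟨C, hC⟩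
      exact ⟨C, hC.mono le_rfl fun A f h => hst h⟩
    · rintro s t ⟨C, hC⟩ ⟨C', hC'⟩
      refine ⟨max C C', fun A hA hh f hf hr hm => ?_⟩
      rcases hm with hm | hm
      · exact hC.mono (le_max_left _ _) (fun _ _ h => h) A hA hh f hf hr hm
      · exact hC'.mono (le_max_right _ _) (fun _ _ h => h) A hA hh f hf hr hm
    · rintro ⟨a₀, x⟩ hx
      obtain ⟨s, hs, h⟩ := exists_rootBound_near (by omega) ih (D := D) hδ a₀ x
        (rootMultiplicity_lt_of_normalized hx.2.1 hx.2.2 x)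
      exact ⟨s, mem_nhdsWithin_of_mem_nhds hs, h⟩
  obtain ⟨C, hC⟩ := key
  refine ⟨C, fun A hA hh f hf hr hQ => hC A hA hh f hf hr ⟨?_, hQ⟩⟩
  have h0 : (0 : ℝ) ∈ Ioo (-δ) δ := by simp [hδ]
  have hA0 := hA.norm_le h0
  rw [mem_closedBall_zero_iff, Prod.norm_def]
  refine max_le (hA0.trans (le_max_left _ _)) ?_
  refine (abs_root_le hr.self_of_nhds).trans (le_trans ?_ (le_max_right _ _))
  gcongr

lemma sq_root_le {m : ℕ} {a : Fin (m + 2) → ℝ} (h : IsHyperbolic (monicPoly a)) (h0 : a 0 = 0) :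
    0 ≤ -2 * a 1 ∧ ∀ y, (monicPoly a).IsRoot y → y ^ 2 ≤ -2 * a 1 := by
  obtain ⟨v, -, hv⟩ := exists_monotone_roots h
  have e := (sum_roots_and_sum_sq_roots hv).2
  rw [h0] at e
  have e' : -2 * a 1 = ∑ j, v j ^ 2 := by rw [e]; ring
  rw [e']
  refine ⟨Finset.sum_nonneg fun j _ => sq_nonneg _, fun y hy => ?_⟩
  rw [hv, isRoot_prod_iff] at hy
  obtain ⟨j, rfl⟩ := hy
  exact Finset.single_le_sum (f := fun j => v j ^ 2) (fun j _ => sq_nonneg _) (Finset.mem_univ j)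

/-- Scaling roots and time by the same factor preserves Lipschitz constants, so the problem reduces
to the normalized case once uniform bounds survive the scaling. -/
lemma exists_rootBound_centered {m : ℕ}
    (ih : ∀ q < m + 2, ∀ δ > 0, ∀ D : ℝ, ∃ C, RootBound q δ D C fun _ _ => True)
    {δ : ℝ} (hδ : 0 < δ) (D : ℝ) :
    ∃ C, RootBound (m + 2) δ D C fun A _ => ∀ t ∈ Ioo (-δ) δ, A t 0 = 0 := by
  -- `R` dominates every scaling factor `r` used below, so `r * s` stays in the original interval
  -- when `|s| < δ / R`, whatever the curve.
  set R : ℝ := Real.sqrt (2 * |D|) + 1 with hR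
  have hR1 : 1 ≤ R := by rw [hR]; linarith [Real.sqrt_nonneg (2 * |D|)]
  set δ' := δ / R with hδ'
  have hδ'0 : 0 < δ' := by positivity
  set M : ℝ := 3 + 2 * (2 * |D|) * δ' ^ 2 with hM
  have hM1 : 1 ≤ M := by
    have : 0 ≤ 2 * (2 * |D|) * δ' ^ 2 := by positivity
    linarith
  obtain ⟨D₂, hD₂, htop⟩ := exists_ckBound_of_top (m + 2) hδ'0 (2 ^ (m + 2) * M ^ (m + 2))
    (R ^ (m + 2) * |D|)
  obtain ⟨C, hC⟩ := exists_rootBound_normalized ih hδ'0 D₂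
  refine ⟨max R C, fun A hA hh f hf hr hz => ?_⟩
  have h0 : (0 : ℝ) ∈ Ioo (-δ) δ := by simp [hδ]
  have hD : 0 ≤ D := (norm_nonneg _).trans (hA.norm_le h0)
  have hcomp := (ckBound_pi isOpen_Ioo hD).1 hA
  set V : ℝ → ℝ := fun t => -2 * A t 1 with hV
  have hVc : ContDiffOn ℝ 2 V (Ioo (-δ) δ) :=
    contDiffOn_const.mul ((hcomp 1).1.of_le (by exact_mod_cast (by omega : 2 ≤ m + 2)))
  have hV2 : ∀ t ∈ Ioo (-δ) δ, |iteratedDeriv 2 V t| ≤ 2 * |D| := by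
    intro t ht
    have e := iteratedDeriv_const_mul_comp_mul (-2) 1 (fun t => A t 1) 2 t
    simp only [one_mul, one_pow, mul_one] at e
    rw [hV, e, abs_mul]
    have := (hcomp 1).2 2 (by omega) t ht
    rw [Real.norm_eq_abs] at this
    rw [abs_of_nonneg hD]
    norm_num
    exact this
  have hVpos : ∀ t ∈ Ioo (-δ) δ, 0 ≤ V t := fun t ht => (sq_root_le (hh t ht) (hz t ht)).1
  have hV0 : V 0 ≤ 2 * |D| := by
    have := (norm_le_pi_norm (A 0) 1).trans (hA.norm_le h0)
    rw [Real.norm_eq_abs] at this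
    rw [abs_of_nonneg hD]
    have h2 := neg_abs_le (A 0 1)
    simp only [hV]
    linarith
  have hmem : ∀ᶠ t in 𝓝 (0 : ℝ), t ∈ Ioo (-δ) δ := isOpen_Ioo.mem_nhds h0
  -- If `V 0 = 0`, all roots vanish at `0` and `f ^ 2 ≤ V ≤ 2 * |D| * t ^ 2` suffices, without
  -- induction.
  rcases (hVpos 0 h0).eq_or_lt with hz0 | hpos
  · have hf0 : f 0 = 0 := by
      have := (sq_root_le (hh 0 h0) (hz 0 h0)).2 _ hr.self_of_nhds
      change f 0 ^ 2 ≤ V 0 at this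
      rw [← hz0] at this
      exact pow_eq_zero_iff (two_ne_zero) |>.1 (le_antisymm this (sq_nonneg _))
    filter_upwards [hr, hmem] with t ht1 ht2
    rw [hf0, sub_zero]
    have h1 := (sq_root_le (hh t ht2) (hz t ht2)).2 _ ht1
    change f t ^ 2 ≤ V t at h1
    have h2 := le_sq_of_nonneg_of_zero isOpen_Ioo (convex_Ioo (-δ) δ) h0 hVc hV2 hVpos hz0.symm ht2
    have h3 : |f t| ≤ Real.sqrt (2 * |D|) * |t| := by
      rw [← Real.sqrt_sq_eq_abs t, ← Real.sqrt_mul (by positivity)]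
      exact Real.abs_le_sqrt (h1.trans h2)
    refine h3.trans ?_
    gcongr
    exact le_trans (by rw [hR]; linarith) (le_max_left _ _)
  · set r := Real.sqrt (V 0) with hr_def
    have hr0 : 0 < r := Real.sqrt_pos.2 hpos
    have hrR : r ≤ R := by
      have : r ≤ Real.sqrt (2 * |D|) := Real.sqrt_le_sqrt hV0
      rw [hR]; linarith
    have hr2 : r ^ 2 = V 0 := Real.sq_sqrt hpos.le
    have hin : ∀ s ∈ Ioo (-δ') δ', r * s ∈ Ioo (-δ) δ := by
      intro s hs
      have : |r * s| < δ := by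
        rw [abs_mul, abs_of_pos hr0]
        calc r * |s| ≤ R * |s| := by gcongr
          _ < R * δ' := by gcongr; exact abs_lt.2 hs
          _ = δ := by rw [hδ']; field_simp
      exact abs_lt.1 this
    set B : ℝ → Fin (m + 2) → ℝ := fun s => dilate r⁻¹ (A (r * s)) with hB
    have hBh : ∀ s ∈ Ioo (-δ') δ', IsHyperbolic (monicPoly (B s)) := fun s hs =>
      isHyperbolic_dilate (inv_ne_zero hr0.ne') (hh _ (hin s hs))
    have hB0 : ∀ s ∈ Ioo (-δ') δ', B s 0 = 0 := fun s hs => by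
      simp [hB, dilate, hz _ (hin s hs)]
    have hmul : ContDiff ℝ (2 : ℕ) fun s : ℝ => r * s := contDiff_const.mul contDiff_id
    have hW : ∀ s, -2 * B s 1 = (r⁻¹) ^ 2 * V (r * s) := fun s => by
      simp only [hB, hV, dilate, Fin.val_one]
      ring
    have hWle : ∀ s ∈ Ioo (-δ') δ', -2 * B s 1 ≤ M := by
      intro s hs
      refine le_of_nonneg_of_one (V := fun s => -2 * B s 1) hδ'0 (M := 2 * |D|) ?_ ?_
        (fun s hs => (sq_root_le (hBh s hs) (hB0 s hs)).1) ?_ hs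
      · simp only [hW]
        exact contDiffOn_const.mul (hVc.comp hmul.contDiffOn hin)
      · intro s hs
        simp only [hW]
        rw [iteratedDeriv_const_mul_comp_mul, ← mul_pow, inv_mul_cancel₀ hr0.ne', one_pow, one_mul]
        exact hV2 _ (hin s hs)
      · simp only [hW, mul_zero, ← hr2]
        rw [← mul_pow, inv_mul_cancel₀ hr0.ne', one_pow]
    -- The values of `B` are bounded through its roots. Its derivatives of order `m + 2` carry the
    -- nonnegative power `r ^ (m + 2 - (j + 1))`, harmless even for tiny `r`. Interpolation supplies
    -- the orders between.
    have hBck : CkBound (m + 2) (Ioo (-δ') δ') D₂ B := by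
      rw [ckBound_pi isOpen_Ioo hD₂]
      intro j
      refine htop _ ?_ ?_ ?_
      · exact contDiffOn_const.mul ((hcomp j).1.comp
          (contDiff_const.mul contDiff_id).contDiffOn hin)
      · intro s hs
        obtain ⟨v, -, hv⟩ := exists_monotone_roots (hBh s hs)
        have hvM : ∀ i, |v i| ≤ M := by
          intro i
          have h1 := (sq_root_le (hBh s hs) (hB0 s hs)).2 (v i)
            (by rw [hv, isRoot_prod_iff]; exact ⟨i, rfl⟩)
          have h2 := hWle s hs
          exact abs_le_of_sq_le_sq (by nlinarith) (by linarith)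
        refine (norm_le_of_roots_le hv hvM j).trans ?_
        exact mul_le_mul_of_nonneg_left (pow_le_pow_right₀ hM1 (by omega)) (by positivity)
      · intro s hs
        have e := iteratedDeriv_const_mul_comp_mul (r⁻¹ ^ (j.val + 1)) r (fun t => A t j) (m + 2) s
        change |iteratedDeriv (m + 2) (fun s => r⁻¹ ^ (j.val + 1) * A (r * s) j) s| ≤ _
        rw [e, abs_mul]
        have h1 : r⁻¹ ^ (j.val + 1) * r ^ (m + 2) = r ^ (m + 2 - (j.val + 1)) := by
          rw [inv_pow, pow_sub₀ _ hr0.ne' (by omega)]; ring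
        rw [h1, abs_of_nonneg (by positivity)]
        have h2 := (hcomp j).2 (m + 2) le_rfl _ (hin s hs)
        rw [Real.norm_eq_abs] at h2
        have h3 : r ^ (m + 2 - (j.val + 1)) ≤ R ^ (m + 2) :=
          (pow_le_pow_left₀ hr0.le hrR _).trans (pow_le_pow_right₀ hR1 (by omega))
        exact mul_le_mul h3 (h2.trans (le_abs_self D)) (abs_nonneg _) (by positivity)
    have hmt : Tendsto (fun s : ℝ => r * s) (𝓝 0) (𝓝 0) := by
      have : Continuous fun s : ℝ => r * s := by fun_prop
      simpa using this.tendsto 0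
    have hdt : Tendsto (fun t : ℝ => r⁻¹ * t) (𝓝 0) (𝓝 0) := by
      have : Continuous fun s : ℝ => r⁻¹ * s := by fun_prop
      simpa using this.tendsto 0
    have hfin := hC B hBck hBh (fun s => r⁻¹ * f (r * s))
      (by
        have h1 : ContinuousAt f (r * 0) := by simpa using hf
        exact continuousAt_const.mul (ContinuousAt.comp (f := fun s : ℝ => r * s) h1 (by fun_prop)))
      (by
        filter_upwards [hmt.eventually hr] with s hs
        exact (isRoot_dilate (inv_ne_zero hr0.ne') _ _).2 hs)
      ⟨hB0 0 (by simp [hδ'0]), by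
        have := hW 0
        rw [mul_zero, ← hr2, ← mul_pow, inv_mul_cancel₀ hr0.ne', one_pow] at this
        linarith⟩
    filter_upwards [hdt.eventually hfin] with t ht
    rw [mul_inv_cancel_left₀ hr0.ne', mul_zero, ← mul_sub, abs_mul, abs_mul,
      abs_of_pos (inv_pos.2 hr0)] at ht
    have h1 : |f t - f 0| ≤ C * |t| := by
      have : r⁻¹ * |f t - f 0| ≤ r⁻¹ * (C * |t|) := by linarith
      exact le_of_mul_le_mul_left this (inv_pos.2 hr0)
    refine h1.trans ?_
    gcongr
    exact le_max_right _ _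

/-- Bronshtein's theorem. Degree `0` has no roots and degree `1` is explicit; otherwise the
Tschirnhaus translation centres the roots at their mean. -/
theorem exists_rootBound (n : ℕ) : ∀ δ > 0, ∀ D : ℝ, ∃ C, RootBound n δ D C fun _ _ => True := by
  induction n using Nat.strong_induction_on with
  | _ n ih =>
  intro δ hδ D
  have h0 : (0 : ℝ) ∈ Ioo (-δ) δ := by simp [hδ]
  have hmem : ∀ᶠ t in 𝓝 (0 : ℝ), t ∈ Ioo (-δ) δ := isOpen_Ioo.mem_nhds h0
  match n, ih with
  | 0, _ =>
    refine ⟨0, fun A _ _ f _ hr _ => ?_⟩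
    have := hr.self_of_nhds
    simp [monicPoly] at this
  | 1, _ =>
    refine ⟨D, fun A hA _ f _ hr _ => ?_⟩
    have hf : ∀ t, (monicPoly (A t)).IsRoot (f t) → f t = -A t 0 := by
      intro t ht
      rw [IsRoot, monicPoly_eval] at ht
      simp at ht
      linarith
    filter_upwards [hr, hmem] with t ht ht'
    rw [hf t ht, hf 0 hr.self_of_nhds, ← abs_neg]
    have h1 := hA.norm_sub_le le_rfl ht'
    have h2 := norm_le_pi_norm (A t - A 0) 0
    rw [Real.norm_eq_abs, Pi.sub_apply] at h2
    rw [show -(-A t 0 - -A 0 0) = A t 0 - A 0 0 by ring]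
    exact h2.trans h1
  | m + 2, ih =>
    set T : (Fin (m + 2) → ℝ) → Fin (m + 2) → ℝ :=
      fun a => translate a (-(a 0) / ((m + 1 : ℕ) + 1)) with hT
    have hTc : ContDiff ℝ (m + 2 : ℕ) T := by
      have h1 : ContDiff ℝ (m + 2 : ℕ) fun a : Fin (m + 2) → ℝ => -(a 0) / (((m + 1 : ℕ) : ℝ) + 1) := by
        fun_prop
      exact contDiff_translate_comp contDiff_id h1
    obtain ⟨D₁, -, hD₁⟩ := exists_ckBound_comp isOpen_univ hTc.contDiffOn
      (isCompact_closedBall 0 D) (subset_univ _) D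
    obtain ⟨C, hC⟩ := exists_rootBound_centered ih hδ D₁
    -- The mean of the roots is itself Lipschitz with constant at most `D`, which is added back
    -- after centring.
    refine ⟨C + D, fun A hA hh f hf hr _ => ?_⟩
    have hc0 : ContinuousAt (fun t => A t 0) 0 := continuousAt_pi.1 (hA.continuousAt hδ) 0
    have hB := hD₁ _ A isOpen_Ioo hA fun t ht => mem_closedBall_zero_iff.2 (hA.norm_le ht)
    have := hC (T ∘ A) hB (fun t ht => isHyperbolic_translate (hh t ht) _)
      (fun t => f t - -(A t 0) / ((m + 1 : ℕ) + 1)) (hf.sub (hc0.neg.div_const _))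
      (by
        filter_upwards [hr] with t ht
        rw [IsRoot, Function.comp_apply, hT, translate_eval, sub_add_cancel]
        exact ht)
      (fun t _ => by
        change translate (A t) _ 0 = 0
        rw [translate_zero_coeff]
        field_simp
        ring)
    filter_upwards [this, hmem] with t ht ht'
    have h1 := hA.norm_sub_le (by omega) ht'
    have h2 := norm_le_pi_norm (A t - A 0) 0
    rw [Real.norm_eq_abs, Pi.sub_apply] at h2
    have h3 : |(A t 0 - A 0 0) / ((m + 1 : ℕ) + 1)| ≤ D * |t| := by
      rw [abs_div]
      refine (div_le_self (abs_nonneg _) ?_).trans (h2.trans h1)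
      rw [abs_of_nonneg (by positivity)]
      have : (0 : ℝ) ≤ (m + 1 : ℕ) := Nat.cast_nonneg _
      linarith
    have e : f t - f 0 = (f t - -(A t 0) / ((m + 1 : ℕ) + 1) - (f 0 - -(A 0 0) / ((m + 1 : ℕ) + 1)))
        - (A t 0 - A 0 0) / ((m + 1 : ℕ) + 1) := by ring
    rw [e]
    refine (abs_sub _ _).trans ?_
    linarith


/-! ### Continuity of the roots -/

/-- The increasing enumeration is continuous: along any ultrafilter the bounded root vectors have a
limit, which is again increasing with the right product, hence is the enumeration at the limit
point. -/
lemma exists_continuousOn_roots {n : ℕ} {S : Set ℝ} {A : ℝ → Fin n → ℝ} (hA : ContinuousOn A S)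
    (hh : ∀ t ∈ S, IsHyperbolic (monicPoly (A t))) :
    ∃ v : Fin n → ℝ → ℝ, (∀ t ∈ S, monicPoly (A t) = ∏ j, (X - C (v j t))) ∧
      ∀ j, ContinuousOn (v j) S := by
  have hex : ∀ t, ∃ w : Fin n → ℝ, t ∈ S → Monotone w ∧ monicPoly (A t) = ∏ j, (X - C (w j)) := by
    intro t
    by_cases ht : t ∈ S
    · obtain ⟨w, hw⟩ := exists_monotone_roots (hh t ht)
      exact ⟨w, fun _ => hw⟩
    · exact ⟨0, fun h => absurd h ht⟩
  choose w hw using hex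
  refine ⟨fun j t => w t j, fun t ht => (hw t ht).2, ?_⟩
  have key : ContinuousOn w S := by
    intro t₀ ht₀
    have hAt : Tendsto A (𝓝[S] t₀) (𝓝 (A t₀)) := hA t₀ ht₀
    rw [ContinuousWithinAt, tendsto_iff_ultrafilter]
    intro U hU
    have hS : ∀ᶠ t in (U : Filter ℝ), t ∈ S := hU self_mem_nhdsWithin
    set R : ℝ := 1 + n * (‖A t₀‖ + 1) with hR
    have hbd : ∀ᶠ t in (U : Filter ℝ), w t ∈ Metric.closedBall (0 : Fin n → ℝ) R := by
      have h1 : ∀ᶠ t in 𝓝[S] t₀, ‖A t‖ < ‖A t₀‖ + 1 := hAt.norm.eventually_lt_const (by linarith)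
      filter_upwards [hS, hU h1] with t ht1 ht2
      rw [mem_closedBall_zero_iff, pi_norm_le_iff_of_nonneg (by positivity)]
      intro j
      refine (abs_root_le (a := A t) ?_).trans ?_
      · rw [(hw t ht1).2, isRoot_prod_iff]; exact ⟨j, rfl⟩
      · rw [hR]; gcongr
    obtain ⟨L, -, hL⟩ := (isCompact_closedBall (0 : Fin n → ℝ) R).ultrafilter_le_nhds (U.map w)
      (le_principal_iff.2 hbd)
    have hL' : Tendsto w U (𝓝 L) := hL
    have hLj : ∀ j, Tendsto (fun t => w t j) U (𝓝 (L j)) := fun j => (tendsto_pi_nhds.1 hL') j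
    have hmono : Monotone L := by
      intro i j hij
      refine le_of_tendsto_of_tendsto (hLj i) (hLj j) ?_
      filter_upwards [hS] with t ht
      exact (hw t ht).1 hij
    have hprod : monicPoly (A t₀) = ∏ j, (X - C (L j)) := by
      refine Polynomial.funext fun z => ?_
      have h1 : Tendsto (fun t => (monicPoly (A t)).eval z) U (𝓝 ((monicPoly (A t₀)).eval z)) := by
        have hc : Continuous fun a : Fin n → ℝ => (monicPoly a).eval z :=
          continuous_eval.comp (f := fun a : Fin n → ℝ => (a, z)) (by fun_prop)
        exact (hc.tendsto (A t₀)).comp (hAt.mono_left hU)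
      have h2 : Tendsto (fun t => (monicPoly (A t)).eval z) U (𝓝 ((∏ j, (X - C (L j))).eval z)) := by
        have h3 : Tendsto (fun t => ∏ j, (z - w t j)) U (𝓝 (∏ j, (z - L j))) :=
          tendsto_finsetProd _ fun j _ => (hLj j).const_sub z
        rw [eval_prod]
        simp only [eval_sub, eval_X, eval_C]
        refine h3.congr' ?_
        filter_upwards [hS] with t ht
        rw [(hw t ht).2, eval_prod]
        simp
      exact tendsto_nhds_unique h1 h2
    have : L = w t₀ := eq_of_monotone_of_prod_eq hmono (hw t₀ ht₀).1 (by
      rw [← hprod, (hw t₀ ht₀).2])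
    rw [← this]
    exact hL'
  intro j
  exact continuousOn_pi.1 key j

/-- The polynomial of `c` has no zero on the compact set of bounded points at distance at least `ε`
from its roots, and this persists for nearby coefficients; Cauchy's bound excludes roots escaping to
infinity. -/
lemma eventually_root_near {n : ℕ} (c : Fin n → ℝ) {ε : ℝ} (hε : 0 < ε) :
    ∀ᶠ a in 𝓝 c, ∀ y, (monicPoly a).IsRoot y → ∃ z, (monicPoly c).IsRoot z ∧ |y - z| < ε := by
  set R : ℝ := 1 + n * (‖c‖ + 1) with hR
  set K : Set ℝ := Metric.closedBall 0 R ∩ ⋂ z ∈ {z | (monicPoly c).IsRoot z}, {y | ε ≤ |y - z|}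
    with hK
  have hKc : IsCompact K := by
    refine (isCompact_closedBall _ _).inter_right (isClosed_biInter fun z _ => ?_)
    exact isClosed_le continuous_const (by fun_prop)
  have h1 : ∀ᶠ a in 𝓝 c, ∀ y ∈ K, (monicPoly a).eval y ≠ 0 := by
    refine hKc.eventually_forall_of_forall_eventually fun y hy => ?_
    refine (continuous_eval.tendsto (c, y)).eventually_ne ?_
    intro h0
    have := mem_iInter₂.1 hy.2 y h0
    simp at this
    linarith
  have h2 : ∀ᶠ a in 𝓝 c, ‖a‖ < ‖c‖ + 1 := continuous_norm.continuousAt.eventually_lt_const (by linarith)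
  filter_upwards [h1, h2] with a ha1 ha2 y hy
  by_contra! hcon
  refine ha1 y ⟨?_, mem_iInter₂.2 fun z hz => hcon z hz⟩ hy
  rw [mem_closedBall_zero_iff, Real.norm_eq_abs]
  refine (abs_root_le hy).trans ?_
  rw [hR]; gcongr

/-- The image of `f` contains the interval between any two of its values and is covered by at most
`N` balls of radius `ε'`, so comparing lengths bounds the oscillation. The neighbourhood depends
neither on `f` nor on `S`, which later makes differentiability uniform. -/
lemma exists_uniform_oscillation {n : ℕ} (c : Fin n → ℝ) {ε : ℝ} (hε : 0 < ε) :
    ∃ W ∈ 𝓝 c, ∀ (S : Set ℝ) (A : ℝ → Fin n → ℝ) (f : ℝ → ℝ), IsPreconnected S →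
      (∀ t ∈ S, A t ∈ W) → ContinuousOn f S → (∀ t ∈ S, (monicPoly (A t)).IsRoot (f t)) →
      ∀ s ∈ S, ∀ t ∈ S, |f s - f t| < ε := by
  set Z := (monicPoly c).roots.toFinset with hZ
  set N : ℝ := (Z.card : ℝ) with hN
  have hN0 : 0 ≤ N := Nat.cast_nonneg _
  set ε' := ε / (2 * (N + 1)) with hε'
  have hε'0 : 0 < ε' := by positivity
  refine ⟨_, eventually_root_near c hε'0, fun S A f hS hA hf hr s hs t ht => ?_⟩
  have himg : uIcc (f s) (f t) ⊆ ⋃ z ∈ Z, Metric.ball z ε' := by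
    intro y hy
    have hoc := (hS.image f hf).ordConnected
    obtain ⟨r, hrS, rfl⟩ := hoc.uIcc_subset (mem_image_of_mem f hs) (mem_image_of_mem f ht) hy
    obtain ⟨z, hz, hyz⟩ := hA r hrS (f r) (hr r hrS)
    refine mem_iUnion₂.2 ⟨z, ?_, by rwa [Metric.mem_ball, Real.dist_eq]⟩
    rw [hZ, Multiset.mem_toFinset, mem_roots (monicPoly_monic c).ne_zero]
    exact hz
  have h1 := (MeasureTheory.measure_mono (μ := MeasureTheory.volume) himg).trans
    (MeasureTheory.measure_biUnion_finset_le Z _)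
  simp only [Real.volume_interval, Real.volume_ball, Finset.sum_const, nsmul_eq_mul] at h1
  rw [← ENNReal.ofReal_natCast, ← ENNReal.ofReal_mul (by positivity),
    ENNReal.ofReal_le_ofReal_iff (by positivity)] at h1
  rw [abs_sub_comm]
  refine h1.trans_lt ?_
  change N * (2 * ε') < ε
  have : (N + 1) * (2 * ε') = ε := by rw [hε']; field_simp
  nlinarith

/-! ### Functions vanishing to finite order -/

lemma isLittleO_iteratedDeriv {δ : ℝ} (hδ : 0 < δ) {m : ℕ} : ∀ {g : ℝ → ℝ},
    ContDiffOn ℝ m g (Ioo (-δ) δ) → (∀ k ≤ m, iteratedDeriv k g 0 = 0) →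
    ∀ k ≤ m, (iteratedDeriv k g) =o[𝓝 0] fun h => h ^ (m - k) := by
  have h0 : (0 : ℝ) ∈ Ioo (-δ) δ := by simp [hδ]
  induction m with
  | zero =>
    intro g hg hz k hk
    obtain rfl : k = 0 := by omega
    have hc : ContinuousAt g 0 := hg.continuousOn.continuousAt (isOpen_Ioo.mem_nhds h0)
    have hz0 : g 0 = 0 := by simpa using hz 0 le_rfl
    simp only [iteratedDeriv_zero, Nat.sub_zero, pow_zero, Asymptotics.isLittleO_one_iff]
    have hc' : Tendsto g (𝓝 0) (𝓝 (g 0)) := hc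
    rwa [hz0] at hc'
  | succ m ih =>
    intro g hg hz k hk
    have hg' : ContDiffOn ℝ m (deriv g) (Ioo (-δ) δ) :=
      hg.deriv_of_isOpen isOpen_Ioo (by exact_mod_cast le_rfl)
    have hd := ih hg' (fun k hk => by rw [← iteratedDeriv_succ']; exact hz (k + 1) (by omega))
    rcases k with _ | k
    · have h1 := hd 0 (Nat.zero_le _)
      have hz0 : g 0 = 0 := by simpa using hz 0 (Nat.zero_le _)
      have h2 := (convex_Ioo (-δ) δ).isLittleO_pow_succ_real (f := g) (f' := deriv g) (n := m) h0
        (fun x hx => ((hg.differentiableOn (by exact_mod_cast Nat.succ_ne_zero m)).differentiableAt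
          (isOpen_Ioo.mem_nhds hx)).hasDerivAt.hasDerivWithinAt)
        (by simpa using h1.mono nhdsWithin_le_nhds)
      rw [isOpen_Ioo.nhdsWithin_eq h0] at h2
      simpa [hz0] using h2
    · have h1 := hd k (by omega)
      rw [iteratedDeriv_succ']
      simpa using h1

lemma iteratedDeriv_const_mul_pow_zero (c : ℝ) (k i : ℕ) :
    iteratedDeriv i (fun h : ℝ => c * h ^ k) 0 = if i = k then c * k.factorial else 0 := by
  rw [iteratedDeriv_const_mul_field, iteratedDeriv_fun_pow_zero]
  split_ifs <;> simp

lemma iteratedDeriv_sub_pow {δ : ℝ} (hδ : 0 < δ) {m : ℕ} {g : ℝ → ℝ}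
    (hg : ContDiffOn ℝ m g (Ioo (-δ) δ)) (c : ℝ) (k : ℕ) {i : ℕ} (hi : i ≤ m) :
    iteratedDeriv i (fun h => g h - c * h ^ k) 0 =
      iteratedDeriv i g 0 - if i = k then c * k.factorial else 0 := by
  have h0 : (0 : ℝ) ∈ Ioo (-δ) δ := by simp [hδ]
  have h1 : ContDiffAt ℝ i g 0 :=
    (hg.contDiffAt (isOpen_Ioo.mem_nhds h0)).of_le (by exact_mod_cast hi)
  have h2 : ContDiffAt ℝ i (fun h : ℝ => c * h ^ k) 0 := by fun_prop
  rw [← iteratedDeriv_const_mul_pow_zero]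
  exact iteratedDeriv_sub h1 h2

/-- The first nonzero derivative of order `k < m` would contribute a term in `h ^ k`, too large for
`O(h ^ m)`. -/
lemma iteratedDeriv_eq_zero_of_isBigO {δ : ℝ} (hδ : 0 < δ) {m : ℕ} {g : ℝ → ℝ}
    (hg : ContDiffOn ℝ m g (Ioo (-δ) δ)) (hO : g =O[𝓝 0] fun h => h ^ m) (k : ℕ) (hk : k < m) :
    iteratedDeriv k g 0 = 0 := by
  induction k using Nat.strong_induction_on with
  | _ k ih =>
  set c := iteratedDeriv k g 0 / k.factorial with hc
  have hfac : (k.factorial : ℝ) ≠ 0 := by positivity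
  have hgk : ContDiffOn ℝ k g (Ioo (-δ) δ) := hg.of_le (by exact_mod_cast hk.le)
  have h1 := isLittleO_iteratedDeriv hδ (m := k) (g := fun h => g h - c * h ^ k)
    (hgk.sub (by fun_prop)) (by
      intro i hi
      rw [iteratedDeriv_sub_pow hδ hgk c k hi]
      rcases hi.eq_or_lt with rfl | hlt
      · rw [if_pos rfl, hc, div_mul_cancel₀ _ hfac, sub_self]
      · rw [if_neg hlt.ne, ih i hlt (hlt.trans hk), sub_zero]) 0 (Nat.zero_le _)
  simp only [iteratedDeriv_zero, Nat.sub_zero] at h1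
  have h2 : g =o[𝓝 0] fun h : ℝ => h ^ k :=
    hO.trans_isLittleO (Asymptotics.isLittleO_pow_pow hk)
  have h3 : (fun h : ℝ => c * h ^ k) =o[𝓝 0] fun h : ℝ => h ^ k := by
    have := h2.sub h1
    simpa using this
  have h4 : c = 0 := by
    by_contra hne
    rw [Asymptotics.isLittleO_const_mul_left_iff hne] at h3
    have h5 := (h3.mono (nhdsWithin_le_nhds (s := {0}ᶜ)))
    have h6 := Asymptotics.isLittleO_irrefl (f'' := fun h : ℝ => h ^ k) (l := 𝓝[≠] (0 : ℝ)) (by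
      refine Eventually.frequently ?_
      filter_upwards [self_mem_nhdsWithin] with h hh
      exact pow_ne_zero _ hh)
    exact h6 h5
  rw [hc, div_eq_zero_iff] at h4
  exact h4.resolve_right hfac

/-- The second limit is `h ^ (k - m)` times the `k`-th derivative of the remainder, at `h = exp u`.
For `k ≤ m` it is Peano's form of Taylor's theorem; for `k > m` the weight tends to `0` and the
derivative stays bounded. -/
lemma exists_taylor_leading {δ : ℝ} (hδ : 0 < δ) {m q : ℕ} (hmq : m ≤ q) {g : ℝ → ℝ}
    (hg : ContDiffOn ℝ q g (Ioo (-δ) δ)) (hO : g =O[𝓝 0] fun h => h ^ m) :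
    ∃ c : ℝ, Tendsto (fun h => (h ^ m)⁻¹ * g h) (𝓝[≠] 0) (𝓝 c) ∧
      ∀ k ≤ q, Tendsto (fun u : ℝ => Real.exp (((k : ℝ) - m) * u) *
        iteratedDeriv k (fun h => g h - c * h ^ m) (Real.exp u)) atBot (𝓝 0) := by
  have h0 : (0 : ℝ) ∈ Ioo (-δ) δ := by simp [hδ]
  have hgm : ContDiffOn ℝ m g (Ioo (-δ) δ) := hg.of_le (by exact_mod_cast hmq)
  have hfac : (m.factorial : ℝ) ≠ 0 := by positivity
  set c := iteratedDeriv m g 0 / m.factorial with hc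
  have hG : ContDiffOn ℝ q (fun h => g h - c * h ^ m) (Ioo (-δ) δ) := hg.sub (by fun_prop)
  have h1 := isLittleO_iteratedDeriv hδ (m := m) (g := fun h => g h - c * h ^ m)
    (hgm.sub (by fun_prop)) (by
      intro i hi
      rw [iteratedDeriv_sub_pow hδ hgm c m hi]
      rcases hi.eq_or_lt with rfl | hlt
      · rw [if_pos rfl, hc, div_mul_cancel₀ _ hfac, sub_self]
      · rw [if_neg hlt.ne, iteratedDeriv_eq_zero_of_isBigO hδ hgm hO i hlt, sub_zero])
  have hexp : Tendsto Real.exp atBot (𝓝 0) := Real.tendsto_exp_atBot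
  refine ⟨c, ?_, fun k hk => ?_⟩
  · have h2 := (h1 0 (Nat.zero_le _)).mono (nhdsWithin_le_nhds (s := {0}ᶜ))
    simp only [iteratedDeriv_zero, Nat.sub_zero] at h2
    have h3 := h2.tendsto_div_nhds_zero.add_const c
    rw [zero_add] at h3
    refine h3.congr' ?_
    filter_upwards [self_mem_nhdsWithin] with h hh
    have : h ^ m ≠ 0 := pow_ne_zero _ hh
    field_simp
    ring
  · rcases Nat.lt_or_ge m k with hlt | hge
    · have hcont : ContinuousAt (iteratedDeriv k fun h => g h - c * h ^ m) 0 :=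
        (continuousOn_iteratedDeriv isOpen_Ioo hG hk).continuousAt (isOpen_Ioo.mem_nhds h0)
      have h2 : Tendsto (fun u : ℝ => Real.exp (((k : ℝ) - m) * u)) atBot (𝓝 0) := by
        refine Real.tendsto_exp_atBot.comp ?_
        refine Tendsto.const_mul_atBot ?_ tendsto_id
        have : (m : ℝ) < k := by exact_mod_cast hlt
        linarith
      have h3 := h2.mul (hcont.tendsto.comp hexp)
      rw [zero_mul] at h3
      exact h3
    · have h2 := ((h1 k hge).comp_tendsto hexp).tendsto_div_nhds_zero
      refine h2.congr fun u => ?_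
      simp only [Function.comp_apply]
      rw [div_eq_mul_inv, mul_comm, ← Real.exp_nat_mul, ← Real.exp_neg, Nat.cast_sub hge]
      congr 2
      ring

/-! ### Logarithmic reparametrization -/

/-- The function `h ↦ h ^ (-m) * g h` in the variable `u = log h`. -/
noncomputable def logScale (m : ℝ) (g : ℝ → ℝ) (u : ℝ) : ℝ := Real.exp (-m * u) * g (Real.exp u)

lemma mapsTo_exp {δ : ℝ} (hδ : 0 < δ) : MapsTo Real.exp (Iio (Real.log δ)) (Ioo 0 δ) := fun u hu =>
  ⟨Real.exp_pos u, by rw [← Real.lt_log_iff_exp_lt hδ]; exact hu⟩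

lemma contDiffOn_logScale {δ : ℝ} (hδ : 0 < δ) {i : ℕ} (m : ℝ) {g : ℝ → ℝ}
    (hg : ContDiffOn ℝ i g (Ioo 0 δ)) : ContDiffOn ℝ i (logScale m g) (Iio (Real.log δ)) := by
  have h1 : ContDiff ℝ i fun u : ℝ => Real.exp (-m * u) := by fun_prop
  exact h1.contDiffOn.mul (hg.comp Real.contDiff_exp.contDiffOn (mapsTo_exp hδ))

/-- Induction on the order through the identity `(logScale m g)' = -m * logScale m g + logScale (m -
1) g'`. -/
lemma tendsto_iteratedDeriv_logScale {δ : ℝ} (hδ : 0 < δ) (i : ℕ) : ∀ (m : ℝ) (g : ℝ → ℝ),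
    ContDiffOn ℝ i g (Ioo 0 δ) →
    (∀ k ≤ i, Tendsto (fun u : ℝ => Real.exp (((k : ℝ) - m) * u) *
        iteratedDeriv k g (Real.exp u)) atBot (𝓝 0)) →
    Tendsto (iteratedDeriv i (logScale m g)) atBot (𝓝 0) := by
  induction i with
  | zero =>
    intro m g _ h
    have := h 0 le_rfl
    refine this.congr fun u => ?_
    simp [logScale]
  | succ i ih =>
    intro m g hg h
    have hgi : ContDiffOn ℝ i g (Ioo 0 δ) := hg.of_le (by exact_mod_cast Nat.le_succ i)
    have hg' : ContDiffOn ℝ i (deriv g) (Ioo 0 δ) :=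
      hg.deriv_of_isOpen isOpen_Ioo (by exact_mod_cast le_rfl)
    have h1 := ih m g hgi fun k hk => h k (by omega)
    have h2 := ih (m - 1) (deriv g) hg' fun k hk => by
      have := h (k + 1) (by omega)
      rw [iteratedDeriv_succ'] at this
      refine this.congr fun u => ?_
      congr 3
      push_cast
      ring
    have h3 := (h1.const_mul (-m)).add h2
    rw [mul_zero, add_zero] at h3
    refine h3.congr' ?_
    filter_upwards [eventually_lt_atBot (Real.log δ)] with u hu
    have hder : deriv (logScale m g) =ᶠ[𝓝 u]
        (fun u => -m * logScale m g u) + logScale (m - 1) (deriv g) := by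
      filter_upwards [isOpen_Iio.mem_nhds hu] with s hs
      have hgs : HasDerivAt g (deriv g (Real.exp s)) (Real.exp s) :=
        ((hg.differentiableOn (by exact_mod_cast Nat.succ_ne_zero i)).differentiableAt
          (isOpen_Ioo.mem_nhds (mapsTo_exp hδ hs))).hasDerivAt
      have he : HasDerivAt (fun u => Real.exp (-m * u)) (Real.exp (-m * s) * (-m)) s := by
        simpa using ((hasDerivAt_id s).const_mul (-m)).exp
      have hp := he.mul (hgs.comp s (Real.hasDerivAt_exp s))
      have := hp.deriv
      change deriv (logScale m g) s = _ at this
      rw [this]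
      simp only [Pi.add_apply, logScale, Function.comp_apply]
      have e : Real.exp (-(m - 1) * s) = Real.exp (-m * s) * Real.exp s := by
        rw [← Real.exp_add]; congr 1; ring
      rw [e]
      ring
    have hu' : Iio (Real.log δ) ∈ 𝓝 u := isOpen_Iio.mem_nhds hu
    have c1 : ContDiffAt ℝ i (logScale m g) u := (contDiffOn_logScale hδ m hgi).contDiffAt hu'
    have c2 : ContDiffAt ℝ i (logScale (m - 1) (deriv g)) u :=
      (contDiffOn_logScale hδ (m - 1) hg').contDiffAt hu'
    rw [iteratedDeriv_succ', hder.iteratedDeriv_eq i, iteratedDeriv_add (contDiffAt_const.mul c1) c2,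
      iteratedDeriv_const_mul_field]


/-! ### Rescaling at a point where all roots vanish -/

lemma exists_ckBound {E : Type*} [NormedAddCommGroup E] [NormedSpace ℝ E] {k : ℕ} {S K T : Set ℝ}
    {A : ℝ → E} (hS : IsOpen S) (hA : ContDiffOn ℝ k A S) (hK : IsCompact K) (hKS : K ⊆ S)
    (hT : T ⊆ K) : ∃ D, CkBound k T D A := by
  have h1 : ∀ i : ℕ, ∃ C, i ≤ k → ∀ x ∈ K, ‖iteratedDeriv i A x‖ ≤ C := by
    intro i
    by_cases hi : i ≤ k
    · obtain ⟨C, hC⟩ := hK.exists_bound_of_continuousOn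
        ((continuousOn_iteratedDeriv hS hA hi).mono hKS)
      exact ⟨C, fun _ => hC⟩
    · exact ⟨0, fun h => absurd h hi⟩
  choose C hC using h1
  refine ⟨∑ i ∈ Finset.range (k + 1), |C i|, hA.mono (hT.trans hKS), fun i hi t ht => ?_⟩
  refine (hC i hi t (hT ht)).trans ((le_abs_self _).trans ?_)
  exact Finset.single_le_sum (f := fun i => |C i|) (fun i _ => abs_nonneg _)
    (Finset.mem_range.2 (by omega))

/-- Since `B 0 = 0`, all roots vanish at `0`, so Bronshtein's bound makes each of them `O(h)`. -/
lemma isBigO_coeff {q : ℕ} {δ : ℝ} (hδ : 0 < δ) {B : ℝ → Fin q → ℝ}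
    (hB : ContDiffOn ℝ q B (Ioo (-δ) δ)) (hh : ∀ t ∈ Ioo (-δ) δ, IsHyperbolic (monicPoly (B t)))
    (h0 : B 0 = 0) (j : Fin q) : (fun h => B h j) =O[𝓝 0] fun h => h ^ (j.val + 1) := by
  have hz : (0 : ℝ) ∈ Ioo (-δ) δ := by simp [hδ]
  have hmem : ∀ᶠ t in 𝓝 (0 : ℝ), t ∈ Ioo (-δ) δ := isOpen_Ioo.mem_nhds hz
  obtain ⟨v, hv, hvc⟩ := exists_continuousOn_roots hB.continuousOn hh
  have hsub : Ioo (-(δ / 2)) (δ / 2) ⊆ Ioo (-δ) δ := Ioo_subset_Ioo (by linarith) (by linarith)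
  obtain ⟨D, hD⟩ := exists_ckBound isOpen_Ioo hB (isCompact_Icc (a := -(δ / 2)) (b := δ / 2))
    (Icc_subset_Ioo (by linarith) (by linarith)) Ioo_subset_Icc_self
  obtain ⟨C, hC⟩ := exists_rootBound q (δ / 2) (by positivity) D
  have hv0 : ∀ i, v i 0 = 0 := by
    intro i
    have h1 : (monicPoly (B 0)).IsRoot (v i 0) := by
      rw [hv 0 hz, isRoot_prod_iff]; exact ⟨i, rfl⟩
    rw [h0, monicPoly_zero, IsRoot, eval_pow, eval_X] at h1
    exact eq_zero_of_pow_eq_zero h1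
  have hb : ∀ i, ∀ᶠ t in 𝓝 (0 : ℝ), |v i t| ≤ C * |t| := by
    intro i
    have := hC B hD (fun t ht => hh t (hsub ht)) (v i)
      ((hvc i).continuousAt (isOpen_Ioo.mem_nhds hz)) (by
        filter_upwards [hmem] with t ht
        rw [hv t ht, isRoot_prod_iff]; exact ⟨i, rfl⟩) trivial
    simpa [hv0 i] using this
  refine Asymptotics.IsBigO.of_bound (2 ^ q * C ^ (j.val + 1)) ?_
  filter_upwards [eventually_all.2 hb, hmem] with t ht1 ht2
  rw [Real.norm_eq_abs, Real.norm_eq_abs, abs_pow, mul_assoc, ← mul_pow]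
  exact norm_le_of_roots_le (hv t ht2) ht1 j

/-- The rescaled curve in logarithmic time. -/
noncomputable def logCurve {q : ℕ} (B : ℝ → Fin q → ℝ) (u : ℝ) : Fin q → ℝ :=
  dilate (Real.exp u)⁻¹ (B (Real.exp u))

lemma logCurve_apply {q : ℕ} (B : ℝ → Fin q → ℝ) (u : ℝ) (j : Fin q) :
    logCurve B u j = logScale (j.val + 1) (fun h => B h j) u := by
  rw [logCurve, dilate, logScale]
  congr 1
  rw [← Real.exp_neg, ← Real.exp_nat_mul]
  congr 1
  push_cast
  ring

lemma contDiffOn_logCurve {q : ℕ} {δ : ℝ} (hδ : 0 < δ) {B : ℝ → Fin q → ℝ}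
    (hB : ContDiffOn ℝ q B (Ioo (-δ) δ)) : ContDiffOn ℝ q (logCurve B) (Iio (Real.log δ)) := by
  rw [contDiffOn_pi]
  intro j
  simp only [logCurve_apply]
  exact contDiffOn_logScale hδ _ ((contDiffOn_pi.1 hB j).mono
    (Ioo_subset_Ioo (by linarith) le_rfl))

/-- The leading term `c j * h ^ (j + 1)` becomes the constant `c j` in logarithmic scale, invisible
to derivatives of order at least `1`; the remainder is handled by `tendsto_iteratedDeriv_logScale`.
That `c` serves both signs of `h` is what later matches left and right slopes. -/
lemma exists_scaled_limit {q : ℕ} {δ : ℝ} (hδ : 0 < δ) {B : ℝ → Fin q → ℝ}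
    (hB : ContDiffOn ℝ q B (Ioo (-δ) δ)) (hh : ∀ t ∈ Ioo (-δ) δ, IsHyperbolic (monicPoly (B t)))
    (h0 : B 0 = 0) :
    ∃ c : Fin q → ℝ, Tendsto (fun h => dilate h⁻¹ (B h)) (𝓝[≠] 0) (𝓝 c) ∧
      ∀ i, 1 ≤ i → i ≤ q → Tendsto (iteratedDeriv i (logCurve B)) atBot (𝓝 0) := by
  have hj := fun j : Fin q => exists_taylor_leading hδ (by omega : j.val + 1 ≤ q)
    (contDiffOn_pi.1 hB j) (isBigO_coeff hδ hB hh h0 j)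
  choose c hc1 hc2 using hj
  refine ⟨c, ?_, fun i hi1 hi2 => ?_⟩
  · rw [tendsto_pi_nhds]
    intro j
    refine (hc1 j).congr fun h => ?_
    rw [dilate, inv_pow]
  · rw [tendsto_pi_nhds]
    intro j
    have hsub : Ioo 0 δ ⊆ Ioo (-δ) δ := Ioo_subset_Ioo (by linarith) le_rfl
    have hG : ContDiffOn ℝ i (fun h => B h j - c j * h ^ (j.val + 1)) (Ioo 0 δ) := by
      refine ((((contDiffOn_pi.1 hB j).of_le (by exact_mod_cast hi2)).mono hsub).sub ?_)
      fun_prop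
    have h1 := tendsto_iteratedDeriv_logScale hδ i (j.val + 1) _ hG fun k hk => by
      have := hc2 j k (hk.trans hi2)
      simpa using this
    refine h1.congr' ?_
    filter_upwards [eventually_lt_atBot (Real.log δ)] with u hu
    rw [iteratedDeriv_apply isOpen_Iio (contDiffOn_logCurve hδ hB) hi2 hu]
    have e : (fun s => logCurve B s j) = fun s => c j +
        logScale (j.val + 1) (fun h => B h j - c j * h ^ (j.val + 1)) s := by
      funext s
      rw [logCurve_apply, logScale, logScale, mul_sub, ← Real.exp_nat_mul]
      have : Real.exp (-((j.val : ℝ) + 1) * s) * (c j * Real.exp (((j.val + 1 : ℕ) : ℝ) * s)) = c j := by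
        rw [mul_left_comm, ← Real.exp_add]
        have : -((j.val : ℝ) + 1) * s + ((j.val + 1 : ℕ) : ℝ) * s = 0 := by push_cast; ring
        rw [this, Real.exp_zero, mul_one]
      rw [this]
      ring
    rw [e, iteratedDeriv_const_add (by omega)]

/-- Far out, the factor of the roots near `μ` has small coefficients and small derivatives on a
window of fixed size. Enlarging its roots by `κ⁻¹` still leaves it bounded by `1`, so Bronshtein's
constant `C` shrinks to `κ * C ≤ ε`. -/
lemma eventually_root_variation_le {q : ℕ} {u₀ : ℝ} {A : ℝ → Fin q → ℝ} {c : Fin q → ℝ}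
    (hA : ContDiffOn ℝ q A (Iio u₀)) (hlim : Tendsto A atBot (𝓝 c))
    (hder : ∀ i, 1 ≤ i → i ≤ q → Tendsto (iteratedDeriv i A) atBot (𝓝 0))
    (hh : ∀ u ∈ Iio u₀, IsHyperbolic (monicPoly (A u))) {φ : ℝ → ℝ}
    (hφ : ContinuousOn φ (Iio u₀)) (hr : ∀ u ∈ Iio u₀, (monicPoly (A u)).IsRoot (φ u)) {μ : ℝ}
    (hμ : Tendsto φ atBot (𝓝 μ)) {ε : ℝ} (hε : 0 < ε) :
    ∀ᶠ u in atBot, ∀ᶠ s in 𝓝 (0 : ℝ), |φ (u + s) - φ u| ≤ ε * |s| := by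
  obtain ⟨k, hk⟩ : ∃ k, (monicPoly c).rootMultiplicity μ = k := ⟨_, rfl⟩
  obtain ⟨l, ψ, χ, ρ, hkl, hρ, hψc, -, hψ, -, hfac, hroot⟩ := exists_ball_of_factor c μ hk
  obtain ⟨C, hC⟩ := exists_rootBound k 1 one_pos 1
  set κ := ε / (|C| + 1) with hκ
  have hκ0 : 0 < κ := by positivity
  -- This is at most `κ ^ (j + 1)` for every `j < k`, exactly what the dilation by `κ⁻¹` costs.
  set τ := (min κ 1) ^ k with hτ
  have hm0 : 0 < min κ 1 := lt_min hκ0 one_pos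
  have hτ0 : 0 < τ := by positivity
  obtain ⟨M, hM, hMb⟩ := exists_bound_comp Metric.isOpen_ball hψ (isCompact_closedBall c ρ)
    (Metric.closedBall_subset_ball (by linarith))
  set η := min 1 (τ / (M + 1)) with hη
  have hη0 : 0 < η := by positivity
  have hη1 : η ≤ 1 := min_le_left _ _
  have hMη : M * η ≤ τ := by
    calc M * η ≤ (M + 1) * (τ / (M + 1)) := by
          gcongr
          · linarith
          · exact min_le_right _ _
      _ = τ := by field_simp
  have hψcont : ContinuousAt ψ c :=
    hψ.continuousOn.continuousAt (Metric.ball_mem_nhds c (by positivity))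
  have e1 : ∀ᶠ u in atBot, ‖ψ (A u)‖ < τ := by
    have := (hψcont.tendsto.comp hlim).norm
    rw [hψc, norm_zero] at this
    exact this.eventually_lt_const hτ0
  -- As `η ≤ 1`, the bound `η ^ q` is below every `η ^ i` with `i ≤ q`.
  have e2 : ∀ᶠ u in atBot, ∀ i ∈ Finset.Icc 1 q, ‖iteratedDeriv i A u‖ < η ^ q := by
    rw [Filter.eventually_all_finset]
    intro i hi
    rw [Finset.mem_Icc] at hi
    have := (hder i hi.1 hi.2).norm
    rw [norm_zero] at this
    exact this.eventually_lt_const (by positivity)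
  have e3 : ∀ᶠ u in atBot, A u ∈ Metric.closedBall c ρ :=
    hlim.eventually (Metric.closedBall_mem_nhds c hρ)
  have e4 : ∀ᶠ u in atBot, |φ u - μ| < 2 * ρ := by
    have := (hμ.sub_const μ).abs
    rw [sub_self, abs_zero] at this
    exact this.eventually_lt_const (by positivity)
  obtain ⟨U, hU⟩ := eventually_atBot.1 ((e1.and e2).and ((e3.and e4).and (eventually_lt_atBot u₀)))
  filter_upwards [eventually_le_atBot (U - 1)] with u hu
  have hin : ∀ s ∈ Ioo (-1 : ℝ) 1, u + s ≤ U := fun s hs => by linarith [hs.2]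
  have hu0 : ∀ s ∈ Ioo (-1 : ℝ) 1, u + s ∈ Iio u₀ := fun s hs => (hU _ (hin s hs)).2.2
  set G : ℝ → Fin q → ℝ := fun s => A (u + s) with hG
  have hGc : ContDiffOn ℝ q G (Ioo (-1) 1) :=
    hA.comp (contDiff_const.add contDiff_id).contDiffOn hu0
  have hGm : MapsTo G (Ioo (-1) 1) (Metric.closedBall c ρ) := fun s hs => (hU _ (hin s hs)).2.1.1
  have hGb : ∀ s ∈ Ioo (-1 : ℝ) 1, G s ∈ Metric.ball c (2 * ρ) := fun s hs =>
    Metric.closedBall_subset_ball (by linarith) (hGm hs)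
  have hbound : CkBound k (Ioo (-1) 1) τ (ψ ∘ G) := by
    refine ⟨(hψ.comp hGc hGb).of_le (by exact_mod_cast (by omega : k ≤ q)), fun i hi s hs => ?_⟩
    rcases Nat.eq_zero_or_pos i with rfl | hi0
    · rw [iteratedDeriv_zero]
      exact (hU _ (hin s hs)).1.1.le
    · refine (hMb _ G isOpen_Ioo hGc hGm s hs η ?_ i (by omega)).trans ?_
      · intro j hj1 hj2
        rw [hG, iteratedDeriv_comp_const_add]
        exact ((hU _ (hin s hs)).1.2 j (Finset.mem_Icc.2 ⟨hj1, hj2⟩)).le.trans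
          (pow_le_pow_of_le_one hη0.le hη1 hj2)
      · refine le_trans ?_ hMη
        gcongr
        exact pow_le_of_le_one hη0.le hη1 (by omega)
  set H : ℝ → Fin k → ℝ := fun s => dilate κ⁻¹ (ψ (G s)) with hH
  have hHb : CkBound k (Ioo (-1) 1) 1 H := by
    rw [ckBound_pi isOpen_Ioo zero_le_one]
    intro j
    have hj := (ckBound_pi isOpen_Ioo hτ0.le).1 hbound j
    refine ⟨contDiffOn_const.mul hj.1, fun i hi s hs => ?_⟩
    have h1 := hj.2 i hi s hs
    rw [Real.norm_eq_abs] at h1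
    change |iteratedDeriv i (fun s => κ⁻¹ ^ (j.val + 1) * ψ (G s) j) s| ≤ 1
    rw [iteratedDeriv_const_mul_field, abs_mul, abs_of_nonneg (by positivity)]
    have h2 : τ ≤ κ ^ (j.val + 1) :=
      (pow_le_pow_of_le_one hm0.le (min_le_right _ _) (by omega)).trans
        (pow_le_pow_left₀ hm0.le (min_le_left _ _) _)
    calc κ⁻¹ ^ (j.val + 1) * |iteratedDeriv i (fun s => ψ (G s) j) s|
        ≤ κ⁻¹ ^ (j.val + 1) * κ ^ (j.val + 1) := by
          gcongr
          exact h1.trans h2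
      _ = 1 := by rw [← mul_pow, inv_mul_cancel₀ hκ0.ne', one_pow]
  have h00 : (0 : ℝ) ∈ Ioo (-1 : ℝ) 1 := by simp
  have hφu : ContinuousAt (fun s => φ (u + s)) 0 := by
    have h1 : ContinuousAt φ (u + 0) := hφ.continuousAt (isOpen_Iio.mem_nhds (hu0 0 h00))
    exact ContinuousAt.comp (f := fun s : ℝ => u + s) h1 (by fun_prop)
  have hfin := hC H hHb
    (fun s hs => isHyperbolic_dilate (inv_ne_zero hκ0.ne')
      (isHyperbolic_factor (hfac _ (hGb s hs)) (hh _ (hu0 s hs))))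
    (fun s => κ⁻¹ * (φ (u + s) - μ)) (continuousAt_const.mul (hφu.sub continuousAt_const)) (by
      filter_upwards [isOpen_Ioo.mem_nhds h00] with s hs
      rw [isRoot_dilate (inv_ne_zero hκ0.ne')]
      exact hroot _ (hGb s hs) _ (hU _ (hin s hs)).2.1.2 (hr _ (hu0 s hs))) trivial
  filter_upwards [hfin] with s hs
  rw [add_zero, ← mul_sub, sub_sub_sub_cancel_right, abs_mul, abs_of_pos (inv_pos.2 hκ0),
    inv_mul_le_iff₀ hκ0] at hs
  refine hs.trans ?_
  rw [← mul_assoc]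
  gcongr
  calc κ * C ≤ κ * (|C| + 1) := by gcongr; linarith [le_abs_self C]
    _ = ε := by rw [hκ]; field_simp

lemma exists_tendsto_of_oscillation {l : Filter ℝ} [l.NeBot] {φ : ℝ → ℝ}
    (h : ∀ ε > 0, ∃ S ∈ l, ∀ s ∈ S, ∀ t ∈ S, |φ s - φ t| < ε) : ∃ μ, Tendsto φ l (𝓝 μ) := by
  have : Cauchy (map φ l) := by
    rw [Metric.cauchy_iff]
    refine ⟨inferInstance, fun ε hε => ?_⟩
    obtain ⟨S, hS, hb⟩ := h ε hε
    refine ⟨φ '' S, image_mem_map hS, ?_⟩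
    rintro _ ⟨s, hs, rfl⟩ _ ⟨t, ht, rfl⟩
    rw [Real.dist_eq]
    exact hb s hs t ht
  exact cauchy_map_iff_exists_tendsto.1 this

/-- Away from `0`, `h⁻¹ * f h` is a continuous root of the rescaled polynomial, which is close to
`c`; the radius `ρ` is the same for all roots `f`. -/
lemma exists_slope_oscillation {q : ℕ} {B : ℝ → Fin q → ℝ} {c : Fin q → ℝ}
    (hc : Tendsto (fun h => dilate h⁻¹ (B h)) (𝓝[≠] 0) (𝓝 c)) {ε : ℝ} (hε : 0 < ε) :
    ∃ ρ > 0, ∀ (S : Set ℝ) (f : ℝ → ℝ), IsPreconnected S → S ⊆ Ioo (-ρ) ρ → (0 : ℝ) ∉ S →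
      ContinuousOn f S → (∀ h ∈ S, (monicPoly (B h)).IsRoot (f h)) →
      ∀ s ∈ S, ∀ t ∈ S, |s⁻¹ * f s - t⁻¹ * f t| < ε := by
  obtain ⟨W, hW, hWo⟩ := exists_uniform_oscillation c hε
  obtain ⟨ρ, hρ, hb⟩ := Metric.mem_nhdsWithin_iff.1 (hc hW)
  refine ⟨ρ, hρ, fun S f hS hsub h0 hf hr => ?_⟩
  have hne : ∀ h ∈ S, h ≠ 0 := fun h hh he => h0 (he ▸ hh)
  refine hWo S (fun h => dilate h⁻¹ (B h)) (fun h => h⁻¹ * f h) hS (fun h hh => hb ⟨?_, hne h hh⟩)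
    ((continuousOn_id.inv₀ hne).mul hf) (fun h hh => (isRoot_dilate (inv_ne_zero (hne h hh)) _ _).2 (hr h hh))
  rw [mem_ball_zero_iff, Real.norm_eq_abs]
  exact abs_lt.2 (hsub hh)

/-- Decompose the remainder as `(k - h) * (f h / h - μ) + k * (f k / k - f h / h)`. The second term
is controlled by `k * |log k - log h| ≤ 2 * |k - h|`, valid for `k` between `h / 2` and `2 * h`. -/
lemma eventually_abs_sub_sub_le_of_log {f : ℝ → ℝ} {μ ε : ℝ} (hε : 0 < ε)
    (hμ : Tendsto (fun h => h⁻¹ * f h) (𝓝[>] 0) (𝓝 μ))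
    (hv : ∀ᶠ u in atBot, ∀ᶠ s in 𝓝 (0 : ℝ),
      |(Real.exp (u + s))⁻¹ * f (Real.exp (u + s)) - (Real.exp u)⁻¹ * f (Real.exp u)| ≤ ε / 4 * |s|) :
    ∀ᶠ h in 𝓝[>] (0 : ℝ), ∀ᶠ k in 𝓝 h, |f k - f h - μ * (k - h)| ≤ ε * |k - h| := by
  have hlog : Tendsto Real.log (𝓝[>] 0) atBot := Real.tendsto_log_nhdsGT_zero
  have h1 : ∀ᶠ h in 𝓝[>] (0 : ℝ), |h⁻¹ * f h - μ| < ε / 2 := by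
    have := (hμ.sub_const μ).abs
    rw [sub_self, abs_zero] at this
    exact this.eventually_lt_const (by positivity)
  filter_upwards [hlog.eventually hv, h1, self_mem_nhdsWithin] with h hh1 hh2 hpos
  have hpos : 0 < h := hpos
  have ht : Tendsto (fun k => Real.log k - Real.log h) (𝓝 h) (𝓝 0) := by
    have := (Real.continuousAt_log hpos.ne').tendsto.sub_const (Real.log h)
    rwa [sub_self] at this
  filter_upwards [ht.eventually hh1, eventually_gt_nhds (half_lt_self hpos),
    eventually_lt_nhds (by linarith : h < 2 * h)] with k hk1 hk2 hk3
  have hk0 : 0 < k := by linarith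
  rw [add_sub_cancel, Real.exp_log hpos, Real.exp_log hk0] at hk1
  have hl : k * |Real.log k - Real.log h| ≤ 2 * |k - h| := by
    rw [← Real.log_div hk0.ne' hpos.ne']
    have l1 := Real.log_le_sub_one_of_pos (div_pos hk0 hpos)
    have l2 := Real.one_sub_inv_le_log_of_pos (div_pos hk0 hpos)
    rw [inv_div] at l2
    have l1' : k * Real.log (k / h) ≤ k / h * (k - h) := by
      calc k * Real.log (k / h) ≤ k * (k / h - 1) := by gcongr
        _ = k / h * (k - h) := by field_simp
    have l2' : k - h ≤ k * Real.log (k / h) := by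
      calc k - h = k * (1 - h / k) := by field_simp
        _ ≤ _ := by gcongr
    have hq : k / h ≤ 2 := by rw [div_le_iff₀ hpos]; linarith
    have hq0 : 0 < k / h := by positivity
    rw [← abs_of_pos hk0, ← abs_mul, abs_of_pos hk0, abs_le]
    rcases le_total 0 (k - h) with hs | hs
    · rw [abs_of_nonneg hs]
      constructor <;> nlinarith
    · rw [abs_of_nonpos hs]
      constructor <;> nlinarith
  have e : f k - f h - μ * (k - h) = (k - h) * (h⁻¹ * f h - μ) + k * (k⁻¹ * f k - h⁻¹ * f h) := by
    field_simp
    ring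
  rw [e]
  refine (abs_add_le _ _).trans ?_
  rw [abs_mul, abs_mul, abs_of_pos hk0]
  have b1 : |k - h| * |h⁻¹ * f h - μ| ≤ |k - h| * (ε / 2) := by gcongr
  have b2 : k * |k⁻¹ * f k - h⁻¹ * f h| ≤ k * (ε / 4 * |Real.log k - Real.log h|) := by gcongr
  nlinarith

/-- The second conclusion is phrased with increments because differentiability of `f` at `h` is not
available here; it bounds any one-sided derivative at `h` by `ε` away from `μ`. -/
lemma exists_right_slope {q : ℕ} {δ : ℝ} (hδ : 0 < δ) {B : ℝ → Fin q → ℝ}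
    (hB : ContDiffOn ℝ q B (Ioo (-δ) δ)) (hh : ∀ t ∈ Ioo (-δ) δ, IsHyperbolic (monicPoly (B t)))
    (h0 : B 0 = 0) {f : ℝ → ℝ} (hf : ContinuousOn f (Ioo 0 δ))
    (hr : ∀ h ∈ Ioo 0 δ, (monicPoly (B h)).IsRoot (f h)) :
    ∃ μ, Tendsto (fun h => h⁻¹ * f h) (𝓝[>] 0) (𝓝 μ) ∧
      ∀ ε > 0, ∀ᶠ h in 𝓝[>] (0 : ℝ), ∀ᶠ k in 𝓝 h, |f k - f h - μ * (k - h)| ≤ ε * |k - h| := by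
  obtain ⟨c, hc, hder⟩ := exists_scaled_limit hδ hB hh h0
  obtain ⟨μ, hμ⟩ : ∃ μ, Tendsto (fun h => h⁻¹ * f h) (𝓝[>] 0) (𝓝 μ) := by
    refine exists_tendsto_of_oscillation fun ε hε => ?_
    obtain ⟨ρ, hρ, hosc⟩ := exists_slope_oscillation hc hε
    have hm : 0 < min ρ δ := lt_min hρ hδ
    have hsub : Ioo 0 (min ρ δ) ⊆ Ioo 0 δ := Ioo_subset_Ioo_right (min_le_right _ _)
    exact ⟨Ioo 0 (min ρ δ), Ioo_mem_nhdsGT hm, hosc _ f isPreconnected_Ioo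
      (Ioo_subset_Ioo (by linarith) (min_le_left _ _)) (by simp) (hf.mono hsub)
      fun h hh => hr h (hsub hh)⟩
  refine ⟨μ, hμ, fun ε hε => eventually_abs_sub_sub_le_of_log hε hμ ?_⟩
  have hexp : Tendsto Real.exp atBot (𝓝[>] 0) := Real.tendsto_exp_atBot_nhdsGT
  have hle : 𝓝[>] (0 : ℝ) ≤ 𝓝[≠] 0 := nhdsWithin_mono _ fun x hx => (ne_of_gt hx : x ≠ 0)
  have hsub : Ioo 0 δ ⊆ Ioo (-δ) δ := Ioo_subset_Ioo_left (by linarith)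
  refine eventually_root_variation_le (A := logCurve B) (u₀ := Real.log δ) (c := c)
    (φ := fun u => (Real.exp u)⁻¹ * f (Real.exp u)) (contDiffOn_logCurve hδ hB)
    ((hc.mono_left hle).comp hexp) hder (fun u hu => ?_) ?_ (fun u hu => ?_) (hμ.comp hexp)
    (by positivity)
  · exact isHyperbolic_dilate (inv_ne_zero (Real.exp_pos u).ne') (hh _ (hsub (mapsTo_exp hδ hu)))
  · refine ContinuousOn.mul ?_ (hf.comp Real.continuous_exp.continuousOn (mapsTo_exp hδ))
    exact Real.continuous_exp.continuousOn.inv₀ fun u _ => (Real.exp_pos u).ne'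
  · exact (isRoot_dilate (inv_ne_zero (Real.exp_pos u).ne') _ _).2 (hr _ (mapsTo_exp hδ hu))


/-- Reflect both time and roots: `-f (-h)` has the same slopes as `f`. -/
lemma exists_left_slope {q : ℕ} {δ : ℝ} (hδ : 0 < δ) {B : ℝ → Fin q → ℝ}
    (hB : ContDiffOn ℝ q B (Ioo (-δ) δ)) (hh : ∀ t ∈ Ioo (-δ) δ, IsHyperbolic (monicPoly (B t)))
    (h0 : B 0 = 0) {f : ℝ → ℝ} (hf : ContinuousOn f (Ioo (-δ) 0))
    (hr : ∀ h ∈ Ioo (-δ) 0, (monicPoly (B h)).IsRoot (f h)) :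
    ∃ μ, Tendsto (fun h => h⁻¹ * f h) (𝓝[<] 0) (𝓝 μ) ∧
      ∀ ε > 0, ∀ᶠ h in 𝓝[<] (0 : ℝ), ∀ᶠ k in 𝓝 h, |f k - f h - μ * (k - h)| ≤ ε * |k - h| := by
  have hneg : MapsTo (fun h : ℝ => -h) (Ioo (-δ) δ) (Ioo (-δ) δ) := fun h hh =>
    ⟨by linarith [hh.2], by linarith [hh.1]⟩
  have hneg' : MapsTo (fun h : ℝ => -h) (Ioo 0 δ) (Ioo (-δ) 0) := fun h hh =>
    ⟨by linarith [hh.2], by linarith [hh.1]⟩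
  have hcneg : ContDiff ℝ q fun h : ℝ => -h := contDiff_neg
  obtain ⟨μ, hμ, hv⟩ := exists_right_slope hδ (B := fun h => dilate (-1) (B (-h)))
    (f := fun h => -f (-h)) (by
      rw [contDiffOn_pi]
      intro j
      exact contDiffOn_const.mul ((contDiffOn_pi.1 hB j).comp hcneg.contDiffOn hneg))
    (fun t ht => isHyperbolic_dilate (by norm_num) (hh _ (hneg ht)))
    (by ext j; simp [dilate, h0])
    (hf.comp continuous_neg.continuousOn hneg').neg
    (fun h hh => by
      have := (isRoot_dilate (r := -1) (by norm_num) (B (-h)) (f (-h))).2 (hr _ (hneg' hh))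
      rwa [neg_one_mul] at this)
  have hn : Tendsto (fun h : ℝ => -h) (𝓝[<] 0) (𝓝[>] 0) := by
    simpa using tendsto_neg_nhdsLT (a := (0 : ℝ))
  refine ⟨μ, (hμ.comp hn).congr fun h => ?_, fun ε hε => ?_⟩
  · simp only [Function.comp_apply, neg_neg, inv_neg, neg_mul_neg]
  · filter_upwards [hn.eventually (hv ε hε)] with h hh
    filter_upwards [(continuous_neg.tendsto h).eventually hh] with k hk
    rw [neg_neg, neg_neg, ← abs_neg (-k - -h)] at hk
    rw [← abs_neg]
    convert hk using 2 <;> ring_nf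

/-! ### Local curves at a root -/

section

variable {n p : ℕ} {I : Set ℝ} {a : Fin n → ℝ → ℝ}

lemma IsHyperbolicCurve.contDiffOn_vec (ha : IsHyperbolicCurve p I a) :
    ContDiffOn ℝ p (fun t j => a j t) I := contDiffOn_pi.2 ha.contDiffOn

lemma rootMultiplicity_le (hp : IsMaximalMultiplicity I a p) {t : ℝ} (ht : t ∈ I) (x : ℝ) :
    (monicPoly fun j => a j t).rootMultiplicity x ≤ p := by
  by_cases hx : (monicPoly fun j => a j t).IsRoot x
  · exact hp.2 ⟨t, ht, x, hx, rfl⟩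
  · rw [rootMultiplicity_eq_zero hx]; exact Nat.zero_le _

/-- The maximal multiplicity enters here: `q ≤ p` makes the factor `B`, of degree `q`, of class `C ^
q`, the regularity that Bronshtein's bound needs. -/
lemma exists_local_curve (hI : IsOpen I) (ha : IsHyperbolicCurve p I a)
    (hp : IsMaximalMultiplicity I a p) {t₀ : ℝ} (ht₀ : t₀ ∈ I) (x : ℝ) {q : ℕ}
    (hq : (monicPoly fun j => a j t₀).rootMultiplicity x = q) :
    ∃ (k : ℕ) (B : ℝ → Fin q → ℝ) (R : ℝ → Fin k → ℝ) (δ ρ : ℝ), 0 < δ ∧ 0 < ρ ∧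
      (∀ h ∈ Ioo (-δ) δ, t₀ + h ∈ I) ∧ ContDiffOn ℝ q B (Ioo (-δ) δ) ∧
      (∀ h ∈ Ioo (-δ) δ, IsHyperbolic (monicPoly (B h))) ∧ B 0 = 0 ∧
      ContinuousAt R 0 ∧ (monicPoly (R 0)).eval 0 ≠ 0 ∧
      (∀ h ∈ Ioo (-δ) δ, (monicPoly fun j => a j (t₀ + h)).comp (X + C x) =
        monicPoly (B h) * monicPoly (R h)) ∧
      ∀ h ∈ Ioo (-δ) δ, ∀ y, |y - x| < ρ → (monicPoly fun j => a j (t₀ + h)).IsRoot y →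
        (monicPoly (B h)).IsRoot (y - x) := by
  obtain ⟨k, ψ, χ, ε, hn, hε, h0, hχ0, hψ, hχ, hfac, hroot⟩ :=
    exists_ball_of_factor (fun j => a j t₀) x hq
  have hqp : q ≤ p := hq ▸ rootMultiplicity_le hp ht₀ x
  have hA : ContDiffOn ℝ q (fun t j => a j t) I :=
    ha.contDiffOn_vec.of_le (by exact_mod_cast hqp)
  have hAc : ContinuousAt (fun t j => a j t) t₀ := hA.continuousOn.continuousAt (hI.mem_nhds ht₀)
  have hmem : ∀ᶠ t in 𝓝 t₀, t ∈ I := hI.mem_nhds ht₀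
  have hev : ∀ᶠ t in 𝓝 t₀, t ∈ I ∧ (fun j => a j t) ∈ Metric.ball (fun j => a j t₀) (2 * ε) :=
    hmem.and
      (hAc.eventually_mem (Metric.ball_mem_nhds _ (by positivity)))
  obtain ⟨δ, hδ, hb⟩ := Metric.eventually_nhds_iff.1 hev
  have hin : ∀ h ∈ Ioo (-δ) δ, t₀ + h ∈ I ∧
      (fun j => a j (t₀ + h)) ∈ Metric.ball (fun j => a j t₀) (2 * ε) := by
    intro h hh
    refine hb ?_
    rw [Real.dist_eq, add_sub_cancel_left]
    exact abs_lt.2 hh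
  have hAδ : ContDiffOn ℝ q (fun h j => a j (t₀ + h)) (Ioo (-δ) δ) :=
    hA.comp (f := fun h : ℝ => t₀ + h) (contDiff_const.add contDiff_id).contDiffOn
      fun h hh => (hin h hh).1
  have hmaps : MapsTo (fun h j => a j (t₀ + h)) (Ioo (-δ) δ)
      (Metric.ball (fun j => a j t₀) (2 * ε)) := fun h hh => (hin h hh).2
  have hz : (0 : ℝ) ∈ Ioo (-δ) δ := by simp [hδ]
  refine ⟨k, fun h => ψ fun j => a j (t₀ + h), fun h => χ fun j => a j (t₀ + h), δ, 2 * ε, hδ,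
    by positivity, fun h hh => (hin h hh).1, ?_, fun h hh => ?_, ?_, ?_, ?_,
    fun h hh => hfac _ (hin h hh).2, fun h hh => hroot _ (hin h hh).2⟩
  · exact ContDiffOn.comp (g := ψ) (f := fun h j => a j (t₀ + h))
      (hψ.of_le (by exact_mod_cast (by omega : q ≤ n))) hAδ hmaps
  · exact isHyperbolic_factor (hfac _ (hin h hh).2) (ha.hyperbolic _ (hin h hh).1)
  · simp only [add_zero]; exact h0
  · have h1 : ContinuousOn (fun h => χ fun j => a j (t₀ + h)) (Ioo (-δ) δ) :=
      ContinuousOn.comp (g := χ) (f := fun h j => a j (t₀ + h)) hχ.continuousOn hAδ.continuousOn hmaps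
    exact h1.continuousAt (isOpen_Ioo.mem_nhds hz)
  · simp only [add_zero]; exact hχ0

lemma exists_one_sided_slopes (hI : IsOpen I) (ha : IsHyperbolicCurve p I a)
    (hp : IsMaximalMultiplicity I a p) {r : ℝ → ℝ} (hr : ContinuousOn r I)
    (hroot : IsRootCurve I a r) {t₀ : ℝ} (ht₀ : t₀ ∈ I) :
    (∃ μ, Tendsto (fun h => h⁻¹ * (r (t₀ + h) - r t₀)) (𝓝[<] 0) (𝓝 μ) ∧
      ∀ ε > 0, ∀ᶠ t in 𝓝[<] t₀, ∀ᶠ k in 𝓝 t, |r k - r t - μ * (k - t)| ≤ ε * |k - t|) ∧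
    (∃ μ, Tendsto (fun h => h⁻¹ * (r (t₀ + h) - r t₀)) (𝓝[>] 0) (𝓝 μ) ∧
      ∀ ε > 0, ∀ᶠ t in 𝓝[>] t₀, ∀ᶠ k in 𝓝 t, |r k - r t - μ * (k - t)| ≤ ε * |k - t|) := by
  obtain ⟨k, B, R, δ, ρ, hδ, hρ, hin, hB, hh, hB0, -, -, -, hBr⟩ :=
    exists_local_curve hI ha hp ht₀ (r t₀) rfl
  have hrc : ContinuousAt r t₀ := hr.continuousAt (hI.mem_nhds ht₀)
  obtain ⟨δ₁, hδ₁, hb⟩ := Metric.continuousAt_iff.1 hrc ρ hρ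
  set δ' := min δ δ₁ with hδ'
  have hδ'0 : 0 < δ' := lt_min hδ hδ₁
  have hsub : Ioo (-δ') δ' ⊆ Ioo (-δ) δ :=
    Ioo_subset_Ioo (neg_le_neg (min_le_left _ _)) (min_le_left _ _)
  have hfroot : ∀ h ∈ Ioo (-δ') δ', (monicPoly (B h)).IsRoot (r (t₀ + h) - r t₀) := by
    intro h hh'
    refine hBr h (hsub hh') _ ?_ (hroot _ (hin h (hsub hh')))
    rw [← Real.dist_eq]
    refine hb ?_
    rw [Real.dist_eq, add_sub_cancel_left]
    exact (abs_lt.2 hh').trans_le (min_le_right _ _)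
  have hfc : ContinuousOn (fun h => r (t₀ + h) - r t₀) (Ioo (-δ') δ') :=
    (ContinuousOn.comp (g := r) (f := fun h => t₀ + h) hr (by fun_prop)
      fun h hh' => hin h (hsub hh')).sub continuousOn_const
  have hs1 : Ioo (-δ') 0 ⊆ Ioo (-δ') δ' := Ioo_subset_Ioo_right hδ'0.le
  have hs2 : Ioo 0 δ' ⊆ Ioo (-δ') δ' := Ioo_subset_Ioo_left (by linarith)
  obtain ⟨μ₁, h1, h1'⟩ := exists_left_slope hδ'0 (hB.mono hsub) (fun t ht => hh t (hsub ht)) hB0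
    (hfc.mono hs1) fun h hh' => hfroot h (hs1 hh')
  obtain ⟨μ₂, h2, h2'⟩ := exists_right_slope hδ'0 (hB.mono hsub) (fun t ht => hh t (hsub ht)) hB0
    (hfc.mono hs2) fun h hh' => hfroot h (hs2 hh')
  have hshift : Tendsto (fun t => t - t₀) (𝓝 t₀) (𝓝 0) := by
    have := (continuous_id.sub continuous_const).tendsto (f := fun t : ℝ => t - t₀) t₀
    simpa using this
  refine ⟨⟨μ₁, h1, fun ε hε => ?_⟩, ⟨μ₂, h2, fun ε hε => ?_⟩⟩
  · have hs : Tendsto (fun t => t - t₀) (𝓝[<] t₀) (𝓝[<] 0) :=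
      tendsto_nhdsWithin_iff.2 ⟨hshift.mono_left nhdsWithin_le_nhds, by
        filter_upwards [self_mem_nhdsWithin] with t ht
        exact sub_neg.2 (mem_Iio.1 ht)⟩
    filter_upwards [hs.eventually (h1' ε hε)] with t ht
    have hk : Tendsto (fun k => k - t₀) (𝓝 t) (𝓝 (t - t₀)) :=
      (continuous_id.sub continuous_const).tendsto (f := fun t : ℝ => t - t₀) t
    filter_upwards [hk.eventually ht] with k hk
    simpa using hk
  · have hs : Tendsto (fun t => t - t₀) (𝓝[>] t₀) (𝓝[>] 0) :=
      tendsto_nhdsWithin_iff.2 ⟨hshift.mono_left nhdsWithin_le_nhds, by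
        filter_upwards [self_mem_nhdsWithin] with t ht
        exact sub_pos.2 (mem_Ioi.1 ht)⟩
    filter_upwards [hs.eventually (h2' ε hε)] with t ht
    have hk : Tendsto (fun k => k - t₀) (𝓝 t) (𝓝 (t - t₀)) :=
      (continuous_id.sub continuous_const).tendsto (f := fun t : ℝ => t - t₀) t
    filter_upwards [hk.eventually ht] with k hk
    simpa using hk

end

/-! ### One-sided derivatives -/

lemma hasDerivWithinAt_of_tendsto {r : ℝ → ℝ} {t₀ μ : ℝ} {S T : Set ℝ} (hS : t₀ ∉ S)
    (hST : MapsTo (fun t => t - t₀) S T)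
    (h : Tendsto (fun h => h⁻¹ * (r (t₀ + h) - r t₀)) (𝓝[T] 0) (𝓝 μ)) :
    HasDerivWithinAt r μ S t₀ := by
  rw [hasDerivWithinAt_iff_tendsto_slope' hS]
  have hshift : Tendsto (fun t => t - t₀) (𝓝 t₀) (𝓝 0) := by
    have := (continuous_id.sub continuous_const).tendsto (f := fun t : ℝ => t - t₀) t₀
    simpa using this
  have hs : Tendsto (fun t => t - t₀) (𝓝[S] t₀) (𝓝[T] 0) :=
    tendsto_nhdsWithin_iff.2 ⟨hshift.mono_left nhdsWithin_le_nhds, by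
      filter_upwards [self_mem_nhdsWithin] with t ht using hST ht⟩
  refine (h.comp hs).congr fun t => ?_
  simp [slope_def_field, div_eq_inv_mul]

lemma hasDerivWithinAt_Iio_of_tendsto {r : ℝ → ℝ} {t₀ μ : ℝ}
    (h : Tendsto (fun h => h⁻¹ * (r (t₀ + h) - r t₀)) (𝓝[<] 0) (𝓝 μ)) :
    HasDerivWithinAt r μ (Iio t₀) t₀ :=
  hasDerivWithinAt_of_tendsto (by simp) (fun _ ht => mem_Iio.2 (sub_neg.2 (mem_Iio.1 ht))) h

lemma hasDerivWithinAt_Ioi_of_tendsto {r : ℝ → ℝ} {t₀ μ : ℝ}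
    (h : Tendsto (fun h => h⁻¹ * (r (t₀ + h) - r t₀)) (𝓝[>] 0) (𝓝 μ)) :
    HasDerivWithinAt r μ (Ioi t₀) t₀ :=
  hasDerivWithinAt_of_tendsto (by simp) (fun _ ht => mem_Ioi.2 (sub_pos.2 (mem_Ioi.1 ht))) h

lemma leftDeriv_eq {r : ℝ → ℝ} {t₀ μ : ℝ} (h : HasDerivWithinAt r μ (Iio t₀) t₀) :
    leftDeriv r t₀ = μ := h.derivWithin (uniqueDiffWithinAt_Iio t₀)

lemma rightDeriv_eq {r : ℝ → ℝ} {t₀ μ : ℝ} (h : HasDerivWithinAt r μ (Ioi t₀) t₀) :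
    rightDeriv r t₀ = μ := h.derivWithin (uniqueDiffWithinAt_Ioi t₀)

lemma abs_deriv_sub_le {r : ℝ → ℝ} {t d μ ε : ℝ} {S : Set ℝ} (hS : t ∉ S) [(𝓝[S] t).NeBot]
    (hd : HasDerivWithinAt r d S t) (h : ∀ᶠ k in 𝓝 t, |r k - r t - μ * (k - t)| ≤ ε * |k - t|) :
    |d - μ| ≤ ε := by
  rw [hasDerivWithinAt_iff_tendsto_slope' hS] at hd
  refine le_of_tendsto (hd.sub_const μ).abs ?_
  filter_upwards [nhdsWithin_le_nhds h, self_mem_nhdsWithin] with k hk hkS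
  have hne : k - t ≠ 0 := sub_ne_zero.2 fun he => hS (he ▸ hkS)
  have e : slope r t k - μ = (r k - r t - μ * (k - t)) / (k - t) := by
    rw [slope_def_field]; field_simp
  rw [e, abs_div]
  exact (div_le_iff₀ (abs_pos.2 hne)).2 hk

lemma tendsto_one_sided_deriv {r : ℝ → ℝ} {t₀ μ : ℝ} {I T : Set ℝ} (hI : I ∈ 𝓝 t₀)
    (hL : ∀ t ∈ I, ∃ d, HasDerivWithinAt r d (Iio t) t)
    (hR : ∀ t ∈ I, ∃ d, HasDerivWithinAt r d (Ioi t) t)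
    (h : ∀ ε > 0, ∀ᶠ t in 𝓝[T] t₀, ∀ᶠ k in 𝓝 t, |r k - r t - μ * (k - t)| ≤ ε * |k - t|) :
    Tendsto (leftDeriv r) (𝓝[T] t₀) (𝓝 μ) ∧ Tendsto (rightDeriv r) (𝓝[T] t₀) (𝓝 μ) := by
  constructor <;> rw [Metric.tendsto_nhds] <;> intro ε hε <;>
    filter_upwards [h (ε / 2) (half_pos hε), mem_nhdsWithin_of_mem_nhds hI] with t ht htI <;>
    rw [Real.dist_eq]
  · obtain ⟨d, hd⟩ := hL t htI
    rw [leftDeriv_eq hd]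
    linarith [abs_deriv_sub_le (by simp) hd ht]
  · obtain ⟨d, hd⟩ := hR t htI
    rw [rightDeriv_eq hd]
    linarith [abs_deriv_sub_le (by simp) hd ht]

section

variable {n p : ℕ} {I : Set ℝ} {a : Fin n → ℝ → ℝ}

theorem one_sided_derivatives (hI : IsOpen I) (ha : IsHyperbolicCurve p I a)
    (hp : IsMaximalMultiplicity I a p) {r : ℝ → ℝ} (hr : ContinuousOn r I)
    (hroot : IsRootCurve I a r) :
    (∀ t ∈ I, DifferentiableWithinAt ℝ r (Iio t) t ∧ DifferentiableWithinAt ℝ r (Ioi t) t) ∧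
      (∀ t₀ ∈ I,
        Tendsto (leftDeriv r) (𝓝[<] t₀) (𝓝 (leftDeriv r t₀)) ∧
        Tendsto (rightDeriv r) (𝓝[<] t₀) (𝓝 (leftDeriv r t₀)) ∧
        Tendsto (leftDeriv r) (𝓝[>] t₀) (𝓝 (rightDeriv r t₀)) ∧
        Tendsto (rightDeriv r) (𝓝[>] t₀) (𝓝 (rightDeriv r t₀))) := by
  have key := fun t (ht : t ∈ I) => exists_one_sided_slopes hI ha hp hr hroot ht
  have hL : ∀ t ∈ I, ∃ d, HasDerivWithinAt r d (Iio t) t := fun t ht => by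
    obtain ⟨⟨μ, h, -⟩, -⟩ := key t ht
    exact ⟨μ, hasDerivWithinAt_Iio_of_tendsto h⟩
  have hR : ∀ t ∈ I, ∃ d, HasDerivWithinAt r d (Ioi t) t := fun t ht => by
    obtain ⟨-, ⟨μ, h, -⟩⟩ := key t ht
    exact ⟨μ, hasDerivWithinAt_Ioi_of_tendsto h⟩
  refine ⟨fun t ht => ⟨(hL t ht).choose_spec.differentiableWithinAt,
    (hR t ht).choose_spec.differentiableWithinAt⟩, fun t₀ ht₀ => ?_⟩
  obtain ⟨⟨μ₁, h1, h1'⟩, ⟨μ₂, h2, h2'⟩⟩ := key t₀ ht₀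
  rw [leftDeriv_eq (hasDerivWithinAt_Iio_of_tendsto h1),
    rightDeriv_eq (hasDerivWithinAt_Ioi_of_tendsto h2)]
  obtain ⟨l1, l2⟩ := tendsto_one_sided_deriv (hI.mem_nhds ht₀) hL hR h1'
  obtain ⟨r1, r2⟩ := tendsto_one_sided_deriv (hI.mem_nhds ht₀) hL hR h2'
  exact ⟨l1, l2, r1, r2⟩

theorem contDiffOn_of_differentiableOn (hI : IsOpen I) (ha : IsHyperbolicCurve p I a)
    (hp : IsMaximalMultiplicity I a p) {r : ℝ → ℝ} (hr : DifferentiableOn ℝ r I)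
    (hroot : IsRootCurve I a r) : ContDiffOn ℝ 1 r I := by
  obtain ⟨-, h⟩ := one_sided_derivatives hI ha hp hr.continuousOn hroot
  have hd : ∀ t ∈ I, HasDerivAt r (deriv r t) t := fun t ht =>
    (hr.differentiableAt (hI.mem_nhds ht)).hasDerivAt
  have hl : ∀ t ∈ I, leftDeriv r t = deriv r t := fun t ht =>
    leftDeriv_eq (hd t ht).hasDerivWithinAt
  have hrt : ∀ t ∈ I, rightDeriv r t = deriv r t := fun t ht =>
    rightDeriv_eq (hd t ht).hasDerivWithinAt
  rw [show (1 : WithTop ℕ∞) = 0 + 1 by norm_num, contDiffOn_succ_iff_deriv_of_isOpen hI]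
  refine ⟨hr, by simp, ?_⟩
  rw [contDiffOn_zero]
  intro t ht
  refine ContinuousAt.continuousWithinAt ?_
  rw [continuousAt_iff_continuous_left'_right']
  obtain ⟨h1, -, -, h4⟩ := h t ht
  rw [hl t ht] at h1
  rw [hrt t ht] at h4
  have hmem : ∀ᶠ s in 𝓝 t, s ∈ I := hI.mem_nhds ht
  constructor
  · refine h1.congr' ?_
    filter_upwards [nhdsWithin_le_nhds hmem] with s hs using hl s hs
  · refine h4.congr' ?_
    filter_upwards [nhdsWithin_le_nhds hmem] with s hs using hrt s hs

end


/-! ### Matching one-sided slopes -/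

section

variable {n p : ℕ} {I : Set ℝ} {a : Fin n → ℝ → ℝ}

lemma IsRootSystem.isRootCurve {r : Fin n → ℝ → ℝ} (h : IsRootSystem I a r) (j : Fin n) :
    IsRootCurve I a (r j) := fun t ht => by
  rw [h t ht]
  exact (isRoot_prod_iff (fun j => r j t) _).2 ⟨j, rfl⟩

lemma rootMultiplicity_prod (v : Fin n → ℝ) (x : ℝ) :
    (∏ j, (X - C (v j))).rootMultiplicity x = (Finset.univ.filter fun j => v j = x).card := by
  have h : (∏ j, (X - C (v j))).roots = Finset.univ.val.map v := by
    have := roots_multiset_prod_X_sub_C (Finset.univ.val.map v)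
    rwa [Multiset.map_map] at this
  rw [← count_roots, h, Multiset.count_map, Finset.card_def, Finset.filter_val]
  simp only [eq_comm]

/-- Each root through `x` at `t₀` absorbs one power of `h` and leaves `z` minus its slope; the
others leave a factor that is nonzero in the limit. -/
lemma tendsto_scaled_prod {r : Fin n → ℝ → ℝ} {t₀ : ℝ} {l : Filter ℝ} (hl : l ≤ 𝓝[≠] 0)
    {m : Fin n → ℝ} (hc : ∀ j, ContinuousAt (r j) t₀)
    (hm : ∀ j, Tendsto (fun h => h⁻¹ * (r j (t₀ + h) - r j t₀)) l (𝓝 (m j))) (x z : ℝ) :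
    Tendsto (fun h => (h ^ (Finset.univ.filter fun j => r j t₀ = x).card)⁻¹ *
        ∏ j, (x + h * z - r j (t₀ + h))) l
      (𝓝 ((∏ j ∈ Finset.univ.filter (fun j => r j t₀ = x), (z - m j)) *
        ∏ j ∈ Finset.univ.filter (fun j => ¬ r j t₀ = x), (x - r j t₀))) := by
  have h1 : Tendsto (fun h => ∏ j ∈ Finset.univ.filter (fun j => r j t₀ = x),
      (z - h⁻¹ * (r j (t₀ + h) - r j t₀))) l
      (𝓝 (∏ j ∈ Finset.univ.filter (fun j => r j t₀ = x), (z - m j))) :=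
    tendsto_finsetProd _ fun j _ => (hm j).const_sub z
  have hid : Tendsto (fun h : ℝ => h) l (𝓝 0) := hl.trans nhdsWithin_le_nhds
  have h2 : Tendsto (fun h => ∏ j ∈ Finset.univ.filter (fun j => ¬ r j t₀ = x),
      (x + h * z - r j (t₀ + h))) l
      (𝓝 (∏ j ∈ Finset.univ.filter (fun j => ¬ r j t₀ = x), (x - r j t₀))) := by
    refine tendsto_finsetProd _ fun j _ => Tendsto.sub ?_ ?_
    · simpa using (hid.mul_const z).const_add x
    · have : Tendsto (fun h => t₀ + h) l (𝓝 t₀) := by simpa using hid.const_add t₀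
      exact (hc j).tendsto.comp this
  refine (h1.mul h2).congr' ?_
  filter_upwards [hl self_mem_nhdsWithin] with h hh
  have hh : h ≠ 0 := hh
  rw [← Finset.prod_filter_mul_prod_filter_not Finset.univ (fun j => r j t₀ = x)
    (fun j => x + h * z - r j (t₀ + h)), ← mul_assoc, ← inv_pow, ← Finset.prod_const,
    ← Finset.prod_mul_distrib]
  congr 1
  refine Finset.prod_congr rfl fun j hj => ?_
  rw [(Finset.mem_filter.1 hj).2]
  field_simp
  ring

lemma exists_tendsto_scaled_eval (hI : IsOpen I) (ha : IsHyperbolicCurve p I a)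
    (hp : IsMaximalMultiplicity I a p) {t₀ : ℝ} (ht₀ : t₀ ∈ I) (x z : ℝ) {q : ℕ}
    (hq : (monicPoly fun j => a j t₀).rootMultiplicity x = q) :
    ∃ L, Tendsto (fun h => (h ^ q)⁻¹ * (monicPoly fun j => a j (t₀ + h)).eval (x + h * z))
      (𝓝[≠] 0) (𝓝 L) := by
  obtain ⟨k, B, R, δ, ρ, hδ, -, -, hB, hh, hB0, hR, -, hfac, -⟩ :=
    exists_local_curve hI ha hp ht₀ x hq
  obtain ⟨c, hc, -⟩ := exists_scaled_limit hδ hB hh hB0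
  have hid : Tendsto (fun h : ℝ => h * z) (𝓝[≠] 0) (𝓝 0) := by
    have : Tendsto (fun h : ℝ => h) (𝓝[≠] 0) (𝓝 0) := nhdsWithin_le_nhds
    simpa using this.mul_const z
  have h1 := (continuous_eval.tendsto (c, z)).comp (hc.prodMk_nhds tendsto_const_nhds)
  have h2 := (continuous_eval.tendsto (R 0, 0)).comp
    ((hR.tendsto.mono_left nhdsWithin_le_nhds).prodMk_nhds hid)
  refine ⟨_, (h1.mul h2).congr' ?_⟩
  have hmem : Ioo (-δ) δ ∈ 𝓝 (0 : ℝ) := isOpen_Ioo.mem_nhds (by simp [hδ])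
  filter_upwards [self_mem_nhdsWithin, nhdsWithin_le_nhds hmem] with h hne hhδ
  have hne : h ≠ 0 := hne
  have e1 : (monicPoly fun j => a j (t₀ + h)).eval (x + h * z) =
      (monicPoly (B h)).eval (h * z) * (monicPoly (R h)).eval (h * z) := by
    rw [← eval_mul, ← hfac h hhδ]
    simp [add_comm]
  have e2 := dilate_eval h (dilate h⁻¹ (B h)) z
  rw [dilate_dilate, mul_inv_cancel₀ hne, dilate_one] at e2
  rw [e1, e2]
  simp only [Function.comp_apply]
  field_simp

/-- For each `x`, left and right limits of the same rescaled polynomial coincide, so the slopes of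
the roots through `x` form the same multiset on both sides. -/
lemma exists_perm_slopes (hI : IsOpen I) (ha : IsHyperbolicCurve p I a)
    (hp : IsMaximalMultiplicity I a p) {r : Fin n → ℝ → ℝ} (hsys : IsRootSystem I a r)
    (hc : ∀ j, ContinuousOn (r j) I) {t₀ : ℝ} (ht₀ : t₀ ∈ I) {m m' : Fin n → ℝ}
    (hm : ∀ j, Tendsto (fun h => h⁻¹ * (r j (t₀ + h) - r j t₀)) (𝓝[<] 0) (𝓝 (m j)))
    (hm' : ∀ j, Tendsto (fun h => h⁻¹ * (r j (t₀ + h) - r j t₀)) (𝓝[>] 0) (𝓝 (m' j))) :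
    ∃ σ : Equiv.Perm (Fin n), ∀ j, r (σ j) t₀ = r j t₀ ∧ m' (σ j) = m j := by
  have hca : ∀ j, ContinuousAt (r j) t₀ := fun j => (hc j).continuousAt (hI.mem_nhds ht₀)
  have hlt : 𝓝[<] (0 : ℝ) ≤ 𝓝[≠] 0 := nhdsWithin_mono _ fun x hx => ne_of_lt (mem_Iio.1 hx)
  have hgt : 𝓝[>] (0 : ℝ) ≤ 𝓝[≠] 0 := nhdsWithin_mono _ fun x hx => ne_of_gt (mem_Ioi.1 hx)
  have hI0 : ∀ᶠ h in 𝓝 (0 : ℝ), t₀ + h ∈ I := by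
    have : Tendsto (fun h => t₀ + h) (𝓝 0) (𝓝 t₀) := by
      simpa using (continuous_const.add continuous_id).tendsto (f := fun h : ℝ => t₀ + h) 0
    exact this.eventually (hI.mem_nhds ht₀)
  have hpoly : ∀ x, ∏ j ∈ Finset.univ.filter (fun j => r j t₀ = x), (X - C (m j)) =
      ∏ j ∈ Finset.univ.filter (fun j => r j t₀ = x), (X - C (m' j)) := by
    intro x
    refine Polynomial.funext fun z => ?_
    have hq : (monicPoly fun j => a j t₀).rootMultiplicity x =
        (Finset.univ.filter fun j => r j t₀ = x).card := by
      rw [hsys t₀ ht₀]; exact rootMultiplicity_prod _ x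
    obtain ⟨L, hL⟩ := exists_tendsto_scaled_eval hI ha hp ht₀ x z hq
    have hL' : Tendsto (fun h => (h ^ (Finset.univ.filter fun j => r j t₀ = x).card)⁻¹ *
        ∏ j, (x + h * z - r j (t₀ + h))) (𝓝[≠] 0) (𝓝 L) := by
      refine hL.congr' ?_
      filter_upwards [nhdsWithin_le_nhds hI0] with h hh
      rw [hsys _ hh, eval_prod]
      simp
    have h1 := tendsto_nhds_unique (tendsto_scaled_prod hlt hca hm x z) (hL'.mono_left hlt)
    have h2 := tendsto_nhds_unique (tendsto_scaled_prod hgt hca hm' x z) (hL'.mono_left hgt)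
    have hne : ∏ j ∈ Finset.univ.filter (fun j => ¬ r j t₀ = x), (x - r j t₀) ≠ 0 :=
      Finset.prod_ne_zero_iff.2 fun j hj =>
        sub_ne_zero.2 fun he => (Finset.mem_filter.1 hj).2 he.symm
    simpa [eval_prod] using mul_right_cancel₀ hne (h1.trans h2.symm)
  have hroots : ∀ (s : Finset (Fin n)) (w : Fin n → ℝ),
      (∏ j ∈ s, (X - C (w j))).roots = s.val.map w := fun s w => by
    have := roots_multiset_prod_X_sub_C (s.val.map w)
    rwa [Multiset.map_map] at this
  -- Equal fibre cardinalities for the pairs (value, slope) produce a permutation respecting both.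
  have hcard : ∀ y : ℝ × ℝ, Fintype.card {j // (r j t₀, m j) = y} =
      Fintype.card {j // (r j t₀, m' j) = y} := by
    rintro ⟨x, y⟩
    have := congrArg (fun P => P.roots.count y) (hpoly x)
    simp only [hroots, Multiset.count_map, ← Finset.filter_val, Finset.filter_filter,
      ← Finset.card_def] at this
    rw [Fintype.card_subtype, Fintype.card_subtype]
    simpa only [Prod.mk.injEq, @eq_comm _ y] using this
  have e : ∀ y : ℝ × ℝ, {j // (r j t₀, m j) = y} ≃ {j // (r j t₀, m' j) = y} := fun y =>
    Fintype.equivOfCardEq (hcard y)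
  refine ⟨Equiv.ofFiberEquiv (f := fun j => (r j t₀, m j)) (g := fun j => (r j t₀, m' j)) e,
    fun j => ?_⟩
  exact Prod.ext_iff.1 (Equiv.ofFiberEquiv_map (f := fun j => (r j t₀, m j))
    (g := fun j => (r j t₀, m' j)) e j)

/-! ### Systems differentiable at finitely many points -/

/-- Switch branches by the permutation after `t₀`. Away from `t₀` this only relabels the roots
locally, so differentiability already achieved is kept. -/
lemma exists_system_differentiableAt_insert (hI : IsOpen I) (ha : IsHyperbolicCurve p I a)
    (hp : IsMaximalMultiplicity I a p) {r : Fin n → ℝ → ℝ} (hsys : IsRootSystem I a r)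
    (hc : ∀ j, ContinuousOn (r j) I) {t₀ : ℝ} (ht₀ : t₀ ∈ I) :
    ∃ r' : Fin n → ℝ → ℝ, IsRootSystem I a r' ∧ (∀ j, ContinuousOn (r' j) I) ∧
      (∀ j, DifferentiableAt ℝ (r' j) t₀) ∧
      ∀ t, t ≠ t₀ → (∀ j, DifferentiableAt ℝ (r j) t) → ∀ j, DifferentiableAt ℝ (r' j) t := by
  have hs := fun j => exists_one_sided_slopes hI ha hp (hc j) (hsys.isRootCurve j) ht₀
  choose hs1 hs2 using hs
  choose m hm _ using hs1
  choose m' hm' _ using hs2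
  obtain ⟨σ, hσ⟩ := exists_perm_slopes hI ha hp hsys hc ht₀ hm hm'
  refine ⟨fun j t => if t ≤ t₀ then r j t else r (σ j) t, fun t ht => ?_, fun j => ?_,
    fun j => ?_, fun t htne hd j => ?_⟩
  · rw [hsys t ht]
    by_cases h : t ≤ t₀
    · simp only [h, if_true]
    · simp only [h, if_false]
      exact (Equiv.prod_comp σ fun j => X - C (r j t)).symm
  · refine ContinuousOn.if (fun t ht => ?_) ((hc j).mono inter_subset_left)
      ((hc (σ j)).mono inter_subset_left)
    have : t = t₀ := by
      have h := ht.2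
      change t ∈ frontier (Iic t₀) at h
      rw [frontier_Iic] at h
      exact h
    rw [this, (hσ j).1]
  · have h1 : HasDerivWithinAt (fun t => if t ≤ t₀ then r j t else r (σ j) t) (m j) (Iio t₀) t₀ :=
      (hasDerivWithinAt_Iio_of_tendsto (hm j)).congr
        (fun t ht => if_pos (mem_Iio.1 ht).le) (if_pos le_rfl)
    have h2 : HasDerivWithinAt (fun t => if t ≤ t₀ then r j t else r (σ j) t) (m j) (Ioi t₀) t₀ := by
      rw [← (hσ j).2]
      exact (hasDerivWithinAt_Ioi_of_tendsto (hm' (σ j))).congr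
        (fun t ht => if_neg (mem_Ioi.1 ht).not_ge) ((if_pos le_rfl).trans (hσ j).1.symm)
    have h3 := (hasDerivWithinAt_Iio_iff_Iic.1 h1).union (hasDerivWithinAt_Ioi_iff_Ici.1 h2)
    rw [Iic_union_Ici, hasDerivWithinAt_univ] at h3
    exact h3.differentiableAt
  · rcases lt_or_gt_of_ne htne with h | h
    · refine (hd j).congr_of_eventuallyEq ?_
      filter_upwards [Iio_mem_nhds h] with s hs
      exact if_pos (mem_Iio.1 hs).le
    · refine (hd (σ j)).congr_of_eventuallyEq ?_
      filter_upwards [Ioi_mem_nhds h] with s hs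
      exact if_neg (mem_Ioi.1 hs).not_ge

lemma exists_system_differentiableAt_finset (hI : IsOpen I) (ha : IsHyperbolicCurve p I a)
    (hp : IsMaximalMultiplicity I a p) (F : Finset ℝ) :
    ∃ r : Fin n → ℝ → ℝ, IsRootSystem I a r ∧ (∀ j, ContinuousOn (r j) I) ∧
      ∀ t ∈ F, t ∈ I → ∀ j, DifferentiableAt ℝ (r j) t := by
  induction F using Finset.induction_on with
  | empty =>
    obtain ⟨r, h1, h2⟩ := exists_continuousOn_roots (A := fun t j => a j t)
      ha.contDiffOn_vec.continuousOn ha.hyperbolic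
    exact ⟨r, h1, h2, by simp⟩
  | insert t₀ F _ ih =>
    obtain ⟨r, h1, h2, h3⟩ := ih
    by_cases ht₀ : t₀ ∈ I
    · obtain ⟨r', h1', h2', h4, h5⟩ := exists_system_differentiableAt_insert hI ha hp h1 h2 ht₀
      refine ⟨r', h1', h2', fun t ht htI => ?_⟩
      rcases eq_or_ne t t₀ with rfl | hne
      · exact h4
      · exact h5 t hne (h3 t (Finset.mem_of_mem_insert_of_ne ht hne) htI)
    · refine ⟨r, h1, h2, fun t ht htI => h3 t ?_ htI⟩
      exact Finset.mem_of_mem_insert_of_ne ht fun he => ht₀ (he ▸ htI)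

/-! ### Uniform differentiability -/

lemma abs_sub_sub_le_of_slope {f : ℝ → ℝ} {S : Set ℝ} [(𝓝[S] (0 : ℝ)).NeBot] {ε d : ℝ}
    (hf : ∀ s ∈ S, ∀ t ∈ S, |s⁻¹ * f s - t⁻¹ * f t| < ε) (h0 : (0 : ℝ) ∉ S)
    (hd : Tendsto (fun h => h⁻¹ * f h) (𝓝[≠] 0) (𝓝 d)) {h : ℝ} (hh : h ∈ S) :
    |f h - d * h| ≤ ε * |h| := by
  have hne : h ≠ 0 := fun he => h0 (he ▸ hh)
  have hle : 𝓝[S] (0 : ℝ) ≤ 𝓝[≠] 0 := nhdsWithin_mono _ fun x hx he => h0 (he ▸ hx)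
  have h1 : |h⁻¹ * f h - d| ≤ ε := by
    refine le_of_tendsto ((hd.mono_left hle).const_sub (h⁻¹ * f h)).abs ?_
    filter_upwards [self_mem_nhdsWithin] with k hk
    exact (hf h hh k hk).le
  have e : f h - d * h = (h⁻¹ * f h - d) * h := by field_simp
  rw [e, abs_mul]
  exact mul_le_mul_of_nonneg_right h1 (abs_nonneg h)

/-- The order of quantifiers is the point: the neighbourhood serves all roots `r` through `x` at
once, because the oscillation of slopes is bounded uniformly. -/
lemma eventually_abs_sub_sub_le_of_eq (hI : IsOpen I) (ha : IsHyperbolicCurve p I a)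
    (hp : IsMaximalMultiplicity I a p) {t₀ : ℝ} (ht₀ : t₀ ∈ I) (x : ℝ) {ε : ℝ} (hε : 0 < ε) :
    ∀ᶠ t in 𝓝 t₀, ∀ (r : ℝ → ℝ) (d : ℝ), r t₀ = x → ContinuousOn r I → IsRootCurve I a r →
      HasDerivAt r d t₀ → |r t - r t₀ - d * (t - t₀)| ≤ ε * |t - t₀| := by
  obtain ⟨k, B, R, δ, ρ, hδ, hρ, hin, hB, hh, hB0, -, -, -, hBr⟩ :=
    exists_local_curve hI ha hp ht₀ x rfl
  obtain ⟨c, hc, -⟩ := exists_scaled_limit hδ hB hh hB0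
  obtain ⟨δ₁, hδ₁, hosc⟩ := exists_slope_oscillation hc hε
  obtain ⟨W, hW, hWo⟩ := exists_uniform_oscillation (fun j => a j t₀) hρ
  have hAc : ContinuousAt (fun t j => a j t) t₀ :=
    ha.contDiffOn_vec.continuousOn.continuousAt (hI.mem_nhds ht₀)
  obtain ⟨δ₂, hδ₂, hWb⟩ := Metric.eventually_nhds_iff.1 (hAc.eventually_mem hW)
  set η := min δ (min δ₁ δ₂) with hη
  have hη0 : 0 < η := lt_min hδ (lt_min hδ₁ hδ₂)
  have hsub1 : Ioo (-η) η ⊆ Ioo (-δ) δ := Ioo_subset_Ioo (neg_le_neg (min_le_left _ _))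
    (min_le_left _ _)
  have hη1 : η ≤ δ₁ := (min_le_right _ _).trans (min_le_left _ _)
  have hη2 : η ≤ δ₂ := (min_le_right _ _).trans (min_le_right _ _)
  filter_upwards [Metric.ball_mem_nhds t₀ hη0] with t ht r d hx hr hroot hd
  rcases eq_or_ne t t₀ with rfl | hne
  · simp
  have hfc : ContinuousOn (fun h => r (t₀ + h)) (Ioo (-η) η) :=
    ContinuousOn.comp (g := r) (f := fun h => t₀ + h) hr (by fun_prop)
      fun h hh' => hin h (hsub1 hh')
  have hnear : ∀ h ∈ Ioo (-η) η, |r (t₀ + h) - x| < ρ := by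
    intro h hh'
    have := hWo (Ioo (-η) η) (fun h j => a j (t₀ + h)) (fun h => r (t₀ + h)) isPreconnected_Ioo
      (fun s hs => hWb ?_) hfc (fun s hs => hroot _ (hin s (hsub1 hs))) h hh' 0 (by simp [hη0])
    · simpa only [add_zero, hx] using this
    · rw [Real.dist_eq, add_sub_cancel_left]
      exact (abs_lt.2 hs).trans_le hη2
  have hfroot : ∀ h ∈ Ioo (-η) η, (monicPoly (B h)).IsRoot (r (t₀ + h) - x) := fun h hh' =>
    hBr h (hsub1 hh') _ (hnear h hh') (hroot _ (hin h (hsub1 hh')))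
  have hslope : Tendsto (fun h => h⁻¹ * (r (t₀ + h) - x)) (𝓝[≠] 0) (𝓝 d) := by
    simpa only [smul_eq_mul, hx] using hd.tendsto_slope_zero
  have hosc' : ∀ S ⊆ Ioo (-η) η, IsPreconnected S → (0 : ℝ) ∉ S → ∀ s ∈ S, ∀ t ∈ S,
      |s⁻¹ * (r (t₀ + s) - x) - t⁻¹ * (r (t₀ + t) - x)| < ε := fun S hS hSc h0 =>
    hosc S (fun h => r (t₀ + h) - x) hSc
      (hS.trans (Ioo_subset_Ioo (neg_le_neg hη1) hη1)) h0
      ((hfc.mono hS).sub continuousOn_const) fun h hh' => hfroot h (hS hh')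
  have ht' : |t - t₀| < η := by rwa [Metric.mem_ball, Real.dist_eq] at ht
  obtain ⟨hl, hu⟩ := abs_lt.1 ht'
  have key : |(fun h => r (t₀ + h) - x) (t - t₀) - d * (t - t₀)| ≤ ε * |t - t₀| := by
    rcases lt_or_gt_of_ne hne with h | h
    · have : (𝓝[Ioo (-η) 0] (0 : ℝ)).NeBot := by
        rw [nhdsWithin_Ioo_eq_nhdsLT (neg_neg_of_pos hη0)]; infer_instance
      exact abs_sub_sub_le_of_slope (hosc' (Ioo (-η) 0) (Ioo_subset_Ioo_right hη0.le)
        isPreconnected_Ioo (by simp)) (by simp) hslope ⟨hl, sub_neg.2 h⟩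
    · have : (𝓝[Ioo 0 η] (0 : ℝ)).NeBot := by
        rw [nhdsWithin_Ioo_eq_nhdsGT hη0]; infer_instance
      exact abs_sub_sub_le_of_slope (hosc' (Ioo 0 η) (Ioo_subset_Ioo_left (by linarith))
        isPreconnected_Ioo (by simp)) (by simp) hslope ⟨sub_pos.2 h, hu⟩
  simpa only [add_sub_cancel, hx] using key

lemma eventually_abs_sub_sub_le (hI : IsOpen I) (ha : IsHyperbolicCurve p I a)
    (hp : IsMaximalMultiplicity I a p) {t₀ : ℝ} (ht₀ : t₀ ∈ I) {ε : ℝ} (hε : 0 < ε) :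
    ∀ᶠ t in 𝓝 t₀, ∀ (r : ℝ → ℝ) (d : ℝ), ContinuousOn r I → IsRootCurve I a r →
      HasDerivAt r d t₀ → |r t - r t₀ - d * (t - t₀)| ≤ ε * |t - t₀| := by
  have h := (Finset.eventually_all (monicPoly fun j => a j t₀).roots.toFinset).2 fun x _ =>
    eventually_abs_sub_sub_le_of_eq hI ha hp ht₀ x hε
  filter_upwards [h] with t ht r d hr hroot hd
  refine ht (r t₀) ?_ r d rfl hr hroot hd
  rw [Multiset.mem_toFinset, mem_roots (monicPoly_monic _).ne_zero]
  exact hroot t₀ ht₀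

/-! ### A differentiable system of the roots -/

lemma exists_tendsto_of_bounded {ι : Type*} (U : Ultrafilter ι) {f : ι → ℝ} {M : ℝ}
    (h : ∀ᶠ i in U, |f i| ≤ M) : ∃ x, Tendsto f U (𝓝 x) := by
  obtain ⟨x, -, hx⟩ := (isCompact_closedBall (0 : ℝ) M).ultrafilter_le_nhds (U.map f) (by
    rw [le_principal_iff]
    change ∀ᶠ i in U, f i ∈ Metric.closedBall 0 M
    filter_upwards [h] with i hi
    simpa using hi)
  exact ⟨x, hx⟩

/-- Take a pointwise ultralimit of systems differentiable on larger and larger finite sets. The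
uniform remainder estimate passes to the limit, so neither gluing nor a choice of consecutive points
is needed. -/
theorem exists_differentiable_system (hI : IsOpen I) (ha : IsHyperbolicCurve p I a)
    (hp : IsMaximalMultiplicity I a p) :
    ∃ r : Fin n → ℝ → ℝ, IsRootSystem I a r ∧ ∀ j, DifferentiableOn ℝ (r j) I := by
  choose s hsys hc hd using fun F : Finset ℝ =>
    exists_system_differentiableAt_finset (a := a) hI ha hp F
  let U : Ultrafilter (Finset ℝ) := Ultrafilter.of atTop
  -- The ultrafilter refines `atTop` on finite sets, so each fixed time is eventually a point of
  -- differentiability.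
  have hU : ∀ t, ∀ᶠ F in (U : Filter (Finset ℝ)), t ∈ F := fun t =>
    (Ultrafilter.of_le atTop) (by
      filter_upwards [eventually_ge_atTop {t}] with F hF using hF (Finset.mem_singleton_self t))
  have hb : ∀ F j, ∀ t ∈ I, |s F j t| ≤ 1 + n * ‖fun j => a j t‖ := fun F j t ht =>
    abs_root_le ((hsys F).isRootCurve j t ht)
  have hlim : ∀ j t, ∃ x, t ∈ I → Tendsto (fun F => s F j t) U (𝓝 x) := fun j t => by
    by_cases ht : t ∈ I
    · obtain ⟨x, hx⟩ := exists_tendsto_of_bounded U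
        (Eventually.of_forall fun F => hb F j t ht)
      exact ⟨x, fun _ => hx⟩
    · exact ⟨0, fun h => absurd h ht⟩
  choose r hr using hlim
  refine ⟨r, fun t ht => Polynomial.funext fun z => ?_, fun j t₀ ht₀ => ?_⟩
  · have h1 : Tendsto (fun F => ∏ j, (z - s F j t)) U (𝓝 (∏ j, (z - r j t))) :=
      tendsto_finsetProd _ fun j _ => (hr j t ht).const_sub z
    have h2 : (fun F => ∏ j, (z - s F j t)) =
        fun _ => (monicPoly fun j => a j t).eval z := by
      ext F
      rw [hsys F t ht, eval_prod]
      simp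
    rw [h2] at h1
    rw [tendsto_nhds_unique tendsto_const_nhds h1, eval_prod]
    simp
  · have hderiv : ∀ᶠ F in (U : Filter (Finset ℝ)), HasDerivAt (s F j) (deriv (s F j) t₀) t₀ := by
      filter_upwards [hU t₀] with F hF using (hd F t₀ hF ht₀ j).hasDerivAt
    have hest : ∀ ε > 0, ∀ᶠ t in 𝓝 t₀, t ∈ I ∧ ∀ᶠ F in (U : Filter (Finset ℝ)),
        |s F j t - s F j t₀ - deriv (s F j) t₀ * (t - t₀)| ≤ ε * |t - t₀| := by
      intro ε hε
      filter_upwards [eventually_abs_sub_sub_le hI ha hp ht₀ hε, hI.mem_nhds ht₀] with t ht htI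
      refine ⟨htI, ?_⟩
      filter_upwards [hderiv] with F hF using ht _ _ (hc F j) ((hsys F).isRootCurve j) hF
    -- The estimate with `ε = 1` at a single `t ≠ t₀` bounds the derivatives at `t₀`, since the
    -- roots are bounded at `t` and at `t₀`.
    obtain ⟨d, hdlim⟩ : ∃ d, Tendsto (fun F => deriv (s F j) t₀) U (𝓝 d) := by
      have hne' : ∀ᶠ t in 𝓝[≠] t₀, t ≠ t₀ := self_mem_nhdsWithin
      obtain ⟨t, ⟨htI, ht⟩, hne⟩ :=
        (((hest 1 one_pos).filter_mono nhdsWithin_le_nhds).and hne').exists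
      have hpos : 0 < |t - t₀| := abs_pos.2 (sub_ne_zero.2 hne)
      refine exists_tendsto_of_bounded U (M := ((1 + n * ‖fun j => a j t‖) +
        (1 + n * ‖fun j => a j t₀‖) + |t - t₀|) / |t - t₀|) ?_
      filter_upwards [ht] with F hF
      rw [le_div_iff₀ hpos, ← abs_mul]
      have e : deriv (s F j) t₀ * (t - t₀) = s F j t - s F j t₀ -
        (s F j t - s F j t₀ - deriv (s F j) t₀ * (t - t₀)) := by ring
      rw [e]
      refine (abs_sub _ _).trans (add_le_add ((abs_sub _ _).trans
        (add_le_add (hb F j t htI) (hb F j t₀ ht₀))) (by linarith))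
    have : HasDerivAt (r j) d t₀ := by
      rw [hasDerivAt_iff_isLittleO, Asymptotics.isLittleO_iff]
      intro ε hε
      filter_upwards [hest ε hε] with t ⟨htI, ht⟩
      rw [Real.norm_eq_abs, Real.norm_eq_abs, smul_eq_mul, mul_comm (t - t₀) d]
      refine le_of_tendsto (((hr j t htI).sub (hr j t₀ ht₀)).sub
        (hdlim.mul_const (t - t₀))).abs ht
    exact this.differentiableAt.differentiableWithinAt

end

end HyperbolicCurve

theorem theorem3 (n p : ℕ) (I : Set ℝ) (hIopen : IsOpen I) (hIint : I.OrdConnected)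
    (a : Fin n → ℝ → ℝ)
    (ha : HyperbolicCurve.IsHyperbolicCurve p I a)
    (hp : HyperbolicCurve.IsMaximalMultiplicity I a p) :
    (∀ r : ℝ → ℝ, ContinuousOn r I → HyperbolicCurve.IsRootCurve I a r →
      (∀ t ∈ I, DifferentiableWithinAt ℝ r (Iio t) t ∧ DifferentiableWithinAt ℝ r (Ioi t) t) ∧
      (∀ t₀ ∈ I,
        Tendsto (HyperbolicCurve.leftDeriv r) (𝓝[<] t₀) (𝓝 (HyperbolicCurve.leftDeriv r t₀)) ∧
        Tendsto (HyperbolicCurve.rightDeriv r) (𝓝[<] t₀) (𝓝 (HyperbolicCurve.leftDeriv r t₀)) ∧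
        Tendsto (HyperbolicCurve.leftDeriv r) (𝓝[>] t₀) (𝓝 (HyperbolicCurve.rightDeriv r t₀)) ∧
        Tendsto (HyperbolicCurve.rightDeriv r) (𝓝[>] t₀) (𝓝 (HyperbolicCurve.rightDeriv r t₀)))) ∧
    (∃ r : Fin n → ℝ → ℝ, HyperbolicCurve.IsRootSystem I a r ∧
      ∀ j, DifferentiableOn ℝ (r j) I) ∧
    (∀ r : ℝ → ℝ, DifferentiableOn ℝ r I → HyperbolicCurve.IsRootCurve I a r →
      ContDiffOn ℝ 1 r I) := by
  exact ⟨fun r hr hroot => HyperbolicCurve.one_sided_derivatives hIopen ha hp hr hroot,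
    HyperbolicCurve.exists_differentiable_system hIopen ha hp,
    fun r hr hroot => HyperbolicCurve.contDiffOn_of_differentiableOn hIopen ha hp hr hroot⟩
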